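/- All graphs are finite, simple, undirected, with at least one vertex. A cograph is a graph obtained from single-vertex graphs by disjoint unions and complementation. A \emph{cograph $k$-decomposition} of $G=(V,E)$ is a set $\{E_1,\dots,E_k\}$ of $k$ distinct sets with $E_1\cup\dots\cup E_k=E$ such that every $(V,E_i)$ is a cograph; it is a \emph{cograph $k$-partition} if moreover the $E_i$ are pairwise disjoint. A \emph{cotree} with leaf set $V$ is a rooted tree with leaf set $V$ whose inner vertices have at least two children and are labelled $0$ or $1$ so that adjacent inner vertices have different labels; its graph is the graph on $V$ in which $x\ne y$ are adjacent if and only if the label of their most recent common ancestor is $1$. A graph $G$ on $V$ is \emph{represented} by cotrees $T_1,\dots,T_k$ with leaf set $V$ if its edge set is the union of the edge sets of the graphs of $T_1,\dots,T_k$. Theorem. Every graph $G=(V,E)$ with maximum degree $\Delta$ has a cograph $k$-partition $\{E_1,\dots,E_k\}$ (in particular, a cograph $k$-decomposition) with $1\le k\le\Delta+1$ whose members are the colour classes of a proper edge colouring of $G$ with $k$ colours (all of them non-empty if $E\neq\emptyset$), and $G$ is represented by $k\le\Delta+1$ cotrees $T_1,\dots,T_k$, where the graph of $T_i$ is $(V,E_i)$.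 Moreover, there is an algorithm (on a random access machine with unit-cost operations on words of $O(\log(|V|+1))$ bits) that, given the number of vertices and a list of the edges of $G$, computes such a colouring and such cotrees in time $O(|V||E|+\Delta(|V|+|E|))$ if $E\ne\emptyset$, and in time $O(|V|)$ if $E=\emptyset$. -/

import Mathlib

universe u

namespace CographDec

/-! ### Cographs, decompositions and partitions -/

/-- Complement-reducible graphs: the graphs (up to isomorphism) formed from single-vertex graphs by
disjoint unions and complementation. -/
inductive IsCograph : ∀ {V : Type u}, SimpleGraph V → Prop
  | single {V : Type u} (G : SimpleGraph V) : Nat.card V = 1 → IsCograph G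
  | disjointUnion {V W : Type u} (G : SimpleGraph V) (H : SimpleGraph W) :
      IsCograph G → IsCograph H → IsCograph (G.sum H)
  | complement {V : Type u} (G : SimpleGraph V) : IsCograph G → IsCograph Gᶜ
  | iso {V W : Type u} (G : SimpleGraph V) (H : SimpleGraph W) :
      Nonempty (G ≃g H) → IsCograph G → IsCograph H

/-- `{E 0, …, E (k-1)}` is a cograph `k`-decomposition of `G`: `k` different edge sets (not
necessarily disjoint) with union the edge set of `G`, each of which forms a cograph on the whole
vertex set. -/
structure IsCographDecomposition {V : Type u} (G : SimpleGraph V) {k : ℕ}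
    (E : Fin k → Set (Sym2 V)) : Prop where
  injective : Function.Injective E
  union : ⋃ i, E i = G.edgeSet
  cograph : ∀ i, IsCograph (SimpleGraph.fromEdgeSet (E i))

/-- A cograph `k`-partition: a cograph `k`-decomposition into pairwise disjoint sets. -/
structure IsCographPartition {V : Type u} (G : SimpleGraph V) {k : ℕ}
    (E : Fin k → Set (Sym2 V)) : Prop extends IsCographDecomposition G E where
  disjoint : ∀ i j, i ≠ j → Disjoint (E i) (E j)

/-- The set of edges of colour `i`. A proper edge colouring of `G` is a vertex colouring of its line
graph, whose vertices are the edges of `G`. -/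
def colourClass {V : Type u} {G : SimpleGraph V} {k : ℕ} (φ : G.lineGraph.Coloring (Fin k))
    (i : Fin k) : Set (Sym2 V) :=
  {e | ∃ h : e ∈ G.edgeSet, φ ⟨e, h⟩ = i}

/-! ### Cotrees -/

/-- A finite rooted tree on the nodes `0, …, size - 1`, given by its parent map (where the root is
its own parent). -/
structure RootedTree where
  size : ℕ
  root : Fin size
  parent : Fin size → Fin size
  parent_root : parent root = root
  reaches_root : ∀ x, ∃ j : ℕ, parent^[j] x = root

namespace RootedTree

/-- `c` is a child of `x`. -/
def IsChild (T : RootedTree) (c x : Fin T.size) : Prop := c ≠ x ∧ T.parent c = x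

/-- `x` is an inner node, that is, it has a child. The other nodes are the leaves. -/
def IsInner (T : RootedTree) (x : Fin T.size) : Prop := ∃ c, T.IsChild c x

/-- `a` lies on the path from `x` to the root (possibly `a = x`). -/
def IsAncestor (T : RootedTree) (a x : Fin T.size) : Prop := ∃ j : ℕ, T.parent^[j] x = a

/-- `a` is the most recent common ancestor of `x` and `y`: the first node that lies on both paths
to the root. -/
def IsLCA (T : RootedTree) (a x y : Fin T.size) : Prop :=
  T.IsAncestor a x ∧ T.IsAncestor a y ∧
    ∀ b, T.IsAncestor b x → T.IsAncestor b y → T.IsAncestor b a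

end RootedTree

/-- A cotree with leaf set `V`: a rooted tree whose leaves are identified with `V`, whose inner
nodes have at least two children, and whose inner nodes are labelled by `true` (that is 1, "join")
and `false` (that is 0, "union") such that adjacent inner nodes have different labels. The labels of
the leaves have no meaning. -/
structure Cotree (V : Type u) extends RootedTree where
  leaf : V → Fin size
  leaf_injective : Function.Injective leaf
  range_leaf : ∀ x, (∃ v, leaf v = x) ↔ ¬ toRootedTree.IsInner x
  two_children : ∀ x, toRootedTree.IsInner x →
    ∃ c d, c ≠ d ∧ toRootedTree.IsChild c x ∧ toRootedTree.IsChild d x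
  label : Fin size → Bool
  label_ne : ∀ x c, toRootedTree.IsInner x → toRootedTree.IsInner c → toRootedTree.IsChild c x →
    label x ≠ label c

/-- The graph of a cotree: different vertices are adjacent iff the label of their most recent common
ancestor is 1. -/
def Cotree.graph {V : Type u} (T : Cotree V) : SimpleGraph V where
  Adj x y := x ≠ y ∧ ∃ a, T.toRootedTree.IsLCA a (T.leaf x) (T.leaf y) ∧ T.label a = true
  symm := ⟨fun _ _ h => ⟨h.1.symm, h.2.imp fun _ ha =>
    ⟨⟨ha.1.2.1, ha.1.1, fun b hy hx => ha.1.2.2 b hx hy⟩, ha.2⟩⟩⟩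
  loopless := ⟨fun _ h => h.1 rfl⟩

/-- `G` is represented by the cotrees `T 0, …, T (k-1)`: two vertices are adjacent in `G` iff the
label of their most recent common ancestor is 1 in at least one of the trees. -/
def IsRepresentedBy {V : Type u} (G : SimpleGraph V) {k : ℕ} (T : Fin k → Cotree V) : Prop :=
  ∀ x y, G.Adj x y ↔ ∃ i, (T i).graph.Adj x y

/-! ### A word RAM

Programs of a random access machine with structured control flow. A program mentions finitely many
registers and finitely many arrays, all of them holding natural numbers. -/

/-- The memory: registers `var x` and arrays `arr a`. -/
structure State where
  var : ℕ → ℕ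
  arr : ℕ → ℕ → ℕ

def State.setVar (σ : State) (x v : ℕ) : State :=
  { σ with var := Function.update σ.var x v }

def State.setArr (σ : State) (a i v : ℕ) : State :=
  { σ with arr := Function.update σ.arr a (Function.update (σ.arr a) i v) }

/-- Expressions; `get a e` is the entry of the array `a` at the index `e`, and `sub` is truncated
subtraction. -/
inductive Expr
  | const (c : ℕ)
  | var (x : ℕ)
  | get (a : ℕ) (e : Expr)
  | add (e f : Expr)
  | sub (e f : Expr)
  | mul (e f : Expr)
  | lt (e f : Expr)
  | eq (e f : Expr)

def Expr.eval (σ : State) : Expr → ℕ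
  | const c => c
  | var x => σ.var x
  | get a e => σ.arr a (e.eval σ)
  | add e f => e.eval σ + f.eval σ
  | sub e f => e.eval σ - f.eval σ
  | mul e f => e.eval σ * f.eval σ
  | lt e f => if e.eval σ < f.eval σ then 1 else 0
  | eq e f => if e.eval σ = f.eval σ then 1 else 0

/-- The time for evaluating an expression: one step for each constant, memory access and
operation in it. -/
def Expr.cost : Expr → ℕ
  | const _ => 1
  | var _ => 1
  | get _ e => e.cost + 1
  | add e f => e.cost + f.cost + 1
  | sub e f => e.cost + f.cost + 1
  | mul e f => e.cost + f.cost + 1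
  | lt e f => e.cost + f.cost + 1
  | eq e f => e.cost + f.cost + 1

/-- Programs: do nothing, `x := e`, `a[i] := e`, composition, `if e ≠ 0`, `while e ≠ 0`. -/
inductive Prog
  | skip
  | assign (x : ℕ) (e : Expr)
  | store (a : ℕ) (i e : Expr)
  | seq (p q : Prog)
  | ite (e : Expr) (p q : Prog)
  | while (e : Expr) (p : Prog)

/-- `Exec W p σ τ t`: the program `p`, started in the memory `σ`, halts after exactly `t` steps in
the memory `τ`, and all numbers (and array indices) that it writes to the memory are at most `W`. -/
inductive Exec (W : ℕ) : Prog → State → State → ℕ → Prop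
  | skip (σ : State) : Exec W .skip σ σ 1
  | assign (σ : State) (x : ℕ) (e : Expr) : e.eval σ ≤ W →
      Exec W (.assign x e) σ (σ.setVar x (e.eval σ)) (e.cost + 1)
  | store (σ : State) (a : ℕ) (i e : Expr) : i.eval σ ≤ W → e.eval σ ≤ W →
      Exec W (.store a i e) σ (σ.setArr a (i.eval σ) (e.eval σ)) (i.cost + e.cost + 1)
  | seq (σ τ ρ : State) (p q : Prog) (s t : ℕ) : Exec W p σ τ s → Exec W q τ ρ t →
      Exec W (.seq p q) σ ρ (s + t)
  | ite_true (σ τ : State) (e : Expr) (p q : Prog) (t : ℕ) : e.eval σ ≠ 0 → Exec W p σ τ t →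
      Exec W (.ite e p q) σ τ (e.cost + 1 + t)
  | ite_false (σ τ : State) (e : Expr) (p q : Prog) (t : ℕ) : e.eval σ = 0 → Exec W q σ τ t →
      Exec W (.ite e p q) σ τ (e.cost + 1 + t)
  | while_true (σ τ ρ : State) (e : Expr) (p : Prog) (s t : ℕ) : e.eval σ ≠ 0 → Exec W p σ τ s →
      Exec W (.while e p) τ ρ t → Exec W (.while e p) σ ρ (e.cost + 1 + s + t)
  | while_false (σ : State) (e : Expr) (p : Prog) : e.eval σ = 0 →
      Exec W (.while e p) σ σ (e.cost + 1)

/-! ### Input and output -/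

/-- `L` lists the edges of `G`, each exactly once, in any order and with any orientation. -/
def IsEdgeList {n : ℕ} (G : SimpleGraph (Fin n)) (L : List (Fin n × Fin n)) : Prop :=
  (L.map fun p => s(p.1, p.2)).Nodup ∧ ∀ e, e ∈ (L.map fun p => s(p.1, p.2)) ↔ e ∈ G.edgeSet

/-- The initial memory: register 0 holds the number of vertices, register 1 the number of edges,
arrays 0 and 1 the two ends of each edge; everything else is 0. -/
def inputState {n : ℕ} (L : List (Fin n × Fin n)) : State where
  var x := if x = 0 then n else if x = 1 then L.length else 0
  arr a j :=
    if a = 0 then (L.map fun p => (p.1 : ℕ)).getD j 0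
    else if a = 1 then (L.map fun p => (p.2 : ℕ)).getD j 0
    else 0

/-- The final memory `τ` holds the edge colouring `φ` and the cotrees `T 0, …, T (k-1)`: register 2
holds `k`, and array 2 the colour of each edge of the list. The nodes of the `i`th tree, whose number
is in entry `i` of array 4, have their parents in array 5 and their labels in array 6, both from the
position on that is in entry `i` of array 3. The leaf of the vertex `v` is the node `v`. -/
structure IsOutput {n : ℕ} (G : SimpleGraph (Fin n)) (L : List (Fin n × Fin n)) (τ : State) {k : ℕ}
    (φ : G.lineGraph.Coloring (Fin k)) (T : Fin k → Cotree (Fin n)) : Prop where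
  numColours : τ.var 2 = k
  colour : ∀ (j : ℕ) (hj : j < L.length) (he : s(L[j].1, L[j].2) ∈ G.edgeSet),
    τ.arr 2 j = φ ⟨s(L[j].1, L[j].2), he⟩
  size : ∀ i : Fin k, τ.arr 4 i = (T i).size
  parent : ∀ (i : Fin k) (x : Fin (T i).size), τ.arr 5 (τ.arr 3 i + x) = (T i).parent x
  label : ∀ (i : Fin k) (x : Fin (T i).size),
    τ.arr 6 (τ.arr 3 i + x) = if (T i).label x = true then 1 else 0
  leaf : ∀ (i : Fin k) (v : Fin n), ((T i).leaf v : ℕ) = v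

end CographDec

/-!
By Vizing's theorem, a graph of maximum degree `Δ` has a proper edge colouring with at most `Δ + 1`
colours, and the colour classes of a proper edge colouring are matchings. A matching is a cograph,
as it is a disjoint union of edges and vertices (`IsCograph.of_matching`), and it has an evident
cotree: on at least three vertices, the root has label 0, its children are the uncovered vertices
and one inner node with label 1 for each edge (`IsMatchingTree.isCotreeData`). Classes without an
edge are avoided by numbering only the colours that are used.

The existence statement is read off from the program, which is run on a copy of the graph with the
vertices `0, …, n - 1`. As the memory is 0 at the beginning, tables indexed by pairs cost nothing to
set up; the table of the colouring contains, for each vertex and colour, the neighbour along the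
edge of this colour, and there is an array with one free colour for each vertex
(`PartialColouring`). With `n` vertices and `m` edges, the time bound permits `O(n)` steps for each
edge, and no more are needed, neither for the colouring nor for the cotrees.

An edge `uv` is coloured as follows. The stored free colours lead from `v` along a fan at `u`: the
vertex after `x` is the one joined to `u` by an edge which has the free colour of `x`. The fan is
followed until it comes to a colour that is free at `u`, or that repeats (`runs_fanWalk`). In the
second case, there are vertices `x` and `y` of the fan with the same free colour `d`. Let `c` be
free at `u`, and exchange the colours `c` and `d` along the path that starts in `x`. If the path
avoids `u`, then `c` is free at `x` and `u` afterwards, so that the fan may stop at `x`. Otherwise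
the path ends in `u`, and so does not contain `y`; now `x` provides `c`, which is the new colour of
the edge that used to have the colour `d`, and the fan leads as before to `y`, whose free colour `d`
has become free at `u` (`KempeWalk.exists_fan`). In each case, the uncoloured edge can be moved
along the fan to its last vertex, and coloured there (`runs_shiftLoop`, `runs_colourEdge`). When a
vertex `x` gives its free colour to the edge `ux`, it needs another one. For `v` it is found by a
search, which succeeds because of the uncoloured edge at `v`; the other vertices get back the colour
of their previous edge to `u`. Hence a step along the fan takes constant time.

Programs are verified in a Hoare logic with time bounds (`Runs`), in which programs without loops
are evaluated symbolically (`Runs.of_safe`). The constants in the time bounds are generous.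
-/

namespace CographDec

/-! ### Timed Hoare logic for the word RAM -/

@[simp] theorem State.setVar_var (σ : State) (x v y : ℕ) :
    (σ.setVar x v).var y = if y = x then v else σ.var y := by
  simp [State.setVar, Function.update_apply]

@[simp] theorem State.setVar_arr (σ : State) (x v : ℕ) : (σ.setVar x v).arr = σ.arr := rfl

@[simp] theorem State.setArr_var (σ : State) (a i v : ℕ) : (σ.setArr a i v).var = σ.var := rfl

@[simp] theorem State.setArr_arr (σ : State) (a i v b : ℕ) :
    (σ.setArr a i v).arr b = if b = a then Function.update (σ.arr a) i v else σ.arr b := by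
  simp only [State.setArr, Function.update_apply]

/-- Started in `σ`, the program `P` halts within time `T` in a state satisfying `Q`, and it respects
the word size `W`. -/
def Runs (W : ℕ) (P : Prog) (σ : State) (T : ℕ) (Q : State → Prop) : Prop :=
  ∃ τ t, Exec W P σ τ t ∧ t ≤ T ∧ Q τ

namespace Prog

/-- The final state of a program without loops (loops are treated as `skip`). -/
def run : Prog → State → State
  | skip, σ => σ
  | assign x e, σ => σ.setVar x (e.eval σ)
  | store a i e, σ => σ.setArr a (i.eval σ) (e.eval σ)
  | seq p q, σ => q.run (p.run σ)
  | ite e p q, σ => if e.eval σ = 0 then q.run σ else p.run σ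
  | .while _ _, σ => σ

/-- A program without loops respects the word size `W` when started in `σ`. -/
def Safe (W : ℕ) : Prog → State → Prop
  | skip, _ => True
  | assign _ e, σ => e.eval σ ≤ W
  | store _ i e, σ => i.eval σ ≤ W ∧ e.eval σ ≤ W
  | seq p q, σ => p.Safe W σ ∧ q.Safe W (p.run σ)
  | ite e p q, σ => (e.eval σ ≠ 0 → p.Safe W σ) ∧ (e.eval σ = 0 → q.Safe W σ)
  | .while _ _, _ => False

/-- An upper bound for the running time of a program without loops. -/
def bound : Prog → ℕ
  | skip => 1
  | assign _ e => e.cost + 1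
  | store _ i e => i.cost + e.cost + 1
  | seq p q => p.bound + q.bound
  | ite e p q => e.cost + 1 + max p.bound q.bound
  | .while _ _ => 0

/-- The program contains an assignment to the register `x`. -/
def writesVar : Prog → ℕ → Bool
  | skip, _ => false
  | assign y _, x => x == y
  | store _ _ _, _ => false
  | seq p q, x => p.writesVar x || q.writesVar x
  | ite _ p q, x => p.writesVar x || q.writesVar x
  | .while _ p, x => p.writesVar x

/-- The program contains an assignment to an entry of the array `a`. -/
def writesArr : Prog → ℕ → Bool
  | skip, _ => false
  | assign _ _, _ => false
  | store b _ _, a => a == b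
  | seq p q, a => p.writesArr a || q.writesArr a
  | ite _ p q, a => p.writesArr a || q.writesArr a
  | .while _ p, a => p.writesArr a

end Prog

/-- `σ` and `τ` agree on all the registers and arrays to which `P` never writes. -/
structure Frame (P : Prog) (σ τ : State) : Prop where
  var : ∀ x, P.writesVar x = false → τ.var x = σ.var x
  arr : ∀ a, P.writesArr a = false → τ.arr a = σ.arr a

theorem Frame.refl (P : Prog) (σ : State) : Frame P σ σ := ⟨fun _ _ => rfl, fun _ _ => rfl⟩

theorem Frame.trans {P : Prog} {σ τ ρ : State} (h : Frame P σ τ) (h' : Frame P τ ρ) :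
    Frame P σ ρ :=
  ⟨fun x hx => (h'.var x hx).trans (h.var x hx), fun a ha => (h'.arr a ha).trans (h.arr a ha)⟩

theorem Exec.frame {W : ℕ} {P : Prog} {σ τ : State} {t : ℕ} (h : Exec W P σ τ t) :
    Frame P σ τ := by
  induction h with
  | skip σ => exact Frame.refl _ _
  | assign σ x e h =>
    refine ⟨fun y hy => ?_, fun a _ => rfl⟩
    have : y ≠ x := by simpa [Prog.writesVar] using hy
    simp [this]
  | store σ a i e hi he =>
    refine ⟨fun y _ => rfl, fun b hb => ?_⟩
    have : b ≠ a := by simpa [Prog.writesArr] using hb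
    simp [this]
  | seq σ τ ρ p q s t _ _ ih₁ ih₂ =>
    constructor
    · intro x hx
      simp only [Prog.writesVar, Bool.or_eq_false_iff] at hx
      rw [ih₂.var x hx.2, ih₁.var x hx.1]
    · intro x hx
      simp only [Prog.writesArr, Bool.or_eq_false_iff] at hx
      rw [ih₂.arr x hx.2, ih₁.arr x hx.1]
  | ite_true σ τ e p q t _ _ ih =>
    constructor
    · intro x hx
      simp only [Prog.writesVar, Bool.or_eq_false_iff] at hx
      exact ih.var x hx.1
    · intro x hx
      simp only [Prog.writesArr, Bool.or_eq_false_iff] at hx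
      exact ih.arr x hx.1
  | ite_false σ τ e p q t _ _ ih =>
    constructor
    · intro x hx
      simp only [Prog.writesVar, Bool.or_eq_false_iff] at hx
      exact ih.var x hx.2
    · intro x hx
      simp only [Prog.writesArr, Bool.or_eq_false_iff] at hx
      exact ih.arr x hx.2
  | while_true σ τ ρ e p s t _ _ _ ih₁ ih₂ =>
    constructor
    · intro x hx
      rw [ih₂.var x hx, ih₁.var x hx]
    · intro x hx
      rw [ih₂.arr x hx, ih₁.arr x hx]
  | while_false σ e p _ => exact Frame.refl _ _

namespace Runs

variable {W : ℕ}

theorem mono {P : Prog} {σ : State} {T T' : ℕ} {Q Q' : State → Prop}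
    (h : Runs W P σ T Q) (hT : T ≤ T') (hQ : ∀ τ, Frame P σ τ → Q τ → Q' τ) :
    Runs W P σ T' Q' := by
  obtain ⟨τ, t, h, ht, hq⟩ := h
  exact ⟨τ, t, h, ht.trans hT, hQ τ h.frame hq⟩

theorem seq {p q : Prog} {σ : State} {T₁ T₂ T : ℕ} {Q R : State → Prop}
    (h₁ : Runs W p σ T₁ Q) (h₂ : ∀ τ, Frame p σ τ → Q τ → Runs W q τ T₂ R) (hT : T₁ + T₂ ≤ T) :
    Runs W (.seq p q) σ T R := by
  obtain ⟨τ, t, h, ht, hq⟩ := h₁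
  obtain ⟨ρ, t', h', ht', hr⟩ := h₂ τ h.frame hq
  exact ⟨ρ, t + t', .seq _ _ _ _ _ _ _ h h', by omega, hr⟩

theorem ite {e : Expr} {p q : Prog} {σ : State} {T' T : ℕ} {R : State → Prop}
    (h₁ : e.eval σ ≠ 0 → Runs W p σ T' R) (h₂ : e.eval σ = 0 → Runs W q σ T' R)
    (hT : e.cost + 1 + T' ≤ T) : Runs W (.ite e p q) σ T R := by
  by_cases he : e.eval σ = 0
  · obtain ⟨ρ, t, h, ht, hr⟩ := h₂ he
    exact ⟨ρ, _, .ite_false _ _ _ _ _ _ he h, by omega, hr⟩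
  · obtain ⟨ρ, t, h, ht, hr⟩ := h₁ he
    exact ⟨ρ, _, .ite_true _ _ _ _ _ _ he h, by omega, hr⟩

/-- Programs without loops are verified by evaluating them. -/
theorem of_safe {P : Prog} {σ : State} {T : ℕ} {Q : State → Prop} (hs : P.Safe W σ)
    (hT : P.bound ≤ T) (hQ : Q (P.run σ)) : Runs W P σ T Q := by
  suffices h : ∃ t, Exec W P σ (P.run σ) t ∧ t ≤ P.bound by
    obtain ⟨t, h, ht⟩ := h
    exact ⟨_, t, h, ht.trans hT, hQ⟩
  clear hT hQ
  induction P generalizing σ with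
  | skip => exact ⟨1, .skip _, le_rfl⟩
  | assign x e => exact ⟨_, .assign _ _ _ hs, le_rfl⟩
  | store a i e => exact ⟨_, .store _ _ _ _ hs.1 hs.2, le_rfl⟩
  | seq p q ih₁ ih₂ =>
    obtain ⟨t, h, ht⟩ := ih₁ hs.1
    obtain ⟨t', h', ht'⟩ := ih₂ hs.2
    exact ⟨_, .seq _ _ _ _ _ _ _ h h', Nat.add_le_add ht ht'⟩
  | ite e p q ih₁ ih₂ =>
    by_cases he : e.eval σ = 0
    · obtain ⟨t, h, ht⟩ := ih₂ (hs.2 he)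
      refine ⟨_, .ite_false _ _ _ _ _ _ he (by simpa [Prog.run, he] using h), ?_⟩
      simp only [Prog.bound]
      omega
    · obtain ⟨t, h, ht⟩ := ih₁ (hs.1 he)
      refine ⟨_, .ite_true _ _ _ _ _ _ he (by simpa [Prog.run, he] using h), ?_⟩
      simp only [Prog.bound]
      omega
  | _ => exact hs.elim

/-- The rule for loops, with an invariant `I k` in which `k` bounds the number of rounds to come. -/
theorem while_loop {e : Expr} {P : Prog} {σ : State} {B c T k : ℕ} {Q : State → Prop}
    (I : ℕ → State → Prop) (h0 : I k σ)
    (step : ∀ k τ, Frame P σ τ → I k τ → e.eval τ ≠ 0 →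
      ∃ k', k = k' + 1 ∧ Runs W P τ B (I k'))
    (hc : e.cost ≤ c) (hT : k * (B + c + 1) + c + 1 ≤ T)
    (post : ∀ k τ, Frame P σ τ → I k τ → e.eval τ = 0 → Q τ) :
    Runs W (.while e P) σ T Q := by
  suffices h : ∀ k τ, Frame P σ τ → I k τ → ∃ ρ t, Exec W (.while e P) τ ρ t ∧
      t ≤ k * (B + c + 1) + c + 1 ∧ Q ρ by
    obtain ⟨ρ, t, h, ht, hq⟩ := h k σ (Frame.refl _ _) h0
    exact ⟨ρ, t, h, ht.trans hT, hq⟩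
  intro k
  induction k with
  | zero =>
    intro τ hf hI
    have he : e.eval τ = 0 := by
      by_contra he
      obtain ⟨k', hk', -⟩ := step 0 τ hf hI he
      omega
    exact ⟨τ, _, .while_false _ _ _ he, by omega, post 0 τ hf hI he⟩
  | succ k ih =>
    intro τ hf hI
    by_cases he : e.eval τ = 0
    · exact ⟨τ, _, .while_false _ _ _ he, by omega, post _ τ hf hI he⟩
    · obtain ⟨k', hk', τ', t, h, ht, hI'⟩ := step _ τ hf hI he
      obtain rfl : k = k' := by omega
      obtain ⟨ρ, t', h', ht', hq⟩ := ih τ' (hf.trans h.frame) hI'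
      refine ⟨ρ, _, .while_true _ _ _ _ _ _ _ he h h', ?_, hq⟩
      rw [Nat.succ_mul]
      omega

/-- A loop that increments the register `x` from 0 until the condition `e` fails. -/
theorem search {e : Expr} {x : ℕ} {σ : State} {c T : ℕ} {Q : State → Prop} (B : ℕ)
    (hx : σ.var x = 0) (hB : ∃ i, i ≤ B ∧ e.eval (σ.setVar x i) = 0) (hW : B ≤ W)
    (hc : e.cost ≤ c) (hT : B * (c + 5) + c + 1 ≤ T)
    (post : ∀ i, i ≤ B → e.eval (σ.setVar x i) = 0 →
      (∀ l < i, e.eval (σ.setVar x l) ≠ 0) → Q (σ.setVar x i)) :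
    Runs W (.while e (.assign x (.add (.var x) (.const 1)))) σ T Q := by
  classical
  have hf := Nat.find_spec hB
  set i₀ := Nat.find hB with hi₀
  have hmin : ∀ l < i₀, e.eval (σ.setVar x l) ≠ 0 := fun l hl h =>
    Nat.find_min hB hl ⟨hl.le.trans hf.1, h⟩
  refine while_loop (k := i₀) (B := 4)
    (fun k τ => ∃ i, i + k = i₀ ∧ τ = σ.setVar x i) ?_ ?_ hc ?_ ?_
  · refine ⟨0, by omega, ?_⟩
    simp only [State.setVar, ← hx, Function.update_eq_self]
  · rintro k τ - ⟨i, hi, rfl⟩ he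
    rcases k with _ | k
    · simp only [add_zero] at hi
      exact (he (hi ▸ hf.2)).elim
    · refine ⟨k, rfl, of_safe ?_ le_rfl ⟨i + 1, by omega, ?_⟩⟩
      · have := hf.1
        simp only [Prog.Safe, Expr.eval, State.setVar_var, if_true]
        omega
      · simp [Prog.run, Expr.eval, State.setVar]
  · have : i₀ * (4 + c + 1) ≤ B * (c + 5) := Nat.mul_le_mul hf.1 (by omega)
    omega
  · rintro k τ - ⟨i, hi, rfl⟩ he
    have : i₀ ≤ i := by
      by_contra h
      exact hmin i (by omega) he
    exact post i (by omega) he fun l hl => hmin l (by omega)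

end Runs

/-! ### Two-dimensional arrays -/

/-- A pairing function given by a polynomial. -/
def pair (a b : ℕ) : ℕ := (a + b) * (a + b) + b

theorem pair_inj {a b c d : ℕ} : pair a b = pair c d ↔ a = c ∧ b = d := by
  refine ⟨fun h => ?_, fun h => by rw [h.1, h.2]⟩
  unfold pair at h
  have : a + b = c + d := by
    rcases lt_trichotomy (a + b) (c + d) with h' | h' | h'
    · nlinarith
    · exact h'
    · nlinarith
  rw [this] at h
  omega

theorem pair_le {a b s : ℕ} (h : a + b ≤ s) : pair a b ≤ s * s + s := by
  unfold pair
  have := Nat.mul_le_mul h h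
  omega

/-- The expression for the pairing function. -/
def Expr.pair (e f : Expr) : Expr := .add (.mul (.add e f) (.add e f)) f

@[simp] theorem Expr.eval_pair (σ : State) (e f : Expr) :
    (Expr.pair e f).eval σ = CographDec.pair (e.eval σ) (f.eval σ) := rfl

/-- The contents of an array, indexed by pairs. -/
def table (A : ℕ → ℕ) (p c : ℕ) : ℕ := A (pair p c)

/-- Overwriting one entry of a table. -/
def setAt (N : ℕ → ℕ → ℕ) (p c v : ℕ) : ℕ → ℕ → ℕ :=
  fun p' c' => if p' = p ∧ c' = c then v else N p' c'

theorem table_update (A : ℕ → ℕ) (p c v : ℕ) :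
    table (Function.update A (pair p c) v) = setAt (table A) p c v := by
  funext p' c'
  simp [table, setAt, Function.update_apply, pair_inj]

/-! ### Partial edge colourings with free colours -/

/-- `N` describes a proper colouring, with colours below `D`, of the edges of `K`: `N p c = q + 1`
if the edge `pq` has colour `c`, and `N p c = 0` if no edge at `p` has colour `c`. Moreover, `F p`
is a colour below `D` which is free at `p`. -/
structure PartialColouring (K : SimpleGraph ℕ) (D : ℕ) (N : ℕ → ℕ → ℕ) (F : ℕ → ℕ) : Prop where
  symm : ∀ {p c q}, N p c = q + 1 → N q c = p + 1
  adj : ∀ {p q}, K.Adj p q ↔ ∃ c, N p c = q + 1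
  inj : ∀ {p c c'}, N p c = N p c' → N p c ≠ 0 → c = c'
  lt : ∀ {p c}, N p c ≠ 0 → c < D
  free : ∀ p, N p (F p) = 0
  free_lt : ∀ p, F p < D

/-- Every vertex of `K` has degree at most `Δ`. -/
def DegreeLE (K : SimpleGraph ℕ) (Δ : ℕ) : Prop :=
  ∀ v (s : Finset ℕ), (∀ w ∈ s, K.Adj v w) → s.card ≤ Δ

namespace PartialColouring

variable {K : SimpleGraph ℕ} {D : ℕ} {N : ℕ → ℕ → ℕ} {F : ℕ → ℕ}

theorem adj_of (h : PartialColouring K D N F) {p c q : ℕ} (hc : N p c = q + 1) : K.Adj p q :=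
  h.adj.2 ⟨c, hc⟩

theorem ne_of (h : PartialColouring K D N F) {p c q : ℕ} (hc : N p c = q + 1) : p ≠ q :=
  (h.adj_of hc).ne

/-- Colouring an edge with a colour that is free at both ends, if the free colours of these ends are
replaced suitably. -/
theorem add_edge {u x a : ℕ} {F' : ℕ → ℕ} (h : PartialColouring (K.deleteEdges {s(u, x)}) D N F)
    (hux : K.Adj u x) (hu : N u a = 0) (hx : N x a = 0) (ha : a < D)
    (hF : ∀ p, p ≠ u → p ≠ x → F' p = F p) (hFu : N u (F' u) = 0 ∧ F' u ≠ a ∧ F' u < D)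
    (hFx : N x (F' x) = 0 ∧ F' x ≠ a ∧ F' x < D) :
    PartialColouring K D (setAt (setAt N u a (x + 1)) x a (u + 1)) F' := by
  have hne := hux.ne
  have hncol : ∀ c, N u c ≠ x + 1 := fun c hc => by
    have := h.adj_of hc
    simp at this
  have hncol' : ∀ c, N x c ≠ u + 1 := fun c hc => hncol c (h.symm hc)
  refine ⟨?_, ?_, ?_, ?_, ?_, ?_⟩
  · intro p c q
    have := @h.symm p c q
    simp only [setAt]
    grind
  · intro p q
    have key := @h.adj p q
    simp only [SimpleGraph.deleteEdges_adj, Set.mem_singleton_iff] at key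
    by_cases hpq : s(p, q) = s(u, x)
    · rcases Sym2.eq_iff.1 hpq with ⟨rfl, rfl⟩ | ⟨rfl, rfl⟩
      · exact ⟨fun _ => ⟨a, by simp [setAt, hne]⟩, fun _ => hux⟩
      · exact ⟨fun _ => ⟨a, by simp [setAt]⟩, fun _ => hux.symm⟩
    · simp only [hpq, not_false_eq_true, and_true] at key
      rw [key]
      have h1 : ¬ (p = u ∧ q = x) := fun h => hpq (by rw [h.1, h.2])
      have h2 : ¬ (p = x ∧ q = u) := fun h => hpq (by rw [h.1, h.2, Sym2.eq_swap])
      refine exists_congr fun c => ?_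
      simp only [setAt]
      grind
  · intro p c c'
    have := @h.inj p c c'
    simp only [setAt]
    grind
  · intro p c
    have := @h.lt p c
    simp only [setAt]
    grind
  · intro p
    have h1 := h.free p
    have h2 := hF p
    simp only [setAt]
    grind
  · intro p
    have h1 := h.free_lt p
    have h2 := hF p
    grind

theorem remove_edge {u y a : ℕ} (h : PartialColouring K D N F) (hy : N u a = y + 1) :
    PartialColouring (K.deleteEdges {s(u, y)}) D (setAt (setAt N u a 0) y a 0) F := by
  have hy' := h.symm hy
  have hne := h.ne_of hy
  refine ⟨?_, ?_, ?_, ?_, ?_, h.free_lt⟩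
  · intro p c q
    have := @h.symm p c q
    simp only [setAt]
    grind
  · intro p q
    simp only [SimpleGraph.deleteEdges_adj, Set.mem_singleton_iff, Sym2.eq_iff, h.adj]
    constructor
    · rintro ⟨⟨c, hc⟩, hpq⟩
      refine ⟨c, ?_⟩
      simp only [setAt]
      grind
    · rintro ⟨c, hc⟩
      have h1 := @h.inj p c a
      have h2 := @h.symm p c q
      simp only [setAt] at hc
      refine ⟨⟨c, by grind⟩, ?_⟩
      grind
  · intro p c c'
    have := @h.inj p c c'
    simp only [setAt]
    grind
  · intro p c
    have := @h.lt p c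
    simp only [setAt]
    grind
  · intro p
    have h1 := h.free p
    simp only [setAt]
    grind

/-- An uncoloured edge at `v` leaves room for a second free colour. -/
theorem exists_second_free {Δ u v : ℕ}
    (h : PartialColouring (K.deleteEdges {s(u, v)}) (Δ + 1) N F) (huv : K.Adj u v)
    (hK : DegreeLE K Δ) : ∃ c, c ≤ Δ ∧ N v c = 0 ∧ c ≠ F v := by
  by_contra! hc
  set A := (Finset.range (Δ + 1)).erase (F v) with hA
  have hcA : ∀ c ∈ A, N v c ≠ 0 := fun c hcA h0 => by
    simp only [hA, Finset.mem_erase, Finset.mem_range] at hcA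
    exact hcA.1 (hc c (by omega) h0)
  have hinj : Set.InjOn (fun c => N v c - 1) A := by
    intro c h1 c' h2 hcc
    have h3 := hcA c h1
    have h4 := hcA c' h2
    simp only at hcc
    exact h.inj (by omega) h3
  have hu : u ∉ A.image fun c => N v c - 1 := by
    intro hu
    obtain ⟨c, hc', hcu⟩ := Finset.mem_image.1 hu
    have h3 := hcA c hc'
    have := h.adj_of (p := v) (q := u) (c := c) (by omega)
    rw [SimpleGraph.deleteEdges_adj] at this
    exact this.2 (by simp [Sym2.eq_swap])
  have h1 := hK v (insert u (A.image fun c => N v c - 1)) (by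
    intro w hw
    rcases Finset.mem_insert.1 hw with rfl | hw
    · exact huv.symm
    obtain ⟨c, hc', rfl⟩ := Finset.mem_image.1 hw
    have h3 := hcA c hc'
    exact (SimpleGraph.deleteEdges_le _) (h.adj_of (c := c) (by omega)))
  rw [Finset.card_insert_of_notMem hu, Finset.card_image_of_injOn hinj, hA,
    Finset.card_erase_of_mem (by simpa using h.free_lt v), Finset.card_range] at h1
  omega

end PartialColouring

/-! ### Fans -/

/-- The stretch `s t, …, s i` of a Vizing fan at `u`: the colour which `F` provides at a vertex of
the fan is that of the edge from `u` to the next one. -/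
structure Fan (N : ℕ → ℕ → ℕ) (F : ℕ → ℕ) (u : ℕ) (s : ℕ → ℕ) (t i : ℕ) : Prop where
  next : ∀ r, t ≤ r → r < i → N u (F (s r)) = s (r + 1) + 1
  inj : ∀ r r', t ≤ r → r < r' → r' ≤ i → s r ≠ s r'

namespace PartialColouring

variable {K : SimpleGraph ℕ} {D : ℕ} {N : ℕ → ℕ → ℕ} {F : ℕ → ℕ}

/-- Moving the uncoloured edge from `ux` to `uy`: the edge `ux` takes over the colour `a = F x` of
`uy`. This sets free `a` at `y`, and `x` gets a new free colour `b`. -/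
theorem shift {u x y a b : ℕ}
    (h : PartialColouring (K.deleteEdges {s(u, x)}) D N F) (hux : K.Adj u x)
    (hy : N u a = y + 1) (hax : a = F x) (hb : N x b = 0 ∧ b ≠ F x ∧ b < D) :
    K.Adj u y ∧ PartialColouring (K.deleteEdges {s(u, y)}) D
      (setAt (setAt (setAt N u a (x + 1)) x a (u + 1)) y a 0) (Function.update F x b) := by
  have huy := h.adj_of hy
  have hne := hux.ne
  have hney := huy.ne
  rw [SimpleGraph.deleteEdges_adj] at huy
  have hxy : x ≠ y := fun hxy => huy.2 (by rw [hxy]; rfl)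
  refine ⟨huy.1, ?_⟩
  have h1 := h.remove_edge hy
  rw [SimpleGraph.deleteEdges_deleteEdges, Set.union_comm,
    ← SimpleGraph.deleteEdges_deleteEdges] at h1
  have hax' : N x a = 0 := hax ▸ h.free x
  have h2 := h1.add_edge (F' := Function.update F x b) (a := a)
    (by
      rw [SimpleGraph.deleteEdges_adj]
      refine ⟨hux, fun hh => ?_⟩
      rcases Sym2.eq_iff.1 (Set.mem_singleton_iff.1 hh) with ⟨_, h⟩ | ⟨h, _⟩
      · exact hxy h
      · exact hney h)
    (by simp [setAt]) (by simp [setAt, hax'])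
    (h.lt (by rw [hy]; omega)) (fun p _ hp => by simp [hp])
    (by
      have h3 := h.free u
      have h4 := h.free_lt u
      rw [Function.update_of_ne hne]
      simp only [setAt]
      grind)
    (by
      rw [Function.update_self]
      simp only [setAt]
      grind)
  convert h2 using 1
  funext p c
  simp only [setAt]
  grind

/-- Moving the uncoloured edge to the next vertex of a fan leaves a shorter fan. -/
theorem shift_fan {u a b i t : ℕ} {s : ℕ → ℕ}
    (h : PartialColouring (K.deleteEdges {s(u, s t)}) D N F) (hux : K.Adj u (s t))
    (hf : Fan N F u s t i) (hti : t < i) (hax : a = F (s t))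
    (hb : N (s t) b = 0 ∧ b ≠ F (s t) ∧ b < D) {N' : ℕ → ℕ → ℕ} {F' : ℕ → ℕ}
    (hN' : N' = setAt (setAt (setAt N u a (s t + 1)) (s t) a (u + 1)) (s (t + 1)) a 0)
    (hF' : F' = Function.update F (s t) b) :
    K.Adj u (s (t + 1)) ∧ PartialColouring (K.deleteEdges {s(u, s (t + 1))}) D N' F' ∧
    Fan N' F' u s (t + 1) i ∧ (∀ c, N' u c = 0 ↔ N u c = 0) ∧ (∀ p, p ≠ s t → F' p = F p) ∧
    (N' (s (t + 1)) a = 0 ∧ a ≠ F' (s (t + 1)) ∧ a < D) := by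
  subst hN' hF'
  have hy : N u a = s (t + 1) + 1 := hax ▸ hf.next t le_rfl hti
  obtain ⟨h1, h2⟩ := h.shift hux hy hax hb
  have hst : ∀ r, t < r → r ≤ i → s r ≠ s t := fun r h1 h2 => (hf.inj t r le_rfl h1 h2).symm
  have hne := hux.ne
  have hne' := h1.ne
  refine ⟨h1, h2, ⟨?_, fun r r' h3 => hf.inj r r' (by omega)⟩, ?_, ?_, ?_⟩
  · intro r hr hri
    have h3 := hf.next r (by omega) hri
    rw [Function.update_of_ne (hst r (by omega) (by omega))]
    have h4 : F (s r) ≠ a := by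
      intro h4
      rw [h4, hy] at h3
      exact hf.inj (t + 1) (r + 1) (by omega) (by omega) (by omega) (by omega)
    simp only [setAt]
    grind
  · intro c
    simp only [setAt]
    grind
  · intro p hp
    simp [hp]
  · have h3 := h.symm hy
    have h4 := h.free (s (t + 1))
    rw [Function.update_of_ne (hst (t + 1) (by omega) (by omega))]
    refine ⟨by simp [setAt], ?_, hax ▸ h.free_lt _⟩
    rintro rfl
    omega

/-- A walk along the colours which `F` provides is a fan, as long as these colours differ. -/
theorem fan_of_injOn {u v i : ℕ} {s : ℕ → ℕ}
    (h : PartialColouring (K.deleteEdges {s(u, v)}) D N F) (hs : s 0 = v)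
    (hnext : ∀ r, r < i → N u (F (s r)) = s (r + 1) + 1)
    (hF : ∀ r r', r < r' → r' < i → F (s r) ≠ F (s r')) : Fan N F u s 0 i := by
  refine ⟨fun r _ => hnext r, fun r r' _ hr hr' heq => ?_⟩
  rcases r with _ | r
  · obtain ⟨r', rfl⟩ : ∃ l, r' = l + 1 := ⟨r' - 1, by omega⟩
    have h1 := h.adj_of (hnext r' (by omega))
    rw [← heq, hs, SimpleGraph.deleteEdges_adj] at h1
    exact h1.2 rfl
  · obtain ⟨r', rfl⟩ : ∃ l, r' = l + 1 := ⟨r' - 1, by omega⟩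
    have h1 := hnext r (by omega)
    have h2 := hnext r' (by omega)
    exact hF r r' (by omega) (by omega) (h.inj (by rw [h1, h2, heq]) (by omega))

end PartialColouring

/-! ### Kempe chains -/

/-- Exchanging the colours `c` and `d` at the vertices of `S`. -/
def kempe (N : ℕ → ℕ → ℕ) (c d : ℕ) (S : Finset ℕ) : ℕ → ℕ → ℕ :=
  fun p h => if p ∈ S then N p (Equiv.swap c d h) else N p h

/-- The effect on the free colours of exchanging `c` and `d` at the vertices of `S`. -/
def kempeFree (F : ℕ → ℕ) (c d : ℕ) (S : Finset ℕ) : ℕ → ℕ :=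
  fun p => if p ∈ S then Equiv.swap c d (F p) else F p

/-- A walk along the `c`/`d` path that starts in `x` has visited `T`; the vertex to be visited next
is `z - 1`, which is included in `T`, and the walk will leave it along its edge of colour `g`. The
walk is over if `z = 0`. -/
structure KempeWalk (N : ℕ → ℕ → ℕ) (c d x : ℕ) (T : Finset ℕ) (z g : ℕ) : Prop where
  start : x ∈ T
  colour : g = c ∨ g = d
  mem : ∀ r, z = r + 1 → r ∈ T
  closed : ∀ q ∈ T, ∀ h, (h = c ∨ h = d) → (z = q + 1 → h ≠ g) →
    ∀ r, N q h = r + 1 → r ∈ T ∧ (z = r + 1 → h ≠ g)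
  ends : ∃ e, (z ≠ 0 → z = e + 1) ∧
    ∀ q ∈ T, q ≠ x → ∀ h, (h = c ∨ h = d) → N q h = 0 → q = e ∧ (z ≠ 0 → h = g)

namespace KempeWalk

variable {K : SimpleGraph ℕ} {D : ℕ} {N : ℕ → ℕ → ℕ} {F : ℕ → ℕ} {c d x : ℕ} {T : Finset ℕ}

theorem init (hd : N x d = 0) : KempeWalk N c d x {x} (x + 1) c where
  start := by simp
  colour := Or.inl rfl
  mem r hr := by simp at hr; simp [hr]
  closed q hq h hh hg r hr := by
    simp only [Finset.mem_singleton] at hq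
    subst hq
    have := hg rfl
    grind
  ends := ⟨x, fun _ => rfl, by simp⟩

/-- The walk is over at a vertex without an edge of the colour `g`. -/
theorem step_end {r g g' : ℕ} (hw : KempeWalk N c d x T (r + 1) g) (hg' : g' = c ∨ g' = d)
    (hz : N r g = 0) : KempeWalk N c d x T 0 g' := by
  obtain ⟨e, he, hends⟩ := hw.ends
  refine ⟨hw.start, hg', by simp, ?_, e, by simp, ?_⟩
  · intro q hq h hh _ r' hr'
    refine ⟨(hw.closed q hq h hh ?_ r' hr').1, by simp⟩
    rintro h1 rfl
    simp only [Nat.add_right_cancel_iff] at h1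
    subst h1
    omega
  · intro q hq hqx h hh h0
    exact ⟨(hends q hq hqx h hh h0).1, by simp⟩

/-- The walk never returns to a vertex which it has visited before. -/
theorem step {r r' g g' : ℕ} (hN : PartialColouring K D N F)
    (hw : KempeWalk N c d x T (r + 1) g) (hg' : g' = c ∨ g' = d) (hgg : g' ≠ g)
    (hz : N r g = r' + 1) :
    r' ∉ T ∧ KempeWalk N c d x (insert r' T) (r' + 1) g' := by
  have hr := hw.mem r rfl
  have hne := hN.ne_of hz
  have hr' : r' ∉ T := fun hr' =>
    (hw.closed r' hr' g hw.colour (fun h => (hne (by omega)).elim) r (hN.symm hz)).2 rfl rfl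
  refine ⟨hr', ?_⟩
  obtain ⟨e, he, hends⟩ := hw.ends
  have he : r = e := by simpa using he
  subst he
  refine ⟨Finset.mem_insert_of_mem hw.start, hg', by simp, ?_, r', by simp, ?_⟩
  · intro q hq h hh hqg p hp
    rcases Finset.mem_insert.1 hq with rfl | hq
    · -- the only edge left at the new vertex is the one used to get there
      have hhg : h = g := by
        have := hqg rfl
        have := hw.colour
        grind
      subst hhg
      have := hN.symm hz
      obtain rfl : r = p := by omega
      exact ⟨Finset.mem_insert_of_mem hr, fun h => (hne (by omega)).elim⟩
    · by_cases hqr : q = r ∧ h = g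
      · obtain ⟨rfl, rfl⟩ := hqr
        obtain rfl : r' = p := by omega
        exact ⟨Finset.mem_insert_self _ _, fun _ => Ne.symm hgg⟩
      · have h1 := (hw.closed q hq h hh (fun h1 h2 => hqr ⟨by omega, h2⟩) p hp).1
        refine ⟨Finset.mem_insert_of_mem h1, fun h2 => ?_⟩
        obtain rfl : r' = p := by omega
        exact (hr' h1).elim
  · intro q hq hqx h hh h0
    rcases Finset.mem_insert.1 hq with rfl | hq
    · refine ⟨rfl, fun _ => ?_⟩
      have := hN.symm hz
      have := hw.colour
      have : h ≠ g := by
        rintro rfl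
        omega
      grind
    · obtain ⟨rfl, h2⟩ := hends q hq hqx h hh h0
      have := h2 (by omega)
      subst this
      omega

/-- Exchanging the colours along a complete `c`/`d` path gives a proper colouring again: the
vertices of the path are closed under passing to neighbours along edges of colour `c` or `d`. -/
theorem exchange {g : ℕ} (hN : PartialColouring K D N F) (hw : KempeWalk N c d x T 0 g) (hc : c < D)
    (hd : d < D) : PartialColouring K D (kempe N c d T) (kempeFree F c d T) := by
  have hclosed : ∀ p h r, N p (Equiv.swap c d h) = r + 1 → (h = c ∨ h = d) → (p ∈ T ↔ r ∈ T) := by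
    intro p h r hp hh
    have hs : Equiv.swap c d h = c ∨ Equiv.swap c d h = d := by
      rcases hh with rfl | rfl <;> simp
    exact ⟨fun h1 => (hw.closed p h1 _ hs (by simp) r hp).1,
      fun h1 => (hw.closed r h1 _ hs (by simp) p (hN.symm hp)).1⟩
  have hother : ∀ h, ¬ (h = c ∨ h = d) → Equiv.swap c d h = h := fun h hh => by
    push Not at hh
    exact Equiv.swap_apply_of_ne_of_ne hh.1 hh.2
  have hclosed' : ∀ p h r, N p h = r + 1 → (h = c ∨ h = d) → (p ∈ T ↔ r ∈ T) := by
    intro p h r hp hh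
    refine hclosed p (Equiv.swap c d h) r (by simpa using hp) ?_
    rcases hh with rfl | rfl <;> simp
  refine ⟨?_, ?_, ?_, ?_, ?_, ?_⟩
  · intro p h q hp
    simp only [kempe] at hp ⊢
    by_cases hh : h = c ∨ h = d
    · split_ifs at hp with hpT
      · rw [if_pos ((hclosed p h q hp hh).1 hpT)]
        exact hN.symm hp
      · rw [if_neg (fun h1 => hpT ((hclosed' p h q hp hh).2 h1))]
        exact hN.symm hp
    · rw [hother h hh] at hp ⊢
      simp only [ite_self] at hp ⊢
      exact hN.symm hp
  · intro p q
    rw [hN.adj]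
    simp only [kempe]
    split_ifs with hp
    · exact ⟨fun ⟨h, hh⟩ => ⟨Equiv.swap c d h, by simpa using hh⟩, fun ⟨h, hh⟩ => ⟨_, hh⟩⟩
    · rfl
  · intro p h h'
    simp only [kempe]
    split_ifs with hp
    · intro h1 h2
      exact (Equiv.swap c d).injective (hN.inj h1 h2)
    · exact hN.inj
  · intro p h
    simp only [kempe]
    split_ifs with hp
    · intro h1
      have := hN.lt h1
      by_cases hh : h = c ∨ h = d
      · rcases hh with rfl | rfl <;> assumption
      · rwa [hother h hh] at this
    · exact hN.lt
  · intro p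
    simp only [kempe, kempeFree]
    split_ifs with hp
    · simpa using hN.free p
    · exact hN.free p
  · intro p
    have := hN.free_lt p
    simp only [kempeFree]
    split_ifs with hp
    · by_cases hh : F p = c ∨ F p = d
      · rcases hh with h | h <;> simp [h, hc, hd]
      · rwa [hother _ hh]
    · exact this

/-- Let the colours provided by a fan at `u` repeat: both `s j` and `s i` provide `d`. Exchanging
`d` with a free colour `c` of `u` along the path from `s j` gives a fan that ends in a vertex whose
colour is free at `u`: this is `s j` if the path avoids `u`, and `s i` else. -/
theorem exists_fan {u g i j : ℕ} {s : ℕ → ℕ} (hN : PartialColouring K D N F)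
    (hw : KempeWalk N c d (s j) T 0 g) (hc : c = F u)
    (hf : Fan N F u s 0 i) (hj : j < i) (hij : F (s i) = d) (hjd : F (s j) = d)
    (hu : ∀ r, r ≤ i → s r ≠ u) :
    ∃ i', Fan (kempe N c d T) (kempeFree F c d T) u s 0 i' ∧
      kempe N c d T u (kempeFree F c d T (s i')) = 0 := by
  have hcu : N u c = 0 := hc ▸ hN.free u
  -- before `s i`, only `s j` provides one of the two colours
  have hFd : ∀ r, r < i → r ≠ j → F (s r) ≠ d := by
    intro r hr hrj h1
    have h2 := hf.next r (by omega) hr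
    have h3 := hf.next j (by omega) hj
    rw [h1] at h2
    rw [hjd] at h3
    rcases Nat.lt_or_gt_of_ne hrj with h | h
    · exact hf.inj (r + 1) (j + 1) (by omega) (by omega) (by omega) (by omega)
    · exact hf.inj (j + 1) (r + 1) (by omega) (by omega) (by omega) (by omega)
  have hFc : ∀ r, r < i → F (s r) ≠ c := by
    intro r hr h1
    have h2 := hf.next r (by omega) hr
    rw [h1] at h2
    omega
  have hF : ∀ r, r < i → r ≠ j → kempeFree F c d T (s r) = F (s r) := by
    intro r hr hrj
    simp only [kempeFree]
    split_ifs
    · exact Equiv.swap_apply_of_ne_of_ne (hFc r hr) (hFd r hr hrj)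
    · rfl
  have hFj : kempeFree F c d T (s j) = c := by
    simp [kempeFree, hw.start, hjd]
  by_cases huT : u ∈ T
  · -- the path has only two ends, so that `s i` is not on it
    have hiT : s i ∉ T := by
      intro hiT
      obtain ⟨e, -, he⟩ := hw.ends
      have h1 := (he u huT (hu j (by omega)).symm c (Or.inl rfl) hcu).1
      have h2 := (he (s i) hiT (hf.inj j i (by omega) hj le_rfl).symm d (Or.inr rfl)
        (hij ▸ hN.free _)).1
      exact hu i le_rfl (h2.trans h1.symm)
    refine ⟨i, ⟨?_, hf.inj⟩, ?_⟩
    · intro r h0 hr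
      have h1 := hf.next r h0 hr
      by_cases hrj : r = j
      · subst hrj
        rw [hFj]
        rw [hjd] at h1
        simpa [kempe, huT] using h1
      · rw [hF r hr hrj]
        simp only [kempe, huT, if_true]
        rwa [Equiv.swap_apply_of_ne_of_ne (hFc r hr) (hFd r hr hrj)]
    · simp [kempe, kempeFree, huT, hiT, hij, hcu]
  · refine ⟨j, ⟨?_, fun r r' h0 hr hr' => hf.inj r r' h0 hr (by omega)⟩, ?_⟩
    · intro r h0 hr
      have h1 := hf.next r h0 (by omega)
      rw [hF r (by omega) (by omega)]
      simpa [kempe, huT] using h1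
    · rw [hFj]
      simpa [kempe, huT] using hcu

end KempeWalk

/-! ### The program for edge colourings -/

/-!
Registers: 3 is the number of the current edge, 4 its end `u` (the centre of the fan), 5 its other
end `v`, 6 the current vertex `x` of the fan, 7 a second free colour of `x`, 8 and 9 the colours of
a Kempe exchange, 10 to 12 and 15 the state of the walk along its path, 13 and 14 a colour and a
vertex. Arrays: 7 is the table of the colouring, 8 has a free colour for each vertex, and 9 is the
table of the marks: the entry for an edge and a colour is one more than the vertex whose free colour
it is, if the fan for this edge has come to such a vertex, and 0 otherwise.
-/

namespace Expr

/-- The entry for the vertex `p` and the colour `c` in the table of the colouring. -/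
def nbr (p c : Expr) : Expr := .get 7 (.pair p c)

/-- The free colour stored for the vertex `p`. -/
def free (p : Expr) : Expr := .get 8 p

/-- The mark of the colour `c` in the round for the current edge. -/
def mark (c : Expr) : Expr := .get 9 (.pair (.var 3) c)

@[simp] theorem eval_nbr (σ : State) (p c : Expr) :
    (nbr p c).eval σ = table (σ.arr 7) (p.eval σ) (c.eval σ) := rfl

@[simp] theorem eval_free (σ : State) (p : Expr) : (free p).eval σ = σ.arr 8 (p.eval σ) := rfl

@[simp] theorem eval_mark (σ : State) (c : Expr) :
    (mark c).eval σ = table (σ.arr 9) (σ.var 3) (c.eval σ) := rfl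

end Expr

namespace Prog

/-- One step along the fan at the vertex in register 4: mark the free colour of the vertex in
register 6 with this vertex, and go on to the next one. -/
def fanBody : Prog :=
  .seq (.store 9 (.pair (.var 3) (.free (.var 6))) (.add (.var 6) (.const 1)))
    (.assign 6 (.sub (.nbr (.var 4) (.free (.var 6))) (.const 1)))

/-- Follow the fan until a colour is free at the centre of the fan, or repeats. -/
def fanWalk : Prog :=
  .while (.mul (.nbr (.var 4) (.free (.var 6))) (.eq (.mark (.free (.var 6))) (.const 0))) fanBody

end Prog

/-- Words bounded by `W` are large enough for graphs with `n` vertices and `m` edges: they can hold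
vertices, colours, numbers of edges, and pairs of these. -/
structure Fits (W n m : ℕ) : Prop where
  pos : 0 < n
  le : m ≤ n * n
  word : (n * n + 3 * n) * (n * n + 3 * n) + (n * n + 3 * n) ≤ W

theorem Fits.pair_le {W n m p c : ℕ} (h : Fits W n m) (hp : p ≤ n) (hc : c ≤ n) : pair p c ≤ W := by
  have h1 : p + c ≤ n * n + 3 * n := by omega
  exact (CographDec.pair_le h1).trans h.word

theorem Fits.pair_le' {W n m p c : ℕ} (h : Fits W n m) (hp : p ≤ m) (hc : c ≤ n) :
    pair p c ≤ W := by
  have := h.le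
  have h1 : p + c ≤ n * n + 3 * n := by omega
  exact (CographDec.pair_le h1).trans h.word

theorem Fits.le_word {W n m p : ℕ} (h : Fits W n m) (hp : p ≤ n * n + 3 * n) : p ≤ W :=
  hp.trans ((Nat.le_add_left _ _).trans h.word)

theorem PartialColouring.nbr_le {K : SimpleGraph ℕ} {D n : ℕ} {N : ℕ → ℕ → ℕ} {F : ℕ → ℕ}
    (h : PartialColouring K D N F) (hn : ∀ p q, K.Adj p q → q < n) (p c : ℕ) : N p c ≤ n := by
  rcases hq : N p c with _ | q
  · omega
  · exact hn p q (h.adj_of hq)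

/-- The memory holds a proper colouring of the edges of `K`, with its table in array 7 and free
colours in array 8. -/
def Colours (K : SimpleGraph ℕ) (D : ℕ) (σ : State) : Prop :=
  PartialColouring K D (table (σ.arr 7)) (σ.arr 8)

section

variable {W n m Δ : ℕ} {K : SimpleGraph ℕ}

/-- The walk ends at a vertex whose free colour is free at `u`, or is also that of an earlier
vertex, which is then to be found in the table of the marks. The colours on the way differ, so that
the walk takes at most `Δ + 1` steps. -/
theorem runs_fanWalk {σ : State} {u v : ℕ} (hW : Fits W n m) (hΔ : Δ < n)
    (hn : ∀ p q, K.Adj p q → q < n)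
    (hN : Colours (K.deleteEdges {s(u, v)}) (Δ + 1) σ)
    (hu : σ.var 4 = u) (hv : σ.var 6 = v) (hvn : v < n) (hJ : σ.var 3 ≤ m)
    (hmark : ∀ a, table (σ.arr 9) (σ.var 3) a = 0) :
    Runs W .fanWalk σ (100 * n + 100) fun τ =>
      (∀ J, J ≠ σ.var 3 → table (τ.arr 9) J = table (σ.arr 9) J) ∧
      ∃ (s : ℕ → ℕ) (i : ℕ), s 0 = v ∧ τ.var 6 = s i ∧
        Fan (table (σ.arr 7)) (σ.arr 8) u s 0 i ∧
        (table (σ.arr 7) u (σ.arr 8 (s i)) = 0 ∨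
          ∃ j < i, σ.arr 8 (s j) = σ.arr 8 (s i) ∧
            table (τ.arr 9) (σ.var 3) (σ.arr 8 (s i)) = s j + 1) := by
  set N := table (σ.arr 7) with hNdef
  set F := σ.arr 8 with hFdef
  have hN : PartialColouring (K.deleteEdges {s(u, v)}) (Δ + 1) N F := hN
  have hnbr := hN.nbr_le fun p q h => hn p q (SimpleGraph.deleteEdges_le _ h)
  set s : ℕ → ℕ := fun t => (fun x => N u (F x) - 1)^[t] v with hs
  have hs0 : s 0 = v := rfl
  have hsucc : ∀ t, s (t + 1) = N u (F (s t)) - 1 := fun t => by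
    simp only [hs, Function.iterate_succ_apply']
  refine Runs.while_loop (B := 50) (c := 30) (k := n)
    (fun k τ => ∃ i, n ≤ i + k ∧ τ.var 6 = s i ∧
      (∀ r, r < i → N u (F (s r)) = s (r + 1) + 1) ∧
      (∀ r r', r < r' → r' < i → F (s r) ≠ F (s r')) ∧
      (∀ a, table (τ.arr 9) (σ.var 3) a ≠ 0 →
        ∃ r < i, F (s r) = a ∧ table (τ.arr 9) (σ.var 3) a = s r + 1) ∧
      (∀ r, r < i → table (τ.arr 9) (σ.var 3) (F (s r)) ≠ 0) ∧
      (∀ J, J ≠ σ.var 3 → table (τ.arr 9) J = table (σ.arr 9) J))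
    ⟨0, by omega, hv, by simp, by simp, by simp [hmark], by simp, by simp⟩ ?_ (by decide)
    (by omega) ?_
  · rintro k τ hf ⟨i, hik, hx, hnext, hinj, hm1, hm2, hm3⟩ he
    have h7 : τ.arr 7 = σ.arr 7 := hf.arr 7 rfl
    have h8 : τ.arr 8 = σ.arr 8 := hf.arr 8 rfl
    have h3 : τ.var 3 = σ.var 3 := hf.var 3 rfl
    have h4 : τ.var 4 = u := (hf.var 4 rfl).trans hu
    simp only [Expr.eval, Expr.eval_nbr, Expr.eval_free, Expr.eval_mark, h7, h8, h3, h4, hx,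
      ← hNdef, ← hFdef, ne_eq, mul_eq_zero, not_or, ite_eq_right_iff, one_ne_zero, imp_false,
      not_not] at he
    obtain ⟨he1, he2⟩ := he
    have hnew : ∀ r < i, F (s r) ≠ F (s i) := fun r hr h => hm2 r hr (h ▸ he2)
    have hcard : i + 1 ≤ Δ + 1 := by
      have := Finset.card_le_card_of_injOn (s := Finset.range (i + 1)) (t := Finset.range (Δ + 1))
        (fun r => F (s r)) (fun r _ => by simpa using hN.free_lt (s r)) (by
          intro r hr r' hr' h
          simp only [Finset.coe_range, Set.mem_Iio] at hr hr' h
          rcases lt_trichotomy r r' with h1 | h1 | h1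
          · rcases Nat.lt_succ_iff_lt_or_eq.1 hr' with h2 | rfl
            · exact (hinj r r' h1 h2 h).elim
            · exact (hnew r h1 h).elim
          · exact h1
          · rcases Nat.lt_succ_iff_lt_or_eq.1 hr with h2 | rfl
            · exact (hinj r' r h1 h2 h.symm).elim
            · exact (hnew r' h1 h.symm).elim)
      simpa using this
    have hsi : s i < n := by
      rcases i with _ | i
      · exact hvn
      · have := hnext i (by omega)
        have := hnbr u (F (s i))
        omega
    have hFi := hN.free_lt (s i)
    refine ⟨k - 1, by omega, Runs.of_safe ?_ (by decide) ?_⟩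
    · have := hnbr u (F (s i))
      simp only [Prog.fanBody, Prog.Safe, Prog.run, Expr.eval, Expr.eval_pair, Expr.eval_nbr,
        Expr.eval_free, State.setArr_var, State.setArr_arr, h7, h8, h3, h4, hx]
      simp only [← hNdef, ← hFdef, reduceIte, Nat.reduceEqDiff]
      exact ⟨⟨hW.pair_le' hJ (by omega), hW.le_word (by omega)⟩, hW.le_word (by omega)⟩
    · simp only [Prog.fanBody, Prog.run, Expr.eval, Expr.eval_pair, Expr.eval_nbr,
        Expr.eval_free, State.setArr_var, State.setArr_arr, State.setVar_var, State.setVar_arr,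
        Nat.reduceEqDiff, reduceIte, h7, h8, h3, h4, hx, table_update]
      simp only [← hNdef, ← hFdef]
      refine ⟨i + 1, by omega, (hsucc i).symm, ?_, ?_, ?_, ?_, ?_⟩
      · intro r hr
        rcases Nat.lt_succ_iff_lt_or_eq.1 hr with h | rfl
        · exact hnext r h
        · rw [hsucc]
          omega
      · intro r r' hr hr'
        rcases Nat.lt_succ_iff_lt_or_eq.1 hr' with h | rfl
        · exact hinj r r' hr h
        · exact hnew r hr
      · intro a ha
        simp only [setAt] at ha ⊢
        by_cases h : a = F (s i)
        · exact ⟨i, by omega, h.symm, by simp [h]⟩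
        · simp only [h, and_false, if_false] at ha ⊢
          obtain ⟨r, hr, h⟩ := hm1 a ha
          exact ⟨r, by omega, h⟩
      · intro r hr
        simp only [setAt]
        split_ifs with h
        · omega
        · refine hm2 r ?_
          rcases Nat.lt_succ_iff_lt_or_eq.1 hr with h' | rfl
          · exact h'
          · simp at h
      · intro J hJ
        rw [← hm3 J hJ]
        funext a
        simp [setAt, hJ]
  · rintro k τ hf ⟨i, -, hx, hnext, hinj, hm1, -, hm3⟩ he
    have h7 : τ.arr 7 = σ.arr 7 := hf.arr 7 rfl
    have h8 : τ.arr 8 = σ.arr 8 := hf.arr 8 rfl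
    have h3 : τ.var 3 = σ.var 3 := hf.var 3 rfl
    have h4 : τ.var 4 = u := (hf.var 4 rfl).trans hu
    refine ⟨hm3, s, i, hs0, hx, hN.fan_of_injOn hs0 hnext hinj, ?_⟩
    simp only [Expr.eval, Expr.eval_nbr, Expr.eval_free, Expr.eval_mark, h7, h8, h3, h4, hx,
      ← hNdef, ← hFdef, mul_eq_zero, ite_eq_right_iff, one_ne_zero, imp_false] at he
    refine he.imp id fun he => ?_
    obtain ⟨r, hr, h⟩ := hm1 _ he
    exact ⟨r, hr, h⟩

end

namespace Prog

/-- One step of a Kempe exchange: the colours in the registers 8 and 9 are exchanged at the next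
vertex of the path, which is one less than register 12; register 10 holds the colour of the edge by
which the path goes on. -/
def kempeBody : Prog :=
  .seq (.assign 11 (.sub (.var 12) (.const 1))) <|
  .seq (.assign 12 (.nbr (.var 11) (.var 10))) <|
  .seq (.assign 15 (.nbr (.var 11) (.var 8))) <|
  .seq (.store 7 (.pair (.var 11) (.var 8)) (.nbr (.var 11) (.var 9))) <|
  .seq (.store 7 (.pair (.var 11) (.var 9)) (.var 15)) <|
  .seq (.ite (.add (.eq (.free (.var 11)) (.var 8)) (.eq (.free (.var 11)) (.var 9)))
    (.store 8 (.var 11) (.sub (.add (.var 8) (.var 9)) (.free (.var 11)))) .skip)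
    (.assign 10 (.sub (.add (.var 8) (.var 9)) (.var 10)))

/-- A Kempe exchange. -/
def kempeLoop : Prog := .while (.var 12) kempeBody

/-- If the free colour of the vertex in register 6 is not free at the centre of the fan, exchange it
with the free colour of the centre, along the path from the vertex marked with it. -/
def kempeStep : Prog :=
  .ite (.nbr (.var 4) (.free (.var 6)))
    (.seq (.assign 9 (.free (.var 6))) <|
      .seq (.assign 8 (.free (.var 4))) <|
      .seq (.assign 10 (.var 8)) <|
      .seq (.assign 12 (.mark (.var 9))) kempeLoop)
    .skip

end Prog

/-- The exchange at one more vertex `r`, as the program carries it out. -/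
theorem kempe_insert {N : ℕ → ℕ → ℕ} {c d r : ℕ} {T : Finset ℕ} (hr : r ∈ T) :
    setAt (setAt (kempe N c d (T.filter fun p => r + 1 ≠ p + 1)) r c (N r d)) r d (N r c) =
      kempe N c d T := by
  funext p h
  simp only [setAt, kempe, Finset.mem_filter, Equiv.swap_apply_def]
  grind

theorem kempeFree_insert {F : ℕ → ℕ} {c d r : ℕ} {T : Finset ℕ} (hr : r ∈ T) :
    (if F r = c ∨ F r = d then
      Function.update (kempeFree F c d (T.filter fun p => r + 1 ≠ p + 1)) r (c + d - F r)
    else kempeFree F c d (T.filter fun p => r + 1 ≠ p + 1)) = kempeFree F c d T := by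
  funext p
  split_ifs with h
  · simp only [kempeFree, Finset.mem_filter, Equiv.swap_apply_def, Function.update_apply]
    grind
  · simp only [kempeFree, Finset.mem_filter, Equiv.swap_apply_def]
    grind

section

variable {W n m Δ : ℕ} {K : SimpleGraph ℕ}

/-- The loop exchanges `c` and `d` at all vertices of the path from `x`. Since it only changes the
rows of visited vertices, the unvisited ones can be followed in the original table. -/
theorem runs_kempeLoop {σ : State} {c d x : ℕ} (hW : Fits W n m)
    (hn : ∀ p q, K.Adj p q → q < n) (hN : Colours K (Δ + 1) σ)
    (hc : σ.var 8 = c) (hd : σ.var 9 = d) (hg : σ.var 10 = c) (hx : σ.var 12 = x + 1)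
    (hcd : c ≠ d) (hcn : c < n) (hdn : d < n) (hxd : table (σ.arr 7) x d = 0) (hxn : x < n) :
    Runs W .kempeLoop σ (300 * n + 300) fun τ => ∃ T g,
      KempeWalk (table (σ.arr 7)) c d x T 0 g ∧
      table (τ.arr 7) = kempe (table (σ.arr 7)) c d T ∧
      τ.arr 8 = kempeFree (σ.arr 8) c d T := by
  have hN : PartialColouring K (Δ + 1) (table (σ.arr 7)) (σ.arr 8) := hN
  have hnbr := hN.nbr_le hn
  set N := table (σ.arr 7) with hNdef
  set F := σ.arr 8 with hFdef
  refine Runs.while_loop (B := 200) (c := 1) (k := n)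
    (fun k τ => ∃ T, KempeWalk N c d x T (τ.var 12) (τ.var 10) ∧
      (τ.var 12 ≠ 0 → T.card + k = n + 1) ∧ (∀ p ∈ T, p < n) ∧
      table (τ.arr 7) = kempe N c d (T.filter fun p => τ.var 12 ≠ p + 1) ∧
      τ.arr 8 = kempeFree F c d (T.filter fun p => τ.var 12 ≠ p + 1))
    ⟨{x}, ?_, by simp [add_comm], by simp [hxn], ?_, ?_⟩ ?_ (by decide) (by omega) ?_
  · rw [hx, hg]
    exact KempeWalk.init hxd
  · funext p h
    simp [kempe, hx, Finset.filter_singleton, ← hNdef]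
  · funext p
    simp [kempeFree, hx, Finset.filter_singleton, ← hFdef]
  · rintro k τ hf ⟨T, hw, hk, hT, h7, h8⟩ he
    have h8' : τ.var 8 = c := (hf.var 8 rfl).trans hc
    have h9' : τ.var 9 = d := (hf.var 9 rfl).trans hd
    obtain ⟨r, hr⟩ : ∃ r, τ.var 12 = r + 1 := ⟨τ.var 12 - 1, by
      simp only [Expr.eval] at he
      omega⟩
    obtain ⟨g, hg⟩ : ∃ g, τ.var 10 = g := ⟨_, rfl⟩
    simp only [hr, hg] at hw hk h7 h8
    have hk := hk (by omega)
    have hrT := hw.mem r rfl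
    have hcard : T.card ≤ n := by
      have : T ⊆ Finset.range n := fun p hp => Finset.mem_range.2 (hT p hp)
      simpa using Finset.card_le_card this
    have hrow : ∀ h, table (τ.arr 7) r h = N r h := fun h => by
      rw [h7]
      simp [kempe]
    have hFr : τ.arr 8 r = F r := by
      rw [h8]
      simp [kempeFree]
    have hrn := hT r hrT
    have hgn : g < n := by
      rcases hw.colour with rfl | rfl <;> assumption
    refine ⟨k - 1, by omega, Runs.of_safe ?_ (by decide) ?_⟩
    · have h1 := hnbr r
      have h2 := h1 g
      have h3 := h1 c
      have h4 := h1 d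
      simp only [Prog.kempeBody, Prog.Safe, Prog.run, Expr.eval, Expr.eval_pair, Expr.eval_nbr,
        Expr.eval_free, State.setVar_var, State.setVar_arr, State.setArr_var, State.setArr_arr,
        Nat.reduceEqDiff, reduceIte, h8', h9', hr, hg, hFr, hrow, Nat.add_sub_cancel]
      refine ⟨hW.le_word (by omega), hW.le_word (by omega), hW.le_word (by omega),
        ⟨hW.pair_le (by omega) (by omega), hW.le_word (by omega)⟩,
        ⟨hW.pair_le (by omega) (by omega), hW.le_word (by omega)⟩,
        ⟨fun _ => ⟨hW.le_word (by omega), hW.le_word (by omega)⟩, fun _ => trivial⟩, ?_⟩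
      split_ifs <;> simp only [State.setArr_var, State.setVar_var, Nat.reduceEqDiff, reduceIte, h8',
        h9', hg] <;> exact hW.le_word (by omega)
    · obtain ⟨g', hg'⟩ : ∃ g', c + d - g = g' := ⟨_, rfl⟩
      have hgc : (g' = c ∨ g' = d) ∧ g' ≠ g := by
        rcases hw.colour with rfl | rfl <;> omega
      have hrun : ∃ ρ, Prog.kempeBody.run τ = ρ ∧ ρ.var 12 = N r g ∧ ρ.var 10 = g' ∧
          table (ρ.arr 7) = kempe N c d T ∧ ρ.arr 8 = kempeFree F c d T := by
        refine ⟨_, rfl, ?_⟩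
        rw [← kempe_insert (N := N) hrT, ← kempeFree_insert (F := F) hrT, ← h7, ← h8]
        simp only [Prog.kempeBody, Prog.run, Expr.eval, Expr.eval_pair, Expr.eval_nbr,
          Expr.eval_free, State.setVar_var, State.setVar_arr, State.setArr_var, State.setArr_arr,
          Nat.reduceEqDiff, reduceIte, h8', h9', hr, hg, hFr, hrow, Nat.add_sub_cancel]
        by_cases h1 : F r = c
        · simp [h1, hcd, h8', h9', hg, hg', table_update]
        · by_cases h2 : F r = d
          · simp [h2, hcd.symm, h8', h9', hg, hg', table_update]
          · simp [h1, h2, h8', h9', hg, hg', table_update]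
      obtain ⟨ρ, hρ, h12, h10, h7', h8''⟩ := hrun
      rw [hρ, h12, h10]
      rcases hz : N r g with _ | r'
      · refine ⟨T, hw.step_end hgc.1 hz, by simp, hT, ?_, ?_⟩
        · simpa using h7'
        · simpa using h8''
      · obtain ⟨h1, h2⟩ := hw.step hN hgc.1 hgc.2 hz
        have hfil : (insert r' T).filter (fun p => r' + 1 ≠ p + 1) = T := by
          ext p
          simp only [Finset.mem_filter, Finset.mem_insert]
          grind
        refine ⟨insert r' T, h2, fun _ => ?_, ?_, ?_, ?_⟩
        · rw [Finset.card_insert_of_notMem h1]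
          omega
        · intro p hp
          rcases Finset.mem_insert.1 hp with rfl | hp
          · exact hn _ _ (hN.adj_of hz)
          · exact hT p hp
        · rw [hfil, h7']
        · rw [hfil, h8'']
  · rintro k τ hf ⟨T, hw, -, -, h7, h8⟩ he
    simp only [Expr.eval] at he
    rw [he] at hw h7 h8
    refine ⟨T, _, hw, ?_, ?_⟩
    · simpa using h7
    · simpa using h8

/-- After the Kempe exchange, there is a fan from `v` to a vertex whose free colour is also free at
the centre `u`. -/
theorem runs_kempeStep {σ : State} {u v i : ℕ} {s : ℕ → ℕ} (hW : Fits W n m) (hΔ : Δ < n)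
    (hn : ∀ p q, K.Adj p q → q < n) (hN : Colours (K.deleteEdges {s(u, v)}) (Δ + 1) σ)
    (huv : K.Adj u v) (hu : σ.var 4 = u) (hs0 : s 0 = v) (hx : σ.var 6 = s i)
    (hf : Fan (table (σ.arr 7)) (σ.arr 8) u s 0 i)
    (hend : table (σ.arr 7) u (σ.arr 8 (s i)) = 0 ∨ ∃ j < i, σ.arr 8 (s j) = σ.arr 8 (s i) ∧
      table (σ.arr 9) (σ.var 3) (σ.arr 8 (s i)) = s j + 1) :
    Runs W .kempeStep σ (300 * n + 400) fun τ =>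
      Colours (K.deleteEdges {s(u, v)}) (Δ + 1) τ ∧ ∃ i, i ≤ n ∧
        Fan (table (τ.arr 7)) (τ.arr 8) u s 0 i ∧ table (τ.arr 7) u (τ.arr 8 (s i)) = 0 := by
  have hN' : PartialColouring (K.deleteEdges {s(u, v)}) (Δ + 1) (table (σ.arr 7)) (σ.arr 8) := hN
  have hvn : v < n := hn _ _ huv
  have hun : u < n := hn _ _ huv.symm
  have hsn : ∀ N F i, PartialColouring (K.deleteEdges {s(u, v)}) (Δ + 1) N F → Fan N F u s 0 i →
      ∀ r, r ≤ i → K.Adj u (s r) := by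
    intro N F i hN hf r hr
    rcases r with _ | r
    · rwa [hs0]
    · exact SimpleGraph.deleteEdges_le _ (hN.adj_of (hf.next r (by omega) hr))
  have hin : ∀ N F i, PartialColouring (K.deleteEdges {s(u, v)}) (Δ + 1) N F → Fan N F u s 0 i →
      i ≤ n := by
    intro N F i hN hf
    have := Finset.card_le_card_of_injOn (s := Finset.range (i + 1)) (t := Finset.range n) s
      (fun r hr => by
        simp only [Finset.coe_range, Set.mem_Iio] at hr ⊢
        exact hn _ _ (hsn N F i hN hf r (by omega))) (by
        intro r hr r' hr' h
        simp only [Finset.coe_range, Set.mem_Iio] at hr hr'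
        rcases lt_trichotomy r r' with h1 | h1 | h1
        · exact (hf.inj r r' (by omega) h1 (by omega) h).elim
        · exact h1
        · exact (hf.inj r' r (by omega) h1 (by omega) h.symm).elim)
    simp only [Finset.card_range] at this
    omega
  refine Runs.ite (T' := 300 * n + 370) (fun he => ?_) (fun he => ?_) ?_
  · simp only [Expr.eval, Expr.eval_nbr, Expr.eval_free, hu, hx] at he
    obtain ⟨j, hj, hjd, hmark⟩ := hend.resolve_left he
    set d := σ.arr 8 (s i) with hd
    set c := σ.arr 8 u with hc
    have hcn := hN'.free_lt u
    have hdn := hN'.free_lt (s i)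
    have hcd : c ≠ d := fun h => he (h ▸ hN'.free u)
    have hsi := hn _ _ (hsn _ _ i hN' hf i le_rfl)
    have hsj := hn _ _ (hsn _ _ i hN' hf j (by omega))
    refine Runs.seq (Q := fun τ => τ = σ.setVar 9 d) (T₁ := 10)
      (Runs.of_safe ?_ (by decide) ?_) ?_ (T₂ := 300 * n + 360) (by omega)
    · simp only [Prog.Safe, Expr.eval, Expr.eval_free, hx]
      exact hW.le_word (by omega)
    · simp only [Prog.run, Expr.eval, Expr.eval_free, hx, hd]
    rintro τ - rfl
    refine Runs.seq (Q := fun τ => τ = (σ.setVar 9 d).setVar 8 c) (T₁ := 10)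
      (Runs.of_safe ?_ (by decide) ?_) ?_ (T₂ := 300 * n + 350) (by omega)
    · simp only [Prog.Safe, Expr.eval, Expr.eval_free, State.setVar_var, State.setVar_arr,
        Nat.reduceEqDiff, reduceIte, hu]
      exact hW.le_word (by omega)
    · simp only [Prog.run, Expr.eval, Expr.eval_free, State.setVar_var, State.setVar_arr,
        Nat.reduceEqDiff, reduceIte, hu, hc]
    rintro τ - rfl
    refine Runs.seq (Q := fun τ => τ = ((σ.setVar 9 d).setVar 8 c).setVar 10 c) (T₁ := 10)
      (Runs.of_safe ?_ (by decide) ?_) ?_ (T₂ := 300 * n + 340) (by omega)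
    · simp only [Prog.Safe, Expr.eval, State.setVar_var, reduceIte]
      exact hW.le_word (by omega)
    · simp only [Prog.run, Expr.eval, State.setVar_var, reduceIte]
    rintro τ - rfl
    refine Runs.seq
      (Q := fun τ => τ = (((σ.setVar 9 d).setVar 8 c).setVar 10 c).setVar 12 (s j + 1))
      (T₁ := 20) (Runs.of_safe ?_ (by decide) ?_) ?_ (T₂ := 300 * n + 300) (by omega)
    · simp only [Prog.Safe, Expr.eval, Expr.eval_mark, State.setVar_var, State.setVar_arr,
        Nat.reduceEqDiff, reduceIte, hmark]
      exact hW.le_word (by omega)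
    · simp only [Prog.run, Expr.eval, Expr.eval_mark, State.setVar_var, State.setVar_arr,
        Nat.reduceEqDiff, reduceIte, hmark]
    rintro τ - rfl
    refine (runs_kempeLoop (m := m) (c := c) (d := d) (x := s j)
      (σ := (((σ.setVar 9 d).setVar 8 c).setVar 10 c).setVar 12 (s j + 1)) hW
      (fun p q h => hn p q (SimpleGraph.deleteEdges_le _ h)) hN (by simp) (by simp) (by simp)
      (by simp) hcd (by omega) (by omega) (hjd ▸ hN'.free (s j)) hsj).mono le_rfl ?_
    rintro τ - ⟨T, g, hw, h7, h8⟩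
    simp only [State.setVar_arr] at hw h7 h8
    have hN'' := hw.exchange hN' hcn hdn
    obtain ⟨i', h1, h2⟩ := hw.exists_fan hN' hc hf hj rfl hjd
      (fun r hr => (hsn _ _ i hN' hf r hr).ne.symm)
    simp only [Colours, h7, h8]
    exact ⟨hN'', i', hin _ _ i' hN'' h1, h1, h2⟩
  · simp only [Expr.eval, Expr.eval_nbr, Expr.eval_free, hu, hx] at he
    exact Runs.of_safe trivial (by simp [Prog.bound]) ⟨hN, i, hin _ _ i hN' hf, hf, he⟩
  · have : (((Expr.var 4).nbr (Expr.var 6).free)).cost ≤ 20 := by decide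
    omega

end

namespace Prog

/-- Find a second free colour of the vertex in register 5. -/
def spareLoop : Prog :=
  .while (.add (.nbr (.var 5) (.var 7)) (.eq (.var 7) (.free (.var 5))))
    (.assign 7 (.add (.var 7) (.const 1)))

/-- Move the uncoloured edge along the fan, by one vertex. Register 7 holds a second free colour of
the vertex in register 6. -/
def shiftBody : Prog :=
  .seq (.assign 13 (.free (.var 6))) <|
  .seq (.assign 14 (.sub (.nbr (.var 4) (.var 13)) (.const 1))) <|
  .seq (.store 7 (.pair (.var 4) (.var 13)) (.add (.var 6) (.const 1))) <|
  .seq (.store 7 (.pair (.var 6) (.var 13)) (.add (.var 4) (.const 1))) <|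
  .seq (.store 7 (.pair (.var 14) (.var 13)) (.const 0)) <|
  .seq (.store 8 (.var 6) (.var 7)) <|
  .seq (.assign 7 (.var 13)) (.assign 6 (.var 14))

/-- Move the uncoloured edge along the fan, until it can be coloured. -/
def shiftLoop : Prog := .while (.nbr (.var 4) (.free (.var 6))) shiftBody

/-- Colour the edge between the vertices in the registers 4 and 6 with the free colour of the
latter. -/
def colourEdge : Prog :=
  .seq (.assign 13 (.free (.var 6))) <|
  .seq (.store 7 (.pair (.var 4) (.var 13)) (.add (.var 6) (.const 1))) <|
  .seq (.store 7 (.pair (.var 6) (.var 13)) (.add (.var 4) (.const 1))) <|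
  .seq (.store 8 (.var 6) (.var 7)) <|
    .assign 13 (.const 0)

/-- Find a free colour of the vertex in register 4. -/
def freeLoop : Prog :=
  .while (.nbr (.var 4) (.var 13)) (.assign 13 (.add (.var 13) (.const 1)))

/-- Extend the colouring to the edge whose number is in register 3. -/
def insertEdge : Prog :=
  .seq (.seq (.assign 4 (.get 0 (.var 3))) <|
    .seq (.assign 5 (.get 1 (.var 3))) (.assign 6 (.var 5))) <|
  .seq fanWalk <|
  .seq kempeStep <|
  .seq (.seq (.assign 6 (.var 5)) (.assign 7 (.const 0))) <|
  .seq spareLoop <|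
  .seq shiftLoop <|
  .seq colourEdge <|
  .seq freeLoop
    (.store 8 (.var 4) (.var 13))

/-- Run `p` for each edge, with the number of the edge in register 3. -/
def forEdges (p : Prog) : Prog :=
  .seq (.assign 3 (.const 0)) <|
    .while (.lt (.var 3) (.var 1)) (.seq p (.assign 3 (.add (.var 3) (.const 1))))

end Prog

/-- The rule for loops over the edges: `I j` holds when the first `j` edges have been treated. -/
theorem Runs.forEdges {W m B T : ℕ} {p : Prog} {σ : State} {Q : State → Prop}
    (I : ℕ → State → Prop) (hm : σ.var 1 = m) (hmW : m ≤ W) (h1 : p.writesVar 1 = false)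
    (h3 : p.writesVar 3 = false) (h0 : I 0 (σ.setVar 3 0))
    (step : ∀ j τ, j < m → Frame (.forEdges p) σ τ → τ.var 3 = j → I j τ →
      Runs W p τ B fun ρ => I (j + 1) (ρ.setVar 3 (j + 1)))
    (hT : m * (B + 20) + 20 ≤ T) (post : ∀ τ, I m τ → Q τ) :
    Runs W (.forEdges p) σ T Q := by
  refine Runs.seq (T₁ := 2) (T₂ := m * (B + 20) + 18) (Q := fun τ => τ = σ.setVar 3 0)
    (Runs.of_safe (by simp [Prog.Safe, Expr.eval]) (by decide) (by simp [Prog.run, Expr.eval]))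
    ?_ (by omega)
  rintro τ₀ hf₀ rfl
  refine Runs.while_loop (B := B + 10) (c := 9) (k := m)
    (fun k τ => ∃ j, j + k = m ∧ τ.var 3 = j ∧ I j τ)
    ⟨0, by omega, by simp, h0⟩ ?_ (by decide)
    (by rw [show B + 10 + 9 + 1 = B + 20 from rfl]; omega) ?_
  · rintro k τ hf ⟨j, hj, hτ3, hI⟩ he
    have hfr : ∀ τ', Frame (.while (.lt (.var 3) (.var 1))
        (.seq p (.assign 3 (.add (.var 3) (.const 1))))) (σ.setVar 3 0) τ' →
        Frame (.forEdges p) σ τ' := by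
      intro τ' h
      constructor
      · intro x hx
        simp only [Prog.forEdges, Prog.writesVar, Bool.or_eq_false_iff] at hx
        rw [h.var x (by simp [Prog.writesVar, hx])]
        have : x ≠ 3 := by simpa using hx.1
        simp [this]
      · intro x hx
        simp only [Prog.forEdges, Prog.writesArr, Bool.or_eq_false_iff] at hx
        rw [h.arr x (by simp [Prog.writesArr, hx])]
        rfl
    have hfτ : Frame (.forEdges p) σ τ := by
      refine hfr τ ⟨fun x hx => hf.var x ?_, fun x hx => hf.arr x ?_⟩
      · simpa [Prog.writesVar] using hx
      · simpa [Prog.writesArr] using hx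
    have hτ1 : τ.var 1 = m := by
      rw [hfτ.var 1 (by simp [Prog.forEdges, Prog.writesVar, h1]), hm]
    simp only [Expr.eval, hτ3, hτ1, ne_eq, ite_eq_right_iff, one_ne_zero, imp_false,
      not_not] at he
    refine ⟨k - 1, by omega, Runs.seq (T₁ := B) (T₂ := 10) (step j τ he hfτ hτ3 hI) ?_ le_rfl⟩
    intro ρ hρ hI'
    have hρ3 : ρ.var 3 = j := (hρ.var 3 h3).trans hτ3
    refine Runs.of_safe ?_ (by decide) ⟨j + 1, by omega, ?_, ?_⟩
    · simp only [Prog.Safe, Expr.eval, hρ3]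
      omega
    · simp [Prog.run, Expr.eval, hρ3]
    · simpa [Prog.run, Expr.eval, hρ3] using hI'
  · rintro k τ hf ⟨j, hj, hτ3, hI⟩ he
    have hτ1 : τ.var 1 = m := by
      rw [hf.var 1 (by simp [Prog.writesVar, h1])]
      simpa using hm
    simp only [Expr.eval, hτ3, hτ1, ite_eq_right_iff, one_ne_zero, imp_false, not_lt] at he
    obtain rfl : j = m := by omega
    exact post τ hI

section

variable {W n m Δ : ℕ} {K : SimpleGraph ℕ}

/-- The situation in which the edge `ux` is the only uncoloured one and `b` is a free colour of `x`
besides the stored one. -/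
structure Hole (K : SimpleGraph ℕ) (Δ : ℕ) (σ : State) (u x b : ℕ) : Prop where
  adj : K.Adj u x
  colours : Colours (K.deleteEdges {s(u, x)}) (Δ + 1) σ
  free : table (σ.arr 7) x b = 0
  ne : b ≠ σ.arr 8 x
  lt : b < Δ + 1

theorem runs_shiftLoop {σ : State} {u i : ℕ} {s : ℕ → ℕ} (hW : Fits W n m) (hΔ : Δ < n)
    (hn : ∀ p q, K.Adj p q → q < n) (hu : σ.var 4 = u) (hx : σ.var 6 = s 0)
    (hole : Hole K Δ σ u (s 0) (σ.var 7)) (hin : i ≤ n)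
    (hf : Fan (table (σ.arr 7)) (σ.arr 8) u s 0 i)
    (hend : table (σ.arr 7) u (σ.arr 8 (s i)) = 0) :
    Runs W .shiftLoop σ (250 * n + 250) fun τ => Hole K Δ τ u (τ.var 6) (τ.var 7) ∧
      table (τ.arr 7) u (τ.arr 8 (τ.var 6)) = 0 := by
  refine Runs.while_loop (B := 200) (c := 20) (k := i)
    (fun k τ => ∃ t, t + k = i ∧ τ.var 6 = s t ∧ Hole K Δ τ u (s t) (τ.var 7) ∧
      Fan (table (τ.arr 7)) (τ.arr 8) u s t i ∧ table (τ.arr 7) u (τ.arr 8 (s i)) = 0)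
    ⟨0, by omega, hx, hole, hf, hend⟩ ?_ (by decide) (by omega) ?_
  · rintro k τ hfr ⟨t, htk, h6, hole, hf, hend⟩ he
    have h4 : τ.var 4 = u := (hfr.var 4 rfl).trans hu
    simp only [Expr.eval, Expr.eval_nbr, Expr.eval_free, h4, h6] at he
    have hti : t < i := by
      rcases Nat.lt_or_ge t i with h | h
      · exact h
      · obtain rfl : t = i := by omega
        exact (he hend).elim
    obtain ⟨b, hb⟩ : ∃ b, τ.var 7 = b := ⟨_, rfl⟩
    rw [hb] at hole
    obtain ⟨a, ha⟩ : ∃ a, a = τ.arr 8 (s t) := ⟨_, rfl⟩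
    have hy : table (τ.arr 7) u a = s (t + 1) + 1 := ha ▸ hf.next t le_rfl hti
    have hsh := PartialColouring.shift_fan hole.colours hole.adj hf hti ha
      ⟨hole.free, hole.ne, hole.lt⟩ rfl rfl
    have hun := hn _ _ hole.adj.symm
    have hxn := hn _ _ hole.adj
    have hyn := hn _ _ hsh.1
    have han : a < Δ + 1 := ha ▸ hole.colours.free_lt (s t)
    have hbn := hole.lt
    refine ⟨k - 1, by omega, Runs.of_safe ?_ (by decide) ?_⟩
    · simp only [Prog.shiftBody, Prog.Safe, Prog.run, Expr.eval, Expr.eval_pair, Expr.eval_nbr,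
        Expr.eval_free, State.setVar_var, State.setVar_arr, State.setArr_var,
        Nat.reduceEqDiff, reduceIte, h4, h6, hb, ← ha, hy, Nat.add_sub_cancel]
      exact ⟨hW.le_word (by omega), hW.le_word (by omega),
        ⟨hW.pair_le (by omega) (by omega), hW.le_word (by omega)⟩,
        ⟨hW.pair_le (by omega) (by omega), hW.le_word (by omega)⟩,
        ⟨hW.pair_le (by omega) (by omega), hW.le_word (by omega)⟩,
        ⟨hW.le_word (by omega), hW.le_word (by omega)⟩,
        hW.le_word (by omega), hW.le_word (by omega)⟩
    · have hrun : ∃ ρ, Prog.shiftBody.run τ = ρ ∧ ρ.var 6 = s (t + 1) ∧ ρ.var 7 = a ∧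
          table (ρ.arr 7) = setAt (setAt (setAt (table (τ.arr 7)) u a (s t + 1)) (s t) a (u + 1))
            (s (t + 1)) a 0 ∧ ρ.arr 8 = Function.update (τ.arr 8) (s t) b := by
        refine ⟨_, rfl, ?_⟩
        simp only [Prog.shiftBody, Prog.run, Expr.eval, Expr.eval_pair, Expr.eval_nbr,
          Expr.eval_free, State.setVar_var, State.setVar_arr, State.setArr_var, State.setArr_arr,
          Nat.reduceEqDiff, reduceIte, h4, h6, hb, ← ha, hy, Nat.add_sub_cancel, table_update,
          and_self]
      obtain ⟨ρ, hρ, h6', h7', hN', hF'⟩ := hrun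
      rw [← hN', ← hF'] at hsh
      obtain ⟨hadj, hcol, hfan, h0, hF'', hfree, hne, hlt⟩ := hsh
      rw [hρ]
      refine ⟨t + 1, by omega, h6', ⟨hadj, hcol, ?_, ?_, ?_⟩, hfan, ?_⟩
      · rw [h7']; exact hfree
      · rw [h7']; exact hne
      · rw [h7']; exact hlt
      · rw [h0, hF'' _ (hf.inj t i le_rfl hti le_rfl).symm]
        exact hend
  · rintro k τ hfr ⟨t, htk, h6, hole, hf, hend⟩ he
    have h4 : τ.var 4 = u := (hfr.var 4 rfl).trans hu
    simp only [Expr.eval, Expr.eval_nbr, Expr.eval_free, h4] at he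
    exact ⟨h6 ▸ hole, he⟩

theorem runs_colourEdge {σ : State} {u x : ℕ} (hW : Fits W n m) (hΔ : Δ < n)
    (hn : ∀ p q, K.Adj p q → q < n) (hK : DegreeLE K Δ) (hu : σ.var 4 = u) (hx : σ.var 6 = x)
    (hole : Hole K Δ σ u x (σ.var 7)) (hfree : table (σ.arr 7) u (σ.arr 8 x) = 0) :
    Runs W (.seq .colourEdge (.seq .freeLoop (.store 8 (.var 4) (.var 13)))) σ (100 * n + 100)
      fun τ => Colours K (Δ + 1) τ := by
  have hun := hn _ _ hole.adj.symm
  have hxn := hn _ _ hole.adj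
  have hne := hole.adj.ne
  have han := hole.colours.free_lt x
  have hbn := hole.lt
  have hcol : PartialColouring (K.deleteEdges {s(u, x)}) (Δ + 1) (table (σ.arr 7)) (σ.arr 8) :=
    hole.colours
  have hcol' : PartialColouring (K.deleteEdges {s(x, u)}) (Δ + 1) (table (σ.arr 7)) (σ.arr 8) := by
    rw [Sym2.eq_swap]
    exact hcol
  obtain ⟨a, ha⟩ : ∃ a, a = σ.arr 8 x := ⟨_, rfl⟩
  obtain ⟨b, hb⟩ : ∃ b, σ.var 7 = b := ⟨_, rfl⟩
  -- `u` has two free colours, so that one is left besides `a`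
  have hex : ∃ c, c ≤ Δ ∧ table (σ.arr 7) u c = 0 ∧ c ≠ a := by
    obtain ⟨c, hc, hc0, hcF⟩ := hcol'.exists_second_free hole.adj.symm hK
    by_cases h : c = a
    · exact ⟨_, Nat.le_of_lt_succ (hcol.free_lt u), hcol.free u, fun h' => hcF (h.trans h'.symm)⟩
    · exact ⟨c, hc, hc0, h⟩
  refine Runs.seq (T₁ := 60) (T₂ := 100 * n + 40)
    (Q := fun τ => τ.var 4 = u ∧ τ.var 13 = 0 ∧
      table (τ.arr 7) = setAt (setAt (table (σ.arr 7)) u a (x + 1)) x a (u + 1) ∧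
      τ.arr 8 = Function.update (σ.arr 8) x b)
    (Runs.of_safe ?_ (by decide) ?_) ?_ (by omega)
  · simp only [Prog.colourEdge, Prog.Safe, Prog.run, Expr.eval, Expr.eval_pair,
      Expr.eval_free, State.setVar_var, State.setArr_var,
      Nat.reduceEqDiff, reduceIte, hu, hx, hb]
    exact ⟨hW.le_word (by omega), ⟨hW.pair_le (by omega) (by omega), hW.le_word (by omega)⟩,
      ⟨hW.pair_le (by omega) (by omega), hW.le_word (by omega)⟩,
      ⟨hW.le_word (by omega), hW.le_word (by omega)⟩, hW.le_word (by omega)⟩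
  · simp only [Prog.colourEdge, Prog.run, Expr.eval, Expr.eval_pair,
      Expr.eval_free, State.setVar_var, State.setVar_arr, State.setArr_var, State.setArr_arr,
      Nat.reduceEqDiff, reduceIte, hu, hx, hb, ← ha, table_update, and_self]
  rintro τ - ⟨h4, h13, h7, h8⟩
  have hev : ∀ c, (Expr.nbr (.var 4) (.var 13)).eval (τ.setVar 13 c) = 0 ↔
      table (σ.arr 7) u c = 0 ∧ c ≠ a := by
    intro c
    simp only [Expr.eval_nbr, Expr.eval, State.setVar_var, State.setVar_arr, Nat.reduceEqDiff,
      reduceIte, h4, h7, setAt]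
    grind
  refine Runs.seq (T₁ := 90 * n + 30) (T₂ := 10)
    (Q := fun ρ => ∃ c, c ≤ Δ ∧ table (σ.arr 7) u c = 0 ∧ c ≠ a ∧ ρ = τ.setVar 13 c)
    (Runs.search (c := 20) Δ h13 ?_ (hW.le_word (by omega)) (by decide) (by omega) ?_) ?_ (by omega)
  · obtain ⟨c, hc, h⟩ := hex
    exact ⟨c, hc, (hev c).2 h⟩
  · intro c hc h0 _
    obtain ⟨h1, h2⟩ := (hev c).1 h0
    exact ⟨c, hc, h1, h2, rfl⟩
  rintro ρ - ⟨c, hc, hc0, hca, rfl⟩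
  refine Runs.of_safe ?_ (by decide) ?_
  · simp only [Prog.Safe, Expr.eval, State.setVar_var, Nat.reduceEqDiff, reduceIte, h4]
    exact ⟨hW.le_word (by omega), hW.le_word (by omega)⟩
  · simp only [Colours, Prog.run, Expr.eval, State.setVar_var, State.setVar_arr, State.setArr_arr,
      Nat.reduceEqDiff, reduceIte, h4, h7, h8]
    refine hcol.add_edge hole.adj (ha ▸ hfree) (ha ▸ hcol.free x) (ha ▸ han) ?_ ?_ ?_
    · intro p hpu hpx
      simp [hpu, hpx]
    · simp only [Function.update_self]
      exact ⟨hc0, hca, by omega⟩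
    · rw [Function.update_of_ne hne.symm, Function.update_self, ha, ← hb]
      exact ⟨hole.free, hole.ne, hole.lt⟩

theorem runs_insertEdge {σ : State} {u v : ℕ} (hW : Fits W n m) (hΔ : Δ < n)
    (hn : ∀ p q, K.Adj p q → q < n) (hK : DegreeLE K Δ) (hJ : σ.var 3 ≤ m)
    (hu : σ.arr 0 (σ.var 3) = u) (hv : σ.arr 1 (σ.var 3) = v) (huv : K.Adj u v)
    (hN : Colours (K.deleteEdges {s(u, v)}) (Δ + 1) σ)
    (hmark : ∀ a, table (σ.arr 9) (σ.var 3) a = 0) :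
    Runs W .insertEdge σ (900 * n + 1000) fun τ => Colours K (Δ + 1) τ ∧
      ∀ J, J ≠ σ.var 3 → table (τ.arr 9) J = table (σ.arr 9) J := by
  have hun := hn _ _ huv.symm
  have hvn := hn _ _ huv
  refine Runs.seq (T₁ := 20) (T₂ := 900 * n + 980)
    (Q := fun τ => τ = ((σ.setVar 4 u).setVar 5 v).setVar 6 v)
    (Runs.of_safe ?_ (by decide) ?_) ?_ (by omega)
  · simp only [Prog.Safe, Prog.run, Expr.eval, State.setVar_var, State.setVar_arr,
      Nat.reduceEqDiff, reduceIte, hu, hv]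
    exact ⟨hW.le_word (by omega), hW.le_word (by omega), hW.le_word (by omega)⟩
  · simp only [Prog.run, Expr.eval, State.setVar_var, State.setVar_arr,
      Nat.reduceEqDiff, reduceIte, hu, hv]
  rintro τ - hτ
  have hτv : ∀ x, τ.var x = if x = 6 then v else if x = 5 then v else if x = 4 then u else
      σ.var x := by
    intro x
    simp [hτ]
  have hτa : τ.arr = σ.arr := by
    simp [hτ]
  have hτ3 : τ.var 3 = σ.var 3 := by simp [hτv]
  clear hτ
  refine Runs.seq (T₁ := 100 * n + 100) (T₂ := 800 * n + 880)
    (runs_fanWalk (K := K) (u := u) (v := v) (m := m) hW hΔ hn ?_ (by simp [hτv]) (by simp [hτv])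
      hvn (by omega) (by simpa [hτ3, hτa] using hmark)) ?_ (by omega)
  · simpa only [Colours, hτa] using hN
  rintro ρ hfρ ⟨hmarks, s, i, hs0, h6, hfan, hend⟩
  have hρ4 : ρ.var 4 = u := (hfρ.var 4 rfl).trans (by simp [hτv])
  have hρ5 : ρ.var 5 = v := (hfρ.var 5 rfl).trans (by simp [hτv])
  have hρ3 : ρ.var 3 = σ.var 3 := (hfρ.var 3 rfl).trans (by simp [hτv])
  have hρ7 : ρ.arr 7 = σ.arr 7 := (hfρ.arr 7 rfl).trans (by rw [hτa])
  have hρ8 : ρ.arr 8 = σ.arr 8 := (hfρ.arr 8 rfl).trans (by rw [hτa])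
  rw [hτ3, hτa] at hmarks
  rw [hτ3, hτa, ← hρ7, ← hρ8, ← hρ3] at hend
  rw [hτa, ← hρ7, ← hρ8] at hfan
  refine Runs.seq (T₁ := 300 * n + 400) (T₂ := 500 * n + 480)
    (runs_kempeStep (K := K) (u := u) (v := v) (m := m) hW hΔ hn ?_ huv hρ4 hs0 h6 hfan hend) ?_
    (by omega)
  · simpa only [Colours, hρ7, hρ8] using hN
  clear h6 hfan hend
  rintro π hfπ ⟨hcol, i, hin, hfan, hend⟩
  have hπ4 : π.var 4 = u := (hfπ.var 4 rfl).trans hρ4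
  have hπ5 : π.var 5 = v := (hfπ.var 5 rfl).trans hρ5
  rw [← hfπ.arr 9 rfl] at hmarks
  clear hρ7 hρ8 hρ3 hρ4 hρ5 hfπ hfρ
  have hcol' : PartialColouring (K.deleteEdges {s(u, v)}) (Δ + 1) (table (π.arr 7)) (π.arr 8) :=
    hcol
  refine Runs.seq (T₁ := 20) (T₂ := 500 * n + 460)
    (Q := fun τ => τ = (π.setVar 6 v).setVar 7 0)
    (Runs.of_safe ?_ (by decide) ?_) ?_ (by omega)
  · simp only [Prog.Safe, Expr.eval, hπ5]
    exact ⟨hW.le_word (by omega), hW.le_word (by omega)⟩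
  · simp only [Prog.run, Expr.eval, hπ5]
  rintro τ - rfl
  have hev : ∀ b, (Expr.add (.nbr (.var 5) (.var 7)) (.eq (.var 7) (.free (.var 5)))).eval
      (((π.setVar 6 v).setVar 7 0).setVar 7 b) = 0 ↔
      table (π.arr 7) v b = 0 ∧ b ≠ π.arr 8 v := by
    intro b
    simp [Expr.eval, hπ5]
  refine Runs.seq (T₁ := 60 * n + 60) (T₂ := 400 * n + 400)
    (Q := fun τ => ∃ b, b ≤ Δ ∧ table (π.arr 7) v b = 0 ∧ b ≠ π.arr 8 v ∧
      τ = ((π.setVar 6 v).setVar 7 0).setVar 7 b)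
    (Runs.search (c := 30) Δ (by simp) ?_ (hW.le_word (by omega)) (by decide) (by omega) ?_) ?_
    (by omega)
  · obtain ⟨b, hb, h⟩ := hcol'.exists_second_free huv hK
    exact ⟨b, hb, (hev b).2 h⟩
  · intro b hb h0 _
    obtain ⟨h1, h2⟩ := (hev b).1 h0
    exact ⟨b, hb, h1, h2, rfl⟩
  rintro τ - ⟨b, hb, hb0, hbF, hτ⟩
  have hτ4 : τ.var 4 = u := by simp [hτ, hπ4]
  have hτ6 : τ.var 6 = v := by simp [hτ]
  have hτ7 : τ.var 7 = b := by simp [hτ]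
  have hτa : τ.arr = π.arr := by simp [hτ]
  clear hτ
  refine Runs.seq (T₁ := 250 * n + 250) (T₂ := 150 * n + 150)
    (runs_shiftLoop (K := K) (Δ := Δ) (m := m) (s := s) (i := i) hW hΔ hn hτ4 (hτ6.trans hs0.symm)
      ⟨?_, ?_, ?_, ?_, ?_⟩ hin ?_ ?_) ?_ (by omega)
  · rwa [hs0]
  · rw [hs0]
    simpa only [Colours, hτa] using hcol
  · rwa [hs0, hτa, hτ7]
  · rwa [hs0, hτa, hτ7]
  · omega
  · rwa [hτa]
  · rwa [hτa]
  rintro ρ hfρ ⟨hole, hfree⟩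
  have hρ4 : ρ.var 4 = u := (hfρ.var 4 rfl).trans hτ4
  rw [← hτa, ← hfρ.arr 9 rfl] at hmarks
  refine (runs_colourEdge (K := K) (m := m) hW hΔ hn hK hρ4 rfl hole hfree).mono (by omega) ?_
  intro τ' hf' h
  rw [← hf'.arr 9 rfl] at hmarks
  exact ⟨h, hmarks⟩

end

/-- The graph formed by the first `J` edges of the list with the edges `a j`, `b j`. -/
def prefixGraph (a b : ℕ → ℕ) (J : ℕ) : SimpleGraph ℕ where
  Adj p q := p ≠ q ∧ ∃ j < J, s(a j, b j) = s(p, q)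
  symm := ⟨fun p q h => ⟨h.1.symm, by
    obtain ⟨j, hj, h⟩ := h.2
    exact ⟨j, hj, h.trans Sym2.eq_swap⟩⟩⟩
  loopless := ⟨fun _ h => h.1 rfl⟩

theorem prefixGraph_mono {a b : ℕ → ℕ} {J J' : ℕ} (h : J ≤ J') :
    prefixGraph a b J ≤ prefixGraph a b J' := fun _ _ hpq =>
  ⟨hpq.1, hpq.2.imp fun _ hj => ⟨hj.1.trans_le h, hj.2⟩⟩

theorem DegreeLE.mono {K K' : SimpleGraph ℕ} {Δ : ℕ} (h : DegreeLE K' Δ) (hK : K ≤ K') :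
    DegreeLE K Δ := fun v s hs => h v s fun w hw => hK (hs w hw)

/-- `a j`, `b j` for `j < m` are the different edges of a graph on the vertices `0, …, n - 1` whose
degrees are at most `Δ`. -/
structure EdgeInput (n m Δ : ℕ) (a b : ℕ → ℕ) : Prop where
  left_lt : ∀ {j}, j < m → a j < n
  right_lt : ∀ {j}, j < m → b j < n
  ne : ∀ {j}, j < m → a j ≠ b j
  inj : ∀ {j j'}, j < m → j' < m → s(a j, b j) = s(a j', b j') → j = j'
  degree : DegreeLE (prefixGraph a b m) Δ

theorem EdgeInput.adj_lt {n m Δ : ℕ} {a b : ℕ → ℕ} (h : EdgeInput n m Δ a b) {J : ℕ} (hJ : J ≤ m)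
    (p q : ℕ) (hpq : (prefixGraph a b J).Adj p q) : q < n := by
  obtain ⟨-, j, hj, he⟩ := hpq
  have h1 := h.left_lt (hj.trans_le hJ)
  have h2 := h.right_lt (hj.trans_le hJ)
  rcases Sym2.eq_iff.1 he with ⟨-, rfl⟩ | ⟨rfl, -⟩ <;> assumption

theorem EdgeInput.deleteEdges {n m Δ : ℕ} {a b : ℕ → ℕ} (h : EdgeInput n m Δ a b) {j : ℕ}
    (hj : j < m) :
    (prefixGraph a b (j + 1)).deleteEdges {s(a j, b j)} = prefixGraph a b j := by
  ext p q
  simp only [SimpleGraph.deleteEdges_adj, prefixGraph, Set.mem_singleton_iff]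
  constructor
  · rintro ⟨⟨hpq, i, hi, he⟩, hne⟩
    refine ⟨hpq, i, ?_, he⟩
    rcases Nat.lt_succ_iff_lt_or_eq.1 hi with h | rfl
    · exact h
    · exact (hne he.symm).elim
  · rintro ⟨hpq, i, hi, he⟩
    refine ⟨⟨hpq, i, by omega, he⟩, fun hne => ?_⟩
    have := h.inj (by omega) hj (he.trans hne)
    omega

theorem runs_colourEdges {W n m Δ : ℕ} {σ : State} (hW : Fits W n m) (hΔ : Δ < n)
    (hm : σ.var 1 = m) (hin : EdgeInput n m Δ (σ.arr 0) (σ.arr 1))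
    (h7 : ∀ i, σ.arr 7 i = 0) (h8 : ∀ i, σ.arr 8 i = 0) (h9 : ∀ i, σ.arr 9 i = 0) :
    Runs W (.forEdges .insertEdge) σ (m * (900 * n + 1020) + 20) fun τ =>
      Colours (prefixGraph (σ.arr 0) (σ.arr 1) m) (Δ + 1) τ := by
  refine Runs.forEdges (m := m) (B := 900 * n + 1000)
    (fun j τ => Colours (prefixGraph (σ.arr 0) (σ.arr 1) j) (Δ + 1) τ ∧
      ∀ J, j ≤ J → ∀ i, table (τ.arr 9) J i = 0) hm ?_ rfl rfl ⟨?_, ?_⟩ ?_ le_rfl fun τ h => h.1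
  · have := hW.le
    exact hW.le_word (by omega)
  · have hN : table (σ.arr 7) = fun _ _ => 0 := by
      funext p c
      exact h7 _
    have hF : σ.arr 8 = fun _ => 0 := funext h8
    simp only [Colours, State.setVar_arr, hN, hF]
    refine ⟨by simp, ?_, by simp, by simp, by simp, by simp⟩
    intro p q
    simp [prefixGraph]
  · intro J _ i
    exact h9 _
  · rintro j τ hj hf h3 ⟨hcol, hmark⟩
    have ha : τ.arr 0 = σ.arr 0 := hf.arr 0 rfl
    have hb : τ.arr 1 = σ.arr 1 := hf.arr 1 rfl
    refine (runs_insertEdge (K := prefixGraph (σ.arr 0) (σ.arr 1) (j + 1)) (m := m)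
      (u := σ.arr 0 j) (v := σ.arr 1 j) hW hΔ (hin.adj_lt hj)
      (hin.degree.mono (prefixGraph_mono hj)) (by omega) (by rw [ha, h3]) (by rw [hb, h3])
      ⟨hin.ne hj, j, by omega, rfl⟩ ?_ ?_).mono le_rfl ?_
    · rwa [hin.deleteEdges hj]
    · rw [h3]
      exact hmark j le_rfl
    · rintro ρ - ⟨h1, h2⟩
      refine ⟨h1, fun J hJ i => ?_⟩
      rw [State.setVar_arr, h2 J (by omega)]
      exact hmark J (by omega) i

/-! ### Matchings are cographs -/

/-- A graph is a cograph if it is the disjoint union of two cographs. -/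
theorem IsCograph.of_split {V : Type u} (G : SimpleGraph V) (s : Set V)
    (hs : ∀ x ∈ s, ∀ y ∉ s, ¬ G.Adj x y) (h₁ : IsCograph (G.induce s))
    (h₂ : IsCograph (G.induce sᶜ)) : IsCograph G := by
  classical
  refine .iso _ _ ⟨⟨Equiv.Set.sumCompl s, ?_⟩⟩ (.disjointUnion _ _ h₁ h₂)
  rintro (⟨x, hx⟩ | ⟨x, hx⟩) (⟨y, hy⟩ | ⟨y, hy⟩)
  · simp
  · simpa using hs x hx y hy
  · simpa using fun h => hs y hy x hx h.symm
  · simp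

theorem IsCograph.of_matching {V : Type u} [Finite V] [Nonempty V] (G : SimpleGraph V)
    (h : ∀ x y z, G.Adj x y → G.Adj x z → y = z) : IsCograph G := by
  obtain ⟨k, hk⟩ : ∃ k, Nat.card V = k := ⟨_, rfl⟩
  induction k using Nat.strong_induction_on generalizing V with
  | _ k ih =>
    obtain ⟨v⟩ := ‹Nonempty V›
    -- split off the component of `v`
    by_cases hS : ∀ w, w = v ∨ G.Adj v w
    · by_cases hw : ∃ w, G.Adj v w
      · -- a single edge, whose complement has no edges
        obtain ⟨w, hw⟩ := hw
        have hV : ∀ x, x = v ∨ x = w := fun x => (hS x).imp id fun hx => h v x w hx hw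
        rw [← compl_compl G]
        refine .complement _ (.of_split _ {v} ?_ (.single _ (by simp)) (.single _ ?_))
        · rintro x rfl y hy
          obtain rfl := (hV y).resolve_left hy
          simp [hw]
        · have : ({v}ᶜ : Set V) = {w} := by
            ext x
            refine ⟨(hV x).resolve_left, ?_⟩
            rintro rfl
            exact hw.ne.symm
          rw [this]
          simp
      · push Not at hw
        refine .single _ (Nat.card_eq_one_iff_unique.2 ⟨⟨fun x y => ?_⟩, ⟨v⟩⟩)
        rw [(hS x).resolve_right (hw x), (hS y).resolve_right (hw y)]
    · push Not at hS
      obtain ⟨z, hz⟩ := hS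
      have hsub : ∀ s : Set V, s.Nonempty → sᶜ.Nonempty → IsCograph (G.induce s) := by
        intro s hs hs'
        have := hs.to_subtype
        refine ih (Nat.card s) ?_ _ ?_ rfl
        · rw [← hk, Nat.card_coe_set_eq, ← Set.ncard_univ]
          exact Set.ncard_lt_ncard (Set.ssubset_univ_iff.2 (Set.nonempty_compl.1 hs'))
        · intro x y z hxy hxz
          exact Subtype.ext (h x y z hxy hxz)
      refine .of_split _ {w | w = v ∨ G.Adj v w} ?_ (hsub _ ⟨v, Or.inl rfl⟩ ⟨z, ?_⟩)
        (hsub _ ⟨z, ?_⟩ ?_)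
      · rintro x (rfl | hx) y hy hxy
        · exact hy (Or.inr hxy)
        · exact hy (Or.inl (h x y v hxy hx.symm))
      · simpa using hz
      · simpa using hz
      · rw [compl_compl]
        exact ⟨v, Or.inl rfl⟩

/-! ### Cotrees of depth at most two -/

theorem RootedTree.isAncestor_iff {T : RootedTree} (h : ∀ x, T.parent (T.parent x) = T.root)
    (a x : Fin T.size) : T.IsAncestor a x ↔ a = x ∨ a = T.parent x ∨ a = T.root := by
  constructor
  · rintro ⟨j, rfl⟩
    rcases j with _ | _ | j
    · exact Or.inl rfl
    · exact Or.inr (Or.inl rfl)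
    · refine Or.inr (Or.inr ?_)
      induction j with
      | zero => exact h x
      | succ j ih => rw [Function.iterate_succ_apply', ih, T.parent_root]
  · rintro (rfl | rfl | rfl)
    · exact ⟨0, rfl⟩
    · exact ⟨1, rfl⟩
    · exact ⟨2, h x⟩

/-- In a tree of depth at most two, different leaves have their common parent or else the root as
most recent common ancestor. -/
theorem RootedTree.isLCA_iff {T : RootedTree} (h : ∀ x, T.parent (T.parent x) = T.root)
    {x y : Fin T.size} (hxy : x ≠ y) (hx : ¬ T.IsInner x) (hy : ¬ T.IsInner y)
    (a : Fin T.size) : T.IsLCA a x y ↔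
      a = if T.parent x = T.parent y then T.parent x else T.root := by
  have hleaf : ∀ z w, ¬ T.IsInner z → z ≠ w → T.parent w ≠ z ∧ T.root ≠ z := by
    intro z w hz hzw
    have key : ∀ w, z ≠ w → T.parent w ≠ z := fun w hzw h1 => hz ⟨w, hzw.symm, h1⟩
    refine ⟨key w hzw, fun h1 => ?_⟩
    by_cases h2 : T.parent w = z
    · exact key w hzw h2
    · exact key (T.parent w) (Ne.symm h2) ((h w).trans h1)
  have hx' := hleaf x y hx hxy
  have hy' := hleaf y x hy hxy.symm
  have hr := T.parent_root
  simp only [IsLCA, isAncestor_iff h]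
  constructor
  · rintro ⟨h1, h2, h3⟩
    have h4 := h3 (T.parent x)
    have h5 := h3 T.root
    have h6 := h (T.parent x)
    have h7 := h x
    split_ifs with hp
    · grind
    · grind
  · intro ha
    have h7 := h x
    have h8 := h y
    subst ha
    split_ifs with hp
    · grind
    · grind

/-- `P` and `ℓ` are the parent map and the labels of a cotree with the leaves `0, …, n - 1`, the
root `n`, and inner nodes `n + 1, …, s - 1` that are children of the root. -/
structure IsCotreeData (n s : ℕ) (P : ℕ → ℕ) (ℓ : ℕ → Bool) : Prop where
  lt : n < s
  inner : ∀ t, n ≤ t → t < s → P t = n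
  leaf : ∀ v, v < n → n ≤ P v ∧ P v < s
  two : ∀ t, n ≤ t → t < s → ∃ c d, c ≠ d ∧ c < s ∧ d < s ∧ c ≠ n ∧ d ≠ n ∧ P c = t ∧ P d = t
  label : ∀ t, n < t → t < s → ℓ t ≠ ℓ n

namespace IsCotreeData

variable {n s : ℕ} {P : ℕ → ℕ} {ℓ : ℕ → Bool}

theorem parent_lt (h : IsCotreeData n s P ℓ) {x : ℕ} (hx : x < s) : P x < s := by
  rcases Nat.lt_or_ge x n with h1 | h1
  · exact (h.leaf x h1).2
  · rw [h.inner x h1 hx]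
    exact h.lt

theorem le_parent (h : IsCotreeData n s P ℓ) {x : ℕ} (hx : x < s) : n ≤ P x := by
  rcases Nat.lt_or_ge x n with h1 | h1
  · exact (h.leaf x h1).1
  · rw [h.inner x h1 hx]

/-- The rooted tree with the parent map `P`. -/
def tree (h : IsCotreeData n s P ℓ) : RootedTree where
  size := s
  root := ⟨n, h.lt⟩
  parent x := ⟨P x, h.parent_lt x.2⟩
  parent_root := Fin.ext (h.inner n le_rfl h.lt)
  reaches_root x := ⟨2, Fin.ext (h.inner _ (h.le_parent x.2) (h.parent_lt x.2))⟩

theorem parent_parent (h : IsCotreeData n s P ℓ) (x : Fin h.tree.size) :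
    h.tree.parent (h.tree.parent x) = h.tree.root :=
  Fin.ext (h.inner _ (h.le_parent x.2) (h.parent_lt x.2))

theorem isInner_iff (h : IsCotreeData n s P ℓ) (x : Fin h.tree.size) :
    h.tree.IsInner x ↔ n ≤ (x : ℕ) := by
  constructor
  · rintro ⟨c, -, hc⟩
    have := congrArg Fin.val hc
    exact this ▸ h.le_parent c.2
  · intro hx
    obtain ⟨c, -, -, hc, -, hcn, -, hP, -⟩ := h.two x hx x.2
    refine ⟨⟨c, hc⟩, fun hcx => ?_, Fin.ext hP⟩
    subst hcx
    exact hcn (hP.symm.trans (h.inner c hx hc))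

/-- The cotree with the parent map `P` and the labels `ℓ`, in which the leaf of `v` is the node `v`.
-/
def cotree (h : IsCotreeData n s P ℓ) : Cotree (Fin n) where
  toRootedTree := h.tree
  leaf v := ⟨v, v.2.trans h.lt⟩
  leaf_injective v w hvw := by simpa [Fin.ext_iff] using hvw
  range_leaf x := by
    rw [h.isInner_iff, not_le]
    exact ⟨fun ⟨v, hv⟩ => hv ▸ v.2, fun hx => ⟨⟨x, hx⟩, rfl⟩⟩
  two_children x hx := by
    rw [h.isInner_iff] at hx
    obtain ⟨c, d, hcd, hc, hd, hcn, hdn, hPc, hPd⟩ := h.two x hx x.2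
    refine ⟨⟨c, hc⟩, ⟨d, hd⟩, fun h' => hcd (congrArg Fin.val h'), ⟨fun h' => ?_, Fin.ext hPc⟩,
      ⟨fun h' => ?_, Fin.ext hPd⟩⟩
    · subst h'
      exact hcn (hPc.symm.trans (h.inner c hx hc))
    · subst h'
      exact hdn (hPd.symm.trans (h.inner d hx hd))
  label x := ℓ x
  label_ne x c hx hc hcx := by
    rw [h.isInner_iff] at hx hc
    have h1 : P c = x := congrArg Fin.val hcx.2
    rw [h.inner c hc c.2] at h1
    have h2 : (c : ℕ) ≠ x := fun h' => hcx.1 (Fin.ext h')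
    rw [← h1] at h2 ⊢
    exact (h.label c (by omega) c.2).symm

theorem graph_adj (h : IsCotreeData n s P ℓ) (x y : Fin n) :
    h.cotree.graph.Adj x y ↔ x ≠ y ∧ ℓ (if P x = P y then P x else n) = true := by
  refine and_congr_right fun hxy => ?_
  have hne : h.cotree.leaf x ≠ h.cotree.leaf y := fun h' => hxy (h.cotree.leaf_injective h')
  have hl : ∀ z, ¬ h.tree.IsInner (h.cotree.leaf z) := fun z => (h.cotree.range_leaf _).1 ⟨z, rfl⟩
  have key := RootedTree.isLCA_iff (T := h.tree) h.parent_parent hne (hl x) (hl y)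
  have hval : ((if h.tree.parent (h.cotree.leaf x) = h.tree.parent (h.cotree.leaf y)
      then h.tree.parent (h.cotree.leaf x) else h.tree.root : Fin h.tree.size) : ℕ) =
      if P x = P y then P x else n := by
    have : h.tree.parent (h.cotree.leaf x) = h.tree.parent (h.cotree.leaf y) ↔ P x = P y :=
      ⟨congrArg Fin.val, fun h' => Fin.ext h'⟩
    rw [apply_ite Fin.val]
    simp only [this]
    rfl
  rw [← hval]
  exact ⟨fun ⟨a, ha, hl⟩ => (key a).1 ha ▸ hl, fun hl => ⟨_, (key _).2 rfl, hl⟩⟩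

end IsCotreeData

/-- The cotree with a single node. -/
def Cotree.ofUnique : Cotree (Fin 1) where
  size := 1
  root := 0
  parent := id
  parent_root := rfl
  reaches_root _ := ⟨0, Subsingleton.elim _ _⟩
  leaf := id
  leaf_injective := Function.injective_id
  range_leaf x := ⟨fun _ ⟨_, hc, _⟩ => hc (Subsingleton.elim _ _), fun _ => ⟨x, rfl⟩⟩
  two_children := fun _ ⟨_, hc, _⟩ => (hc (Subsingleton.elim _ _)).elim
  label _ := false
  label_ne := fun _ _ ⟨_, hc, _⟩ => (hc (Subsingleton.elim _ _)).elim

/-! ### The cotree of a matching -/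

/-- In the tree with the parent map `P` and the nodes below `s`, the vertices `x ≠ y` with `M x y`
are those with a common parent different from the root `n`. -/
structure IsMatchingTree (n s : ℕ) (M : ℕ → ℕ → Prop) (P : ℕ → ℕ) : Prop where
  lt : n < s
  inner : ∀ t, n ≤ t → t < s → P t = n
  leaf : ∀ v, v < n → n ≤ P v ∧ P v < s
  node : ∀ t, n < t → t < s → ∃ x y, x < n ∧ y < n ∧ x ≠ y ∧ P x = t ∧ P y = t
  adj : ∀ x y, x < n → y < n → x ≠ y → (M x y ↔ P x = P y ∧ P x ≠ n)

namespace IsMatchingTree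

variable {n s : ℕ} {M : ℕ → ℕ → Prop} {P : ℕ → ℕ}

theorem congr {P' : ℕ → ℕ} {M' : ℕ → ℕ → Prop} (h : IsMatchingTree n s M P)
    (hP : ∀ x, x < s → P' x = P x) (hM : ∀ x y, M' x y ↔ M x y) :
    IsMatchingTree n s M' P' := by
  have hlt := h.lt
  refine ⟨h.lt, ?_, ?_, ?_, ?_⟩
  · intro t h1 h2
    rw [hP t h2, h.inner t h1 h2]
  · intro v hv
    rw [hP v (by omega)]
    exact h.leaf v hv
  · intro t h1 h2
    obtain ⟨x, y, hx, hy, hxy⟩ := h.node t h1 h2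
    refine ⟨x, y, hx, hy, ?_⟩
    rwa [hP x (by omega), hP y (by omega)]
  · intro x y hx hy hxy
    rw [hM, hP x (by omega), hP y (by omega)]
    exact h.adj x y hx hy hxy

theorem blank (hP : ∀ x, x ≤ n → P x = n) (hM : ∀ x y, ¬ M x y) :
    IsMatchingTree n (n + 1) M P := by
  refine ⟨by omega, ?_, ?_, ?_, ?_⟩
  · intro t h1 h2
    exact hP t (by omega)
  · intro v hv
    rw [hP v (by omega)]
    omega
  · intro t h1 h2
    omega
  · intro x y hx hy _
    simp [hM, hP x (by omega)]

theorem parent_eq (h : IsMatchingTree n s M P) {u : ℕ} (hu : u < n) (hM : ∀ w, w < n → ¬ M u w) :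
    P u = n := by
  by_contra hne
  obtain ⟨h1, h2⟩ := h.leaf u hu
  obtain ⟨x, y, hx, hy, hxy, hPx, hPy⟩ := h.node (P u) (by omega) h2
  by_cases hux : u = x
  · exact hM y hy ((h.adj u y hu hy (hux ▸ hxy)).2 ⟨hPy.symm, hne⟩)
  · exact hM x hx ((h.adj u x hu hx hux).2 ⟨hPx.symm, hne⟩)

/-- Adding an edge `uv` to the matching. -/
theorem insert {u v : ℕ} {M' : ℕ → ℕ → Prop} {P' : ℕ → ℕ} (h : IsMatchingTree n s M P)
    (hu : u < n) (hv : v < n) (huv : u ≠ v) (hMu : ∀ w, w < n → ¬ M u w)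
    (hMv : ∀ w, w < n → ¬ M v w) (hM' : ∀ x y, M' x y ↔ M x y ∨ s(u, v) = s(x, y))
    (hP' : ∀ x, x ≤ s → P' x = if x = s then n else if x = u ∨ x = v then s else P x) :
    IsMatchingTree n (s + 1) M' P' := by
  have hPu := h.parent_eq hu hMu
  have hPv := h.parent_eq hv hMv
  have hlt := h.lt
  have hleaf : ∀ x, x < n → P' x = if x = u ∨ x = v then s else P x := by
    intro x hx
    rw [hP' x (by omega), if_neg (by omega)]
  refine ⟨by omega, ?_, ?_, ?_, ?_⟩
  · intro t h1 h2
    rw [hP' t (by omega)]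
    by_cases hts : t = s
    · simp [hts]
    · rw [if_neg hts, if_neg (by omega)]
      exact h.inner t h1 (by omega)
  · intro x hx
    rw [hleaf x hx]
    have := h.leaf x hx
    split_ifs <;> omega
  · intro t h1 h2
    by_cases hts : t = s
    · exact ⟨u, v, hu, hv, huv, by rw [hleaf u hu]; simp [hts], by rw [hleaf v hv]; simp [hts]⟩
    · obtain ⟨x, y, hx, hy, hxy, hPx, hPy⟩ := h.node t h1 (by omega)
      refine ⟨x, y, hx, hy, hxy, ?_, ?_⟩
      · rw [hleaf x hx, if_neg (by rintro (rfl | rfl) <;> omega), hPx]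
      · rw [hleaf y hy, if_neg (by rintro (rfl | rfl) <;> omega), hPy]
  · intro x y hx hy hxy
    have h1 := h.adj x y hx hy hxy
    have h2 := h.leaf x hx
    have h3 := h.leaf y hy
    rw [hM', h1, hleaf x hx, hleaf y hy, Sym2.eq_iff]
    grind

/-- On at least three vertices, the tree of a matching is a cotree, with the label 0 for the root
and 1 for the other inner nodes. -/
theorem isCotreeData {ℓ : ℕ → Bool} (h : IsMatchingTree n s M P) (hn : 3 ≤ n)
    (hM : ∀ x y z, M x y → M x z → y = z) (hℓ : ∀ t, n ≤ t → t < s → (ℓ t = true ↔ n < t)) :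
    IsCotreeData n s P ℓ := by
  have hlt := h.lt
  refine ⟨h.lt, h.inner, h.leaf, ?_, ?_⟩
  · intro t h1 h2
    rcases h1.eq_or_lt with rfl | h1
    · by_cases hs : n + 2 < s
      · exact ⟨n + 1, n + 2, by omega, by omega, by omega, by omega, by omega,
          h.inner _ (by omega) (by omega), h.inner _ (by omega) (by omega)⟩
      · have hex : ∃ c, c < n ∧ P c = n := by
          by_contra! hc
          have hP : ∀ c, c < n → P c = n + 1 := fun c hcn => by
            have := h.leaf c hcn
            have := hc c hcn
            omega
          have h3 : ∀ x y, x < n → y < n → x ≠ y → M x y := fun x y hx hy hxy =>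
            (h.adj x y hx hy hxy).2 ⟨by rw [hP x hx, hP y hy], by rw [hP x hx]; omega⟩
          have := hM 0 1 2 (h3 0 1 (by omega) (by omega) (by omega))
            (h3 0 2 (by omega) (by omega) (by omega))
          omega
        obtain ⟨c, hc, hPc⟩ := hex
        by_cases hs' : n + 1 < s
        · exact ⟨c, n + 1, by omega, by omega, by omega, by omega, by omega, hPc,
            h.inner _ (by omega) (by omega)⟩
        · have hP : ∀ c, c < n → P c = n := fun c hcn => by
            have := h.leaf c hcn
            omega
          exact ⟨0, 1, by omega, by omega, by omega, by omega, by omega, hP 0 (by omega),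
            hP 1 (by omega)⟩
    · obtain ⟨x, y, hx, hy, hxy, hPx, hPy⟩ := h.node t h1 h2
      exact ⟨x, y, hxy, by omega, by omega, by omega, by omega, hPx, hPy⟩
  · intro t h1 h2
    have h3 := (hℓ t h1.le h2).2 h1
    have h4 : ℓ n ≠ true := fun h => by
      have := (hℓ n le_rfl hlt).1 h
      omega
    rw [h3]
    exact h4.symm

end IsMatchingTree

/-! ### The program for the cotrees -/

/-!
Register 2 is the number of different colours found so far, and array 10 assigns a positive number
to each of them. Register 13 is the colour of the current edge, 18 the index of its tree, 16 the
position of this tree in the arrays 5 and 6, and 19 the new node.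
-/

namespace Prog

/-- Write the tree of the empty matching, with the number in register 2. -/
def initTree : Prog :=
  .seq (.seq (.assign 16 (.mul (.var 2) (.add (.add (.var 0) (.var 1)) (.const 2)))) <|
    .seq (.store 3 (.var 2) (.var 16)) <|
    .seq (.store 4 (.var 2) (.add (.var 0) (.const 1))) (.assign 17 (.const 0))) <|
  .while (.lt (.var 17) (.add (.var 0) (.const 1))) <|
    .seq (.store 5 (.add (.var 16) (.var 17)) (.var 0)) (.assign 17 (.add (.var 17) (.const 1)))

/-- Find the colour of the edge between the vertices in the registers 4 and 5. -/
def lookup : Prog :=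
  .while (.eq (.eq (.nbr (.var 4) (.var 13)) (.add (.var 5) (.const 1))) (.const 0))
    (.assign 13 (.add (.var 13) (.const 1)))

/-- If the colour in register 13 has not occurred before, give it the next number. -/
def renumber : Prog :=
  .ite (.eq (.get 10 (.var 13)) (.const 0))
    (.seq (.seq (.assign 2 (.add (.var 2) (.const 1))) (.store 10 (.var 13) (.var 2))) initTree)
    .skip

/-- Store the colour of the edge whose number is in register 3, and add the edge to the tree. -/
def addToTree : Prog :=
  .seq (.assign 18 (.sub (.get 10 (.var 13)) (.const 1))) <|
  .seq (.store 2 (.var 3) (.var 18)) <|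
  .seq (.assign 16 (.mul (.var 18) (.add (.add (.var 0) (.var 1)) (.const 2)))) <|
  .seq (.assign 19 (.get 4 (.var 18))) <|
  .seq (.store 5 (.add (.var 16) (.var 4)) (.var 19)) <|
  .seq (.store 5 (.add (.var 16) (.var 5)) (.var 19)) <|
  .seq (.store 5 (.add (.var 16) (.var 19)) (.var 0)) <|
  .seq (.store 6 (.add (.var 16) (.var 19)) (.const 1))
    (.store 4 (.var 18) (.add (.var 19) (.const 1)))

/-- The round for one edge. -/
def treeBody : Prog :=
  .seq (.seq (.assign 4 (.get 0 (.var 3))) <|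
    .seq (.assign 5 (.get 1 (.var 3))) (.assign 13 (.const 0))) <|
  .seq lookup <|
  .seq renumber addToTree

/-- Write the colours and the trees. A blank tree is always kept in reserve; it becomes the result
if there are no edges. -/
def buildTrees : Prog :=
  .seq initTree <|
  .seq (forEdges treeBody) <|
  .ite (.eq (.var 2) (.const 0)) (.assign 2 (.const 1)) .skip

end Prog

/-- The trees are stored at a distance of `n + m + 2`. -/
def stride (n m : ℕ) : ℕ := n + m + 2

theorem stride_inj {n m i i' x x' : ℕ} (hx : x < stride n m) (hx' : x' < stride n m)
    (h : i * stride n m + x = i' * stride n m + x') : i = i' ∧ x = x' := by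
  have key : ∀ {i i' x x' : ℕ}, x < stride n m → i * stride n m + x = i' * stride n m + x' →
      i' ≤ i := by
    intro i i' x x' hx h
    by_contra hlt
    have : (i + 1) * stride n m ≤ i' * stride n m := Nat.mul_le_mul_right _ (by omega)
    rw [Nat.succ_mul] at this
    omega
  obtain rfl : i = i' := le_antisymm (key hx' h.symm) (key hx h)
  exact ⟨rfl, by omega⟩

theorem Fits.stride_le {W n m i x : ℕ} (h : Fits W n m) (hi : i ≤ n) (hx : x ≤ stride n m) :
    i * stride n m + x ≤ W := by
  have h1 := h.le
  have h2 := h.pos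
  refine le_trans ?_ h.word
  have h3 : i * stride n m ≤ n * stride n m := Nat.mul_le_mul_right _ hi
  have h4 : n * stride n m ≤ n * (n * n + n + 2) := Nat.mul_le_mul_left _ (by
    unfold stride
    omega)
  unfold stride at hx
  nlinarith [Nat.mul_le_mul h2 h2, Nat.mul_le_mul (Nat.mul_le_mul h2 h2) h2]

section

variable {W n m Δ : ℕ} {a b : ℕ → ℕ} {N : ℕ → ℕ → ℕ} {F : ℕ → ℕ}

theorem runs_initTree {σ : State} {k : ℕ} (hW : Fits W n m) (h0 : σ.var 0 = n) (h1 : σ.var 1 = m)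
    (h2 : σ.var 2 = k) (hk : k ≤ n) :
    Runs W .initTree σ (50 * n + 100) fun τ =>
      τ.arr 3 = Function.update (σ.arr 3) k (k * stride n m) ∧
      τ.arr 4 = Function.update (σ.arr 4) k (n + 1) ∧
      (∀ x, x ≤ n → τ.arr 5 (k * stride n m + x) = n) ∧
      ∀ y, (∀ x, x ≤ n → y ≠ k * stride n m + x) → τ.arr 5 y = σ.arr 5 y := by
  have hst : (n + m + 2) = stride n m := rfl
  refine Runs.seq (T₁ := 30) (T₂ := 50 * n + 70)
    (Q := fun τ => τ.var 16 = k * stride n m ∧ τ.var 17 = 0 ∧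
      τ.arr 3 = Function.update (σ.arr 3) k (k * stride n m) ∧
      τ.arr 4 = Function.update (σ.arr 4) k (n + 1))
    (Runs.of_safe ?_ (by decide) ?_) ?_ (by omega)
  · simp only [Prog.Safe, Prog.run, Expr.eval, State.setVar_var, State.setArr_var,
      Nat.reduceEqDiff, reduceIte, h0, h1, h2, hst]
    have := hW.stride_le (x := 0) hk (by omega)
    exact ⟨this, ⟨hW.le_word (by omega), this⟩, ⟨hW.le_word (by omega),
      hW.le_word (by have := hW.pos; omega)⟩, hW.le_word (by omega)⟩
  · simp only [Prog.run, Expr.eval, State.setVar_var, State.setArr_var, State.setVar_arr,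
      State.setArr_arr, Nat.reduceEqDiff, reduceIte, h0, h1, h2, hst, and_self]
  rintro τ hfτ ⟨h16, h17, h3, h4⟩
  have h5 : τ.arr 5 = σ.arr 5 := hfτ.arr 5 rfl
  have h0' : τ.var 0 = n := (hfτ.var 0 rfl).trans h0
  refine Runs.while_loop (B := 20) (c := 10) (k := n + 1)
    (fun k' ρ => ∃ w, w + k' = n + 1 ∧ ρ.var 17 = w ∧
      (∀ x, x < w → ρ.arr 5 (k * stride n m + x) = n) ∧
      ∀ y, (∀ x, x ≤ n → y ≠ k * stride n m + x) → ρ.arr 5 y = σ.arr 5 y)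
    ⟨0, by omega, h17, by simp, fun y _ => by rw [h5]⟩ ?_ (by decide) (by omega) ?_
  · rintro k' ρ hfρ ⟨w, hw, hρ17, hin, hout⟩ he
    have hρ0 : ρ.var 0 = n := (hfρ.var 0 rfl).trans h0'
    have hρ16 : ρ.var 16 = k * stride n m := (hfρ.var 16 rfl).trans h16
    simp only [Expr.eval, hρ17, hρ0, ne_eq, ite_eq_right_iff, one_ne_zero, imp_false,
      not_not] at he
    refine ⟨k' - 1, by omega, Runs.of_safe ?_ (by decide) ⟨w + 1, by omega, ?_, ?_, ?_⟩⟩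
    · simp only [Prog.Safe, Prog.run, Expr.eval, State.setArr_var, hρ17, hρ0, hρ16]
      exact ⟨⟨hW.stride_le hk (by unfold stride; omega), hW.le_word (by omega)⟩,
        hW.le_word (by have := hW.pos; omega)⟩
    · simp [Prog.run, Expr.eval, hρ17]
    · intro x hx
      simp only [Prog.run, Expr.eval, State.setArr_arr, State.setVar_arr, reduceIte, hρ17, hρ0,
        hρ16, Function.update_apply]
      split_ifs with h
      · rfl
      · exact hin x (by omega)
    · intro y hy
      simp only [Prog.run, Expr.eval, State.setArr_arr, State.setVar_arr, reduceIte, hρ17, hρ0,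
        hρ16, Function.update_apply, if_neg (hy w (by omega))]
      exact hout y hy
  · rintro k' ρ hfρ ⟨w, hw, hρ17, hin, hout⟩ he
    have hρ0 : ρ.var 0 = n := (hfρ.var 0 rfl).trans h0'
    simp only [Expr.eval, hρ17, hρ0, ite_eq_right_iff, one_ne_zero, imp_false, not_lt] at he
    refine ⟨(hfρ.arr 3 rfl).trans h3, (hfρ.arr 4 rfl).trans h4, fun x hx => hin x (by omega), hout⟩

/-- Two vertices are related if they form an edge of colour `i`, among the first `j` edges. -/
def ClassRel (a b κ : ℕ → ℕ) (j i x y : ℕ) : Prop :=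
  ∃ j' < j, κ j' = i ∧ s(a j', b j') = s(x, y)

/-- The first `j` edges have been treated: array 10 numbers the colours of `N` that have occurred,
array 2 holds the numbers of the colours of the edges, and there is a tree for each of these
colours, as well as a blank one. -/
structure TreeInv (n m Δ : ℕ) (a b : ℕ → ℕ) (N : ℕ → ℕ → ℕ) (j : ℕ) (τ : State) : Prop where
  index : ∀ i, i < τ.var 2 → ∃ c, c ≤ Δ ∧ τ.arr 10 c = i + 1
  index_le : ∀ c, τ.arr 10 c ≤ τ.var 2
  index_inj : ∀ {c c'}, τ.arr 10 c = τ.arr 10 c' → τ.arr 10 c ≠ 0 → c = c'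
  colour : ∀ j', j' < j → ∃ c, N (a j') c = b j' + 1 ∧ τ.arr 10 c = τ.arr 2 j' + 1
  offset : ∀ i, i ≤ τ.var 2 → τ.arr 3 i = i * stride n m
  size_le : ∀ i, i ≤ τ.var 2 → τ.arr 4 i ≤ n + 1 + j
  tree : ∀ i, i ≤ τ.var 2 → IsMatchingTree n (τ.arr 4 i) (ClassRel a b (τ.arr 2) j i)
    (fun x => τ.arr 5 (i * stride n m + x))
  label_one : ∀ i, i ≤ τ.var 2 → ∀ x, n < x → x < τ.arr 4 i → τ.arr 6 (i * stride n m + x) = 1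
  label_zero : ∀ i x, x ≤ n → τ.arr 6 (i * stride n m + x) = 0

theorem TreeInv.count_le {j : ℕ} {τ : State} (h : TreeInv n m Δ a b N j τ) : τ.var 2 ≤ Δ + 1 := by
  choose! c hc hci using h.index
  have := Finset.card_le_card_of_injOn (s := Finset.range (τ.var 2)) (t := Finset.range (Δ + 1)) c
    (fun i hi => by
      simp only [Finset.coe_range, Set.mem_Iio] at hi ⊢
      have := hc i hi
      omega) (by
    intro i hi i' hi' h'
    simp only [Finset.coe_range, Set.mem_Iio] at hi hi'
    have h1 := hci i hi
    have h2 := hci i' hi'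
    rw [h'] at h1
    omega)
  simpa using this

/-- The invariant only depends on certain parts of the memory. -/
theorem TreeInv.congr {j : ℕ} {τ ρ : State} (h : TreeInv n m Δ a b N j τ)
    (hv : ρ.var 2 = τ.var 2) (h2 : ρ.arr 2 = τ.arr 2) (h3 : ρ.arr 3 = τ.arr 3)
    (h4 : ρ.arr 4 = τ.arr 4) (h5 : ρ.arr 5 = τ.arr 5) (h6 : ρ.arr 6 = τ.arr 6)
    (h10 : ρ.arr 10 = τ.arr 10) : TreeInv n m Δ a b N j ρ := by
  constructor
  · rw [hv, h10]; exact h.index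
  · rw [hv, h10]; exact h.index_le
  · rw [h10]; exact h.index_inj
  · rw [h10, h2]; exact h.colour
  · rw [hv, h3]; exact h.offset
  · rw [hv, h4]; exact h.size_le
  · rw [hv, h4, h2, h5]; exact h.tree
  · rw [hv, h4, h6]; exact h.label_one
  · rw [h6]; exact h.label_zero

theorem PartialColouring.of_sym2 {K : SimpleGraph ℕ} {D p q x y c : ℕ}
    (hN : PartialColouring K D N F) (h : N p c = q + 1) (he : s(p, q) = s(x, y)) :
    N x c = y + 1 := by
  rcases Sym2.eq_iff.1 he with ⟨rfl, rfl⟩ | ⟨rfl, rfl⟩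
  · exact h
  · exact hN.symm h

/-- After this step, the colour `c` of the edge has a number, and all the other numbers in use
belong to colours of previous edges. -/
theorem runs_renumber {τ : State} {j c : ℕ} (hW : Fits W n m) (hΔ : Δ < n)
    (h0 : τ.var 0 = n) (h1 : τ.var 1 = m) (h13 : τ.var 13 = c) (hc : c ≤ Δ)
    (hj : j ≤ m) (hinv : TreeInv n m Δ a b N j τ)
    (hsurj : ∀ i, i < τ.var 2 → ∃ j', j' < j ∧ τ.arr 2 j' = i) :
    Runs W .renumber τ (50 * n + 200) fun ρ => TreeInv n m Δ a b N j ρ ∧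
      ∃ i, ρ.arr 10 c = i + 1 ∧ i < ρ.var 2 ∧
        ∀ i', i' < ρ.var 2 → i' ≠ i → ∃ j', j' < j ∧ ρ.arr 2 j' = i' := by
  obtain ⟨k, hk⟩ : ∃ k, τ.var 2 = k := ⟨_, rfl⟩
  refine Runs.ite (T' := 50 * n + 150) (fun he => ?_) (fun he => ?_) ?_
  · simp only [Expr.eval, h13, ne_eq, ite_eq_right_iff, one_ne_zero, imp_false, not_not] at he
    -- the colours that have a number are at most `Δ` in number
    have hkΔ : k ≤ Δ := by
      choose! d hd hdi using hinv.index
      have := Finset.card_le_card_of_injOn (s := Finset.range k)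
        (t := (Finset.range (Δ + 1)).erase c) d
        (fun i hi => by
          simp only [Finset.coe_range, Set.mem_Iio] at hi
          have h2 := hd i (by omega)
          have h3 := hdi i (by omega)
          simp only [Finset.coe_erase, Finset.coe_range, Set.mem_sdiff, Set.mem_Iio,
            Set.mem_singleton_iff]
          refine ⟨by omega, fun h => ?_⟩
          rw [h] at h3
          omega) (by
        intro i hi i' hi' h'
        simp only [Finset.coe_range, Set.mem_Iio] at hi hi'
        have h2 := hdi i (by omega)
        have h3 := hdi i' (by omega)
        rw [h'] at h2
        omega)
      rw [Finset.card_erase_of_mem (by simp; omega)] at this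
      simpa using this
    refine Runs.seq (T₁ := 20) (T₂ := 50 * n + 130)
      (Q := fun ρ => ρ = (τ.setVar 2 (k + 1)).setArr 10 c (k + 1))
      (Runs.of_safe ?_ (by decide) ?_) ?_ (by omega)
    · simp only [Prog.Safe, Prog.run, Expr.eval, State.setVar_var, Nat.reduceEqDiff, reduceIte,
        hk, h13]
      exact ⟨hW.le_word (by omega), hW.le_word (by omega), hW.le_word (by omega)⟩
    · simp only [Prog.run, Expr.eval, State.setVar_var, Nat.reduceEqDiff, reduceIte, hk, h13]
    rintro ρ - hρ
    have hρv : ∀ x, ρ.var x = if x = 2 then k + 1 else τ.var x := fun x => by simp [hρ]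
    have hρa : ∀ x, x ≠ 10 → ρ.arr x = τ.arr x := fun x hx => by simp [hρ, hx]
    have hρ10 : ρ.arr 10 = Function.update (τ.arr 10) c (k + 1) := by simp [hρ]
    clear hρ
    refine (runs_initTree (k := k + 1) hW (by simp [hρv, h0]) (by simp [hρv, h1]) (by simp [hρv])
      (by omega)).mono (by omega) ?_
    rintro π hfπ ⟨h3, h4, hin, hout⟩
    have hπ2 : π.var 2 = k + 1 := (hfπ.var 2 rfl).trans (by simp [hρv])
    have hπ10 : π.arr 10 = Function.update (τ.arr 10) c (k + 1) := (hfπ.arr 10 rfl).trans hρ10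
    have hπa2 : π.arr 2 = τ.arr 2 := (hfπ.arr 2 rfl).trans (hρa 2 (by omega))
    have hπa6 : π.arr 6 = τ.arr 6 := (hfπ.arr 6 rfl).trans (hρa 6 (by omega))
    rw [hρa 3 (by omega)] at h3
    rw [hρa 4 (by omega)] at h4
    rw [hρa 5 (by omega)] at hout
    have hidx : ∀ d, π.arr 10 d = if d = c then k + 1 else τ.arr 10 d := fun d => by
      rw [hπ10, Function.update_apply]
    have hle := hinv.index_le
    rw [hk] at hle
    refine ⟨⟨?_, ?_, ?_, ?_, ?_, ?_, ?_, ?_, ?_⟩, k, by simp [hidx], by omega, ?_⟩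
    · intro i hi
      by_cases hik : i = k
      · exact ⟨c, hc, by simp [hidx, hik]⟩
      · obtain ⟨d, hd, hdi⟩ := hinv.index i (by omega)
        refine ⟨d, hd, ?_⟩
        rw [hidx, if_neg, hdi]
        rintro rfl
        omega
    · intro d
      have := hle d
      rw [hidx, hπ2]
      split_ifs <;> omega
    · intro d d'
      have h5 := hle d
      have h6 := hle d'
      have h7 := @TreeInv.index_inj _ _ _ _ _ _ _ _ hinv d d'
      rw [hidx, hidx]
      grind
    · intro j' hj'
      obtain ⟨d, hd, hdi⟩ := hinv.colour j' hj'
      refine ⟨d, hd, ?_⟩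
      rw [hidx, if_neg, hdi, hπa2]
      rintro rfl
      omega
    · intro i hi
      rw [h3, Function.update_apply]
      split_ifs with h
      · rw [h]
      · exact hinv.offset i (by omega)
    · intro i hi
      rw [h4, Function.update_apply]
      split_ifs with h
      · omega
      · exact hinv.size_le i (by omega)
    · intro i hi
      rw [h4, Function.update_apply, hπa2]
      split_ifs with h
      · subst h
        refine .blank hin ?_
        rintro x y ⟨j', hj', hji, -⟩
        obtain ⟨d, hd, hdi⟩ := hinv.colour j' hj'
        have := hle d
        omega
      · refine (hinv.tree i (by omega)).congr (fun x hx => ?_) fun _ _ => Iff.rfl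
        have hs := hinv.size_le i (by omega)
        refine hout _ fun y hy h' => h ?_
        exact (stride_inj (by unfold stride; omega) (by unfold stride; omega) h').1
    · intro i hi x hx hx'
      rw [h4, Function.update_apply] at hx'
      rw [hπa6]
      split_ifs at hx' with h
      · omega
      · exact hinv.label_one i (by omega) x hx hx'
    · rw [hπa6]
      exact hinv.label_zero
    · intro i' hi' hne
      rw [hπa2]
      exact hsurj i' (by omega)
  · simp only [Expr.eval, h13, ite_eq_right_iff, one_ne_zero, imp_false] at he
    obtain ⟨i, hi⟩ : ∃ i, τ.arr 10 c = i + 1 := ⟨τ.arr 10 c - 1, by omega⟩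
    have := hinv.index_le c
    exact Runs.of_safe trivial (by simp [Prog.bound])
      ⟨hinv, i, hi, by simp only [Prog.run]; omega, fun i' hi' _ => hsurj i' hi'⟩
  · have : ((Expr.get 10 (.var 13)).eq (.const 0)).cost ≤ 40 := by decide
    omega

theorem runs_addToTree {τ : State} {j c i : ℕ} (hW : Fits W n m) (hΔ : Δ < n)
    (hin : EdgeInput n m Δ a b) (hN : PartialColouring (prefixGraph a b m) (Δ + 1) N F)
    (h0 : τ.var 0 = n) (h1 : τ.var 1 = m) (h3 : τ.var 3 = j) (h4 : τ.var 4 = a j)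
    (h5 : τ.var 5 = b j) (h13 : τ.var 13 = c) (hj : j < m) (hc : N (a j) c = b j + 1)
    (hi : τ.arr 10 c = i + 1) (hik : i < τ.var 2) (hinv : TreeInv n m Δ a b N j τ) :
    Runs W .addToTree τ 100 fun ρ => TreeInv n m Δ a b N (j + 1) ρ ∧ ρ.arr 10 = τ.arr 10 ∧
      ρ.arr 2 = Function.update (τ.arr 2) j i := by
  have hst : (n + m + 2) = stride n m := rfl
  have hlt : n + m + 2 ≤ stride n m := le_rfl
  have hcount := hinv.count_le
  have hu := hin.left_lt hj
  have hv := hin.right_lt hj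
  have hne := hin.ne hj
  have hsize := hinv.size_le i hik.le
  obtain ⟨s, hs⟩ : ∃ s, τ.arr 4 i = s := ⟨_, rfl⟩
  have hnn := hW.le
  have hrun : ∃ ρ, Prog.addToTree.run τ = ρ ∧ ρ.var 2 = τ.var 2 ∧ ρ.arr 10 = τ.arr 10 ∧
      ρ.arr 3 = τ.arr 3 ∧ ρ.arr 2 = Function.update (τ.arr 2) j i ∧
      ρ.arr 4 = Function.update (τ.arr 4) i (s + 1) ∧
      ρ.arr 5 = Function.update (Function.update (Function.update (τ.arr 5)
        (i * stride n m + a j) s) (i * stride n m + b j) s) (i * stride n m + s) n ∧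
      ρ.arr 6 = Function.update (τ.arr 6) (i * stride n m + s) 1 := by
    refine ⟨_, rfl, ?_⟩
    simp only [Prog.addToTree, Prog.run, Expr.eval, State.setVar_var, State.setArr_var,
      State.setVar_arr, State.setArr_arr, Nat.reduceEqDiff, reduceIte, h0, h1, h3, h4, h5, h13, hi,
      hst, hs, Nat.add_sub_cancel, and_self]
  refine Runs.of_safe ?_ (by decide) ?_
  · simp only [Prog.addToTree, Prog.Safe, Prog.run, Expr.eval, State.setVar_var, State.setArr_var,
      State.setVar_arr, State.setArr_arr, Nat.reduceEqDiff, reduceIte, h0, h1, h3, h4, h5, h13, hi,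
      hst, hs, Nat.add_sub_cancel]
    have hin' : i ≤ n := by omega
    exact ⟨hW.le_word (by omega), ⟨hW.le_word (by omega), hW.le_word (by omega)⟩,
      hW.stride_le (x := 0) hin' (by omega), hW.le_word (by omega),
      ⟨hW.stride_le hin' (by omega), hW.le_word (by omega)⟩,
      ⟨hW.stride_le hin' (by omega), hW.le_word (by omega)⟩,
      ⟨hW.stride_le hin' (by omega), hW.le_word (by omega)⟩,
      ⟨hW.stride_le hin' (by omega), hW.le_word (by omega)⟩,
      ⟨hW.le_word (by omega), hW.le_word (by omega)⟩⟩
  obtain ⟨ρ, hρ, hv2, h10, ha3, ha2, ha4, ha5, ha6⟩ := hrun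
  rw [hρ]
  have h2 : ∀ j', ρ.arr 2 j' = if j' = j then i else τ.arr 2 j' := fun j' => by
    rw [ha2, Function.update_apply]
  have hrel : ∀ i' x y, ClassRel a b (ρ.arr 2) (j + 1) i' x y ↔
      ClassRel a b (τ.arr 2) j i' x y ∨ (i' = i ∧ s(a j, b j) = s(x, y)) := by
    intro i' x y
    constructor
    · rintro ⟨j', hj', hκ, he⟩
      rw [h2] at hκ
      split_ifs at hκ with h
      · subst h
        exact Or.inr ⟨hκ.symm, he⟩
      · exact Or.inl ⟨j', by omega, hκ, he⟩
    · rintro (⟨j', hj', hκ, he⟩ | ⟨rfl, he⟩)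
      · exact ⟨j', by omega, by rw [h2, if_neg (by omega), hκ], he⟩
      · exact ⟨j, by omega, by rw [h2, if_pos rfl], he⟩
  -- the ends of the new edge are not yet covered by the matching
  have hfree : ∀ x y, N x c = y + 1 → s(x, y) = s(a j, b j) → ∀ w,
      ¬ ClassRel a b (τ.arr 2) j i x w := by
    rintro x y hxy he w ⟨j', hj', hκ, he'⟩
    obtain ⟨d, hd, hdi⟩ := hinv.colour j' hj'
    obtain rfl : d = c := hinv.index_inj (by rw [hdi, hi, hκ]) (by omega)
    have := hN.of_sym2 hd he'
    obtain rfl : y = w := by omega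
    have := hin.inj (by omega) hj (he'.trans he)
    omega
  refine ⟨⟨?_, ?_, ?_, ?_, ?_, ?_, ?_, ?_, ?_⟩, h10, ha2⟩
  · rw [hv2, h10]; exact hinv.index
  · rw [hv2, h10]; exact hinv.index_le
  · rw [h10]; exact hinv.index_inj
  · intro j' hj'
    rw [h2, h10]
    split_ifs with h
    · subst h
      exact ⟨c, hc, hi⟩
    · exact hinv.colour j' (by omega)
  · rw [hv2, ha3]; exact hinv.offset
  · intro i' hi'
    rw [ha4, Function.update_apply]
    have := hinv.size_le i' (by omega)
    split_ifs <;> omega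
  · intro i' hi'
    rw [ha4, Function.update_apply]
    have hsz := hinv.size_le i' (by omega)
    split_ifs with h
    · subst h
      have ht := hinv.tree i' (by omega)
      rw [hs] at ht
      refine ht.insert hu hv hne (fun w _ => hfree _ _ hc rfl w)
        (fun w _ => hfree _ _ (hN.symm hc) Sym2.eq_swap w) (fun x y => ?_) ?_
      · rw [hrel]
        simp
      · intro x hx
        simp only [ha5, Function.update_apply, Nat.add_left_cancel_iff]
        grind
    · refine (hinv.tree i' (by omega)).congr (fun x hx => ?_) fun x y => ?_
      · have key : ∀ y, y ≤ n + m + 1 → i' * stride n m + x ≠ i * stride n m + y :=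
          fun y hy h' => h (stride_inj (by omega) (by omega) h').1
        simp only [ha5, Function.update_apply]
        rw [if_neg (key s (by omega)), if_neg (key _ (by omega)), if_neg (key _ (by omega))]
      · rw [hrel]
        simp [h]
  · intro i' hi' x hx hx'
    rw [ha4, Function.update_apply] at hx'
    rw [ha6, Function.update_apply]
    split_ifs with h
    · rfl
    · refine hinv.label_one i' (by omega) x hx ?_
      split_ifs at hx' with h'
      · subst h'
        rcases Nat.lt_succ_iff_lt_or_eq.1 hx' with h'' | rfl
        · omega
        · exact (h rfl).elim
      · exact hx'
  · intro i' x hx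
    have := (hinv.tree i hik.le).lt
    rw [ha6, Function.update_apply, if_neg]
    · exact hinv.label_zero i' x hx
    · intro h
      have := (stride_inj (by omega) (by omega) h).2
      omega

/-- If there are no edges, the number of colours is 1 in the end, although no colour has occurred;
this is why the invariant is then stated with the register reset to 0. -/
theorem runs_buildTrees {σ : State} (hW : Fits W n m) (hΔ : Δ < n)
    (h0 : σ.var 0 = n) (h1 : σ.var 1 = m) (h2 : σ.var 2 = 0)
    (hin : EdgeInput n m Δ (σ.arr 0) (σ.arr 1))
    (hcol : Colours (prefixGraph (σ.arr 0) (σ.arr 1) m) (Δ + 1) σ)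
    (h6 : ∀ x, σ.arr 6 x = 0) (h10 : ∀ x, σ.arr 10 x = 0) :
    Runs W .buildTrees σ (m * (100 * n + 500) + (50 * n + 200)) fun τ =>
      TreeInv n m Δ (σ.arr 0) (σ.arr 1) (table (σ.arr 7)) m
        (if m = 0 then τ.setVar 2 0 else τ) ∧
      (m = 0 → τ.var 2 = 1) ∧
      (0 < m → 0 < τ.var 2 ∧ ∀ i, i < τ.var 2 → ∃ j, j < m ∧ τ.arr 2 j = i) := by
  have hN : PartialColouring (prefixGraph (σ.arr 0) (σ.arr 1) m) (Δ + 1) (table (σ.arr 7))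
    (σ.arr 8) := hcol
  have hnn := hW.le
  have hnp := hW.pos
  refine Runs.seq (T₁ := 50 * n + 100) (T₂ := m * (100 * n + 500) + 100)
    (runs_initTree hW h0 h1 h2 (by omega)) ?_ (by omega)
  rintro τ hfτ ⟨h3, h4, hin5, -⟩
  have hτ1 : τ.var 1 = m := (hfτ.var 1 rfl).trans h1
  have hτ2 : τ.var 2 = 0 := (hfτ.var 2 rfl).trans h2
  have hτ10 : ∀ x, τ.arr 10 x = 0 := by rw [hfτ.arr 10 rfl]; exact h10
  have hτ6 : ∀ x, τ.arr 6 x = 0 := by rw [hfτ.arr 6 rfl]; exact h6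
  refine Runs.seq (T₁ := m * (100 * n + 470 + 20) + 20) (T₂ := 80)
    (Q := fun ρ => TreeInv n m Δ (σ.arr 0) (σ.arr 1) (table (σ.arr 7)) m ρ ∧
      (∀ i, i < ρ.var 2 → ∃ j', j' < m ∧ ρ.arr 2 j' = i))
    (Runs.forEdges (m := m) (B := 100 * n + 470)
    (fun j ρ => TreeInv n m Δ (σ.arr 0) (σ.arr 1) (table (σ.arr 7)) j ρ ∧
      (∀ i, i < ρ.var 2 → ∃ j', j' < j ∧ ρ.arr 2 j' = i)) hτ1 (hW.le_word (by omega)) rfl rfl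
    ⟨?_, ?_⟩ ?_ le_rfl fun _ h => h) ?_ ?_
  · have h3' : τ.arr 3 0 = 0 := by rw [h3]; simp
    have h4' : τ.arr 4 0 = n + 1 := by rw [h4]; simp
    refine ⟨?_, ?_, ?_, ?_, ?_, ?_, ?_, ?_, ?_⟩
    · simp [hτ2]
    · simp [hτ10]
    · simp [hτ10]
    · simp
    · simp [hτ2, h3']
    · simp [hτ2, h4']
    · intro i hi
      obtain rfl : i = 0 := by simpa [hτ2] using hi
      simp only [State.setVar_arr, h4']
      refine .blank hin5 ?_
      rintro x y ⟨j', hj', -⟩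
      omega
    · intro i hi x hx hx'
      obtain rfl : i = 0 := by simpa [hτ2] using hi
      simp only [State.setVar_arr, h4'] at hx'
      omega
    · simp [hτ6]
  · simp [hτ2]
  · rintro j ρ hj hfρ hρ3 ⟨hinv, hsurj⟩
    have hρ0 : ρ.var 0 = n := (hfρ.var 0 rfl).trans ((hfτ.var 0 rfl).trans h0)
    have hρ1 : ρ.var 1 = m := (hfρ.var 1 rfl).trans hτ1
    have hρa0 : ρ.arr 0 = σ.arr 0 := (hfρ.arr 0 rfl).trans (hfτ.arr 0 rfl)
    have hρa1 : ρ.arr 1 = σ.arr 1 := (hfρ.arr 1 rfl).trans (hfτ.arr 1 rfl)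
    have hρa7 : ρ.arr 7 = σ.arr 7 := (hfρ.arr 7 rfl).trans (hfτ.arr 7 rfl)
    obtain ⟨u, hu⟩ : ∃ u, σ.arr 0 j = u := ⟨_, rfl⟩
    obtain ⟨v, hv⟩ : ∃ v, σ.arr 1 j = v := ⟨_, rfl⟩
    have hun := hin.left_lt hj
    have hvn := hin.right_lt hj
    rw [hu] at hun
    rw [hv] at hvn
    refine Runs.seq (T₁ := 20) (T₂ := 100 * n + 450)
      (Q := fun π => π = ((ρ.setVar 4 u).setVar 5 v).setVar 13 0)
      (Runs.of_safe ?_ (by decide) ?_) ?_ (by omega)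
    · simp only [Prog.Safe, Prog.run, Expr.eval, State.setVar_var, State.setVar_arr,
        Nat.reduceEqDiff, reduceIte, hρ3, hρa0, hρa1, hu, hv]
      exact ⟨hW.le_word (by omega), hW.le_word (by omega), hW.le_word (by omega)⟩
    · simp only [Prog.run, Expr.eval, State.setVar_var, State.setVar_arr,
        Nat.reduceEqDiff, reduceIte, hρ3, hρa0, hρa1, hu, hv]
    rintro π - rfl
    have hev : ∀ c, (Expr.eq (.eq (.nbr (.var 4) (.var 13)) (.add (.var 5) (.const 1)))
        (.const 0)).eval ((((ρ.setVar 4 u).setVar 5 v).setVar 13 0).setVar 13 c) = 0 ↔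
        table (σ.arr 7) u c = v + 1 := by
      intro c
      simp [Expr.eval, hρa7]
    refine Runs.seq (T₁ := 40 * n + 50) (T₂ := 60 * n + 400)
      (Q := fun π => ∃ c, c ≤ Δ ∧ table (σ.arr 7) u c = v + 1 ∧
        π = (((ρ.setVar 4 u).setVar 5 v).setVar 13 0).setVar 13 c)
      (Runs.search (c := 30) Δ (by simp) ?_ (hW.le_word (by omega)) (by decide) (by omega) ?_) ?_
      (by omega)
    · have hadj : (prefixGraph (σ.arr 0) (σ.arr 1) m).Adj u v :=
        ⟨by rw [← hu, ← hv]; exact hin.ne hj, j, hj, by rw [hu, hv]⟩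
      obtain ⟨c, hc⟩ := hN.adj.1 hadj
      exact ⟨c, Nat.le_of_lt_succ (hN.lt (by omega : table (σ.arr 7) u c ≠ 0)), (hev c).2 hc⟩
    · intro c hc h0 _
      exact ⟨c, hc, (hev c).1 h0, rfl⟩
    rintro π - ⟨c, hc, hcN, hπ⟩
    have hπv : ∀ x, π.var x = if x = 13 then c else if x = 5 then v else if x = 4 then u else
        ρ.var x := by
      intro x
      simp only [hπ, State.setVar_var]
      grind
    have hπa : π.arr = ρ.arr := by simp [hπ]
    clear hπ
    refine Runs.seq (T₁ := 50 * n + 200) (T₂ := 100)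
      (runs_renumber (m := m) (a := σ.arr 0) (b := σ.arr 1) (N := table (σ.arr 7)) (j := j) (c := c)
        hW hΔ (by simp [hπv, hρ0]) (by simp [hπv, hρ1]) (by simp [hπv]) hc hj.le ?_ ?_) ?_
      (by omega)
    · exact hinv.congr (by simp [hπv]) (by rw [hπa]) (by rw [hπa]) (by rw [hπa]) (by rw [hπa])
        (by rw [hπa]) (by rw [hπa])
    · simpa [hπv, hπa] using hsurj
    rintro μ hfμ ⟨hinvμ, i, hi, hik, hother⟩
    refine (runs_addToTree (m := m) (a := σ.arr 0) (b := σ.arr 1) (j := j) (c := c) (i := i) hW hΔ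
      hin hN ?_ ?_ ?_ ?_ ?_ ?_ hj ?_ hi hik hinvμ).mono le_rfl ?_
    · rw [hfμ.var 0 rfl]; simp [hπv, hρ0]
    · rw [hfμ.var 1 rfl]; simp [hπv, hρ1]
    · rw [hfμ.var 3 rfl]; simp [hπv, hρ3]
    · rw [hfμ.var 4 rfl]; simp [hπv, hu]
    · rw [hfμ.var 5 rfl]; simp [hπv, hv]
    · rw [hfμ.var 13 rfl]; simp [hπv]
    · rw [hu, hv, hcN]
    · rintro ν hfν ⟨hinvν, -, hν2⟩
      have hνv : ν.var 2 = μ.var 2 := hfν.var 2 rfl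
      refine ⟨hinvν.congr (by simp) rfl rfl rfl rfl rfl rfl, ?_⟩
      intro i' hi'
      simp only [State.setVar_var, Nat.reduceEqDiff, reduceIte, hνv] at hi'
      simp only [State.setVar_arr, hν2, Function.update_apply]
      by_cases hne : i' = i
      · exact ⟨j, by omega, by simp [hne]⟩
      · obtain ⟨j', hj', h⟩ := hother i' hi' hne
        exact ⟨j', by omega, by rw [if_neg (by omega), h]⟩
  · rintro ρ - ⟨hinv, hsurj⟩
    by_cases hm : m = 0
    · subst hm
      have hρ2 : ρ.var 2 = 0 := by
        by_contra h
        obtain ⟨j', hj', -⟩ := hsurj 0 (by omega)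
        omega
      refine Runs.of_safe ?_ (by decide) ?_
      · simp only [Prog.Safe, Expr.eval]
        exact ⟨fun _ => hW.le_word (by omega), fun _ => trivial⟩
      · simp only [Prog.run, Expr.eval, hρ2, reduceIte, one_ne_zero]
        refine ⟨hinv.congr (by simp [hρ2]) ?_ ?_ ?_ ?_ ?_ ?_, by simp, by simp⟩ <;> simp
    · have hρ2 : ρ.var 2 ≠ 0 := by
        obtain ⟨c, -, hc⟩ := hinv.colour 0 (by omega)
        have := hinv.index_le c
        omega
      refine Runs.of_safe ?_ (by decide) ?_
      · simp only [Prog.Safe, Expr.eval]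
        exact ⟨fun _ => hW.le_word (by omega), fun _ => trivial⟩
      · simp only [Prog.run, Expr.eval, hρ2, reduceIte, hm]
        exact ⟨hinv, by simp, fun _ => ⟨by omega, hsurj⟩⟩
  · have h : 100 * n + 470 + 20 ≤ 100 * n + 500 := by omega
    have := Nat.mul_le_mul (le_refl m) h
    linarith

end

/-! ### Proper edge colourings give cograph partitions -/

section

variable {V : Type u} {G : SimpleGraph V} {k : ℕ}

theorem mem_colourClass {φ : G.lineGraph.Coloring (Fin k)} {i : Fin k} {e : Sym2 V} :
    e ∈ colourClass φ i ↔ ∃ h : e ∈ G.edgeSet, φ ⟨e, h⟩ = i := Iff.rfl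

/-- Colour classes are matchings. -/
theorem colourClass_matching (φ : G.lineGraph.Coloring (Fin k)) (i : Fin k) {x y z : V}
    (hy : s(x, y) ∈ colourClass φ i) (hz : s(x, z) ∈ colourClass φ i) : y = z := by
  obtain ⟨hy, hyi⟩ := hy
  obtain ⟨hz, hzi⟩ := hz
  by_contra hne
  refine φ.valid (SimpleGraph.lineGraph_adj_iff_exists.2 ⟨?_, x, ?_, ?_⟩) (hyi.trans hzi.symm)
  · intro h
    exact hne (Sym2.congr_right.1 (congrArg Subtype.val h))
  · simp
  · simp

theorem isCographPartition [Finite V] [Nonempty V] (φ : G.lineGraph.Coloring (Fin k))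
    (h : k ≤ 1 ∨ ∀ i, (colourClass φ i).Nonempty) : IsCographPartition G (colourClass φ) := by
  have hdisj : ∀ i j, i ≠ j → Disjoint (colourClass φ i) (colourClass φ j) := by
    intro i j hij
    rw [Set.disjoint_left]
    rintro e ⟨he, hi⟩ ⟨_, hj⟩
    exact hij (hi.symm.trans hj)
  refine ⟨⟨?_, ?_, ?_⟩, hdisj⟩
  · intro i j hij
    rcases h with h | h
    · exact Fin.ext (by omega)
    · by_contra hne
      have := hdisj i j hne
      rw [← hij, disjoint_self] at this
      exact (h i).ne_empty this
  · ext e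
    simp only [Set.mem_iUnion, mem_colourClass]
    exact ⟨fun ⟨_, h, _⟩ => h, fun h => ⟨_, h, rfl⟩⟩
  · intro i
    refine .of_matching _ fun x y z hy hz => ?_
    rw [SimpleGraph.fromEdgeSet_adj] at hy hz
    exact colourClass_matching φ i hy.1 hz.1

theorem isRepresentedBy {φ : G.lineGraph.Coloring (Fin k)} {T : Fin k → Cotree V}
    (hT : ∀ i, (T i).graph = SimpleGraph.fromEdgeSet (colourClass φ i)) : IsRepresentedBy G T := by
  intro x y
  simp only [hT, SimpleGraph.fromEdgeSet_adj, mem_colourClass]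
  exact ⟨fun h => ⟨_, ⟨h, rfl⟩, h.ne⟩, fun ⟨_, ⟨h, _⟩, _⟩ => h⟩

/-- Renaming the leaves of a cotree. -/
def Cotree.rename {W : Type*} (T : Cotree W) (e : V ≃ W) : Cotree V where
  toRootedTree := T.toRootedTree
  leaf v := T.leaf (e v)
  leaf_injective := T.leaf_injective.comp e.injective
  range_leaf x := by
    rw [← T.range_leaf]
    exact ⟨fun ⟨v, hv⟩ => ⟨e v, hv⟩, fun ⟨w, hw⟩ => ⟨e.symm w, by simpa using hw⟩⟩
  two_children := T.two_children
  label := T.label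
  label_ne := T.label_ne

theorem Cotree.rename_adj {W : Type*} (T : Cotree W) (e : V ≃ W) (x y : V) :
    (T.rename e).graph.Adj x y ↔ T.graph.Adj (e x) (e y) :=
  and_congr_left fun _ => e.injective.ne_iff.symm

end

/-! ### The result of the program -/

/-- The memory `τ` holds the numbers below `k` of the colours of the edges `a j`, `b j` for `j < m`,
together with the cotrees `T` of the colour classes. -/
structure IsSolution (n m Δ : ℕ) (a b : ℕ → ℕ) (τ : State) {k : ℕ} (T : Fin k → Cotree (Fin n)) :
    Prop where
  pos : 1 ≤ k
  le : k ≤ Δ + 1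
  single : m = 0 → k = 1
  count : τ.var 2 = k
  lt : ∀ j, j < m → τ.arr 2 j < k
  surj : 0 < m → ∀ i, i < k → ∃ j, j < m ∧ τ.arr 2 j = i
  proper : ∀ j j', j < m → j' < m → τ.arr 2 j = τ.arr 2 j' →
    (∃ v, v ∈ s(a j, b j) ∧ v ∈ s(a j', b j')) → j = j'
  size : ∀ i : Fin k, τ.arr 4 i = (T i).size
  parent : ∀ (i : Fin k) (x : Fin (T i).size), τ.arr 5 (τ.arr 3 i + x) = (T i).parent x
  label : ∀ (i : Fin k) (x : Fin (T i).size),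
    τ.arr 6 (τ.arr 3 i + x) = if (T i).label x = true then 1 else 0
  leaf : ∀ (i : Fin k) (v : Fin n), ((T i).leaf v : ℕ) = v
  graph : ∀ (i : Fin k) (x y : Fin n), (T i).graph.Adj x y ↔ ClassRel a b (τ.arr 2) m i x y

/-- A cotree with the prescribed parents and labels in the memory. -/
theorem IsCotreeData.output {n s : ℕ} {P : ℕ → ℕ} {ℓ : ℕ → Bool} (h : IsCotreeData n s P ℓ) :
    ∃ T : Cotree (Fin n), T.size = s ∧ (∀ x : Fin T.size, (T.parent x : ℕ) = P x) ∧
      (∀ x : Fin T.size, T.label x = ℓ x) ∧ (∀ v, (T.leaf v : ℕ) = v) ∧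
      ∀ x y, T.graph.Adj x y ↔ x ≠ y ∧ ℓ (if P x = P y then P x else n) = true :=
  ⟨h.cotree, rfl, fun _ => rfl, fun _ => rfl, fun _ => rfl, h.graph_adj⟩

theorem TreeInv.isSolution {n m Δ : ℕ} {a b : ℕ → ℕ} {N : ℕ → ℕ → ℕ} {F : ℕ → ℕ} {τ : State}
    (hn : 3 ≤ n) (hin : EdgeInput n m Δ a b)
    (hN : PartialColouring (prefixGraph a b m) (Δ + 1) N F)
    (hinv : TreeInv n m Δ a b N m (if m = 0 then τ.setVar 2 0 else τ)) (h0 : m = 0 → τ.var 2 = 1)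
    (hpos : 0 < m → 0 < τ.var 2 ∧ ∀ i, i < τ.var 2 → ∃ j, j < m ∧ τ.arr 2 j = i) :
    ∃ (k : ℕ) (T : Fin k → Cotree (Fin n)), IsSolution n m Δ a b τ T := by
  obtain ⟨ρ, hρ⟩ : ∃ ρ, (if m = 0 then τ.setVar 2 0 else τ) = ρ := ⟨_, rfl⟩
  rw [hρ] at hinv
  have harr : ρ.arr = τ.arr := by
    rw [← hρ]
    split_ifs <;> simp
  have hvar : ∀ i, i < τ.var 2 → i ≤ ρ.var 2 := by
    intro i hi
    rw [← hρ]
    split_ifs with h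
    · have := h0 h
      omega
    · omega
  have hvar' : 0 < m → ρ.var 2 = τ.var 2 := by
    intro hm
    rw [← hρ, if_neg (by omega)]
  -- two edges of the same colour with a common end are equal
  have hmatch : ∀ i x y z, ClassRel a b (τ.arr 2) m i x y → ClassRel a b (τ.arr 2) m i x z →
      y = z := by
    rintro i x y z ⟨j, hj, hji, he⟩ ⟨j', hj', hji', he'⟩
    obtain ⟨c, hc, hci⟩ := hinv.colour j hj
    obtain ⟨c', hc', hci'⟩ := hinv.colour j' hj'
    rw [harr, hji] at hci
    rw [harr, hji'] at hci'
    obtain rfl : c = c' := hinv.index_inj (by rw [harr, hci, hci']) (by rw [harr]; omega)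
    have h1 := hN.of_sym2 hc he
    have h2 := hN.of_sym2 hc' he'
    omega
  have hT : ∀ i : Fin (τ.var 2), ∃ T : Cotree (Fin n), τ.arr 4 i = T.size ∧
      (∀ x : Fin T.size, τ.arr 5 (τ.arr 3 i + x) = T.parent x) ∧
      (∀ x : Fin T.size, τ.arr 6 (τ.arr 3 i + x) = if T.label x = true then 1 else 0) ∧
      (∀ v, (T.leaf v : ℕ) = v) ∧
      ∀ x y : Fin n, T.graph.Adj x y ↔ ClassRel a b (τ.arr 2) m i x y := by
    intro i
    have hi := hvar i i.2
    have htree := hinv.tree i hi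
    have hoff := hinv.offset i hi
    have hone := hinv.label_one i hi
    have hzero := hinv.label_zero i
    rw [harr] at htree hoff hone hzero
    set ℓ : ℕ → Bool := fun x => decide (τ.arr 6 (i * stride n m + x) = 1) with hℓ
    have hℓt : ∀ t, t < τ.arr 4 i → (ℓ t = true ↔ n < t) := by
      intro t ht
      simp only [hℓ, decide_eq_true_eq]
      rcases Nat.lt_or_ge n t with h | h
      · simp [h, hone t h ht]
      · simp [hzero t h, h]
    have hdata := htree.isCotreeData hn (hmatch i) fun t _ ht => hℓt t ht
    obtain ⟨T, hs, hP, hl, hleaf, hg⟩ := hdata.output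
    refine ⟨T, hs.symm, fun x => by rw [hP, hoff], fun x => ?_, hleaf, fun x y => ?_⟩
    · have hx : (x : ℕ) < τ.arr 4 i := hs ▸ x.2
      rw [hl, hoff]
      simp only [hℓt x hx]
      split_ifs with h
      · exact hone x h hx
      · exact hzero x (by omega)
    · rw [hg]
      have hx := htree.leaf x x.2
      have hlt := htree.lt
      by_cases hxy : x = y
      · subst hxy
        simp only [ne_eq, not_true_eq_false, false_and, false_iff]
        rintro ⟨j, hj, -, he⟩
        refine hin.ne hj ?_
        rcases Sym2.eq_iff.1 he with h | h <;> rw [h.1, h.2]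
      · have hxy' : (x : ℕ) ≠ y := fun h => hxy (Fin.ext h)
        rw [htree.adj x y x.2 y.2 hxy']
        simp only [ne_eq, hxy, not_false_eq_true, true_and]
        split_ifs with h
        · rw [hℓt _ hx.2]
          simp only [h, true_and]
          rw [h] at hx
          omega
        · rw [hℓt n hlt]
          simp [h]
  choose T hsize hparent hlabel hleaf hgraph using hT
  refine ⟨τ.var 2, T, ?_, ?_, h0, rfl, ?_, fun hm => (hpos hm).2, ?_, hsize, hparent, hlabel, hleaf,
    hgraph⟩
  · rcases Nat.eq_zero_or_pos m with h | h
    · exact (h0 h).ge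
    · exact (hpos h).1
  · rcases Nat.eq_zero_or_pos m with h | h
    · rw [h0 h]
      omega
    · rw [← hvar' h]
      exact hinv.count_le
  · intro j hj
    obtain ⟨c, -, hc⟩ := hinv.colour j hj
    have := hinv.index_le c
    rw [hvar' (by omega)] at this
    rw [harr] at hc this
    omega
  · rintro j j' hj hj' hκ ⟨v, hv, hv'⟩
    obtain ⟨w, hw⟩ := Sym2.mem_iff_exists.1 hv
    obtain ⟨w', hw'⟩ := Sym2.mem_iff_exists.1 hv'
    obtain rfl := hmatch _ _ _ _ ⟨j, hj, hκ, hw⟩ ⟨j', hj', rfl, hw'⟩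
    exact hin.inj hj hj' (hw.trans hw'.symm)

namespace Prog

/-- The graphs with at most two vertices: here the root is labelled by the number of edges. -/
def smallCase : Prog :=
  .seq (.assign 2 (.const 1)) <|
  .ite (.eq (.var 0) (.const 1)) (.store 4 (.const 0) (.const 1)) <|
    .seq (.store 4 (.const 0) (.const 3)) <|
    .seq (.store 5 (.const 0) (.const 2)) <|
    .seq (.store 5 (.const 1) (.const 2)) <|
    .seq (.store 5 (.const 2) (.const 2))
      (.store 6 (.const 2) (.var 1))

/-- The program that computes an edge colouring and the cotrees of the colour classes. -/
def main : Prog :=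
  .ite (.lt (.var 0) (.const 3)) smallCase (.seq (forEdges insertEdge) buildTrees)

end Prog

/-- Everything but the input is 0. -/
structure IsInitial (σ : State) : Prop where
  var_two : σ.var 2 = 0
  arr : ∀ a, 2 ≤ a → ∀ i, σ.arr a i = 0

theorem runs_smallCase {W n m Δ : ℕ} {σ : State} (hW : Fits W n m) (hn : n < 3)
    (h0 : σ.var 0 = n) (h1 : σ.var 1 = m) (hin : EdgeInput n m Δ (σ.arr 0) (σ.arr 1))
    (hσ : IsInitial σ) :
    Runs W .smallCase σ 40 fun τ => ∃ (k : ℕ) (T : Fin k → Cotree (Fin n)),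
      IsSolution n m Δ (σ.arr 0) (σ.arr 1) τ T := by
  have hpos := hW.pos
  have hnn := hW.le
  have hW4 : 4 ≤ W := hW.le_word (by nlinarith)
  have hmW : m ≤ W := hW.le_word (by omega)
  have h2 := hσ.arr 2 le_rfl
  -- all the edges join the vertices 0 and 1
  have hedge : ∀ j, j < m → n = 2 ∧ s(σ.arr 0 j, σ.arr 1 j) = s(0, 1) := by
    intro j hj
    have h3 := hin.left_lt hj
    have h4 := hin.right_lt hj
    have h5 := hin.ne hj
    refine ⟨by omega, ?_⟩
    rw [Sym2.eq_iff]
    omega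
  have hm : m ≤ 1 := by
    by_contra h
    have := hin.inj (j := 0) (j' := 1) (by omega) (by omega)
      ((hedge 0 (by omega)).2.trans (hedge 1 (by omega)).2.symm)
    omega
  refine Runs.of_safe ?_ (by decide) ?_
  · simp only [Prog.smallCase, Prog.Safe, Prog.run, Expr.eval, State.setVar_var, State.setArr_var,
      Nat.reduceEqDiff, reduceIte, h1]
    refine ⟨by omega, fun _ => ⟨by omega, by omega⟩, fun _ => ?_⟩
    simp only [hmW, and_true]
    omega
  · obtain rfl | rfl : n = 1 ∨ n = 2 := by omega
    · obtain rfl : m = 0 := by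
        by_contra h
        have := (hedge 0 (by omega)).1
        omega
      refine ⟨1, fun _ => Cotree.ofUnique, le_rfl, by omega, fun _ => rfl, ?_, by simp, by simp,
        by simp, ?_, ?_, ?_, ?_, ?_⟩
      · simp [Prog.smallCase, Prog.run, Expr.eval, h0]
      · intro i
        simp [Prog.smallCase, Prog.run, Expr.eval, h0, Cotree.ofUnique]
      · intro i x
        have hx : (x : ℕ) < 1 := x.2
        simp only [Prog.smallCase, Prog.run, Expr.eval, h0, State.setVar_var, State.setVar_arr,
          State.setArr_arr, Nat.reduceEqDiff, reduceIte, one_ne_zero, hσ.arr 5 (by omega)]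
        change 0 = (x : ℕ)
        omega
      · intro i x
        simp [Prog.smallCase, Prog.run, Expr.eval, h0, Cotree.ofUnique, hσ.arr 6 (by omega)]
      · intro i v
        rfl
      · intro i x y
        constructor
        · rintro ⟨h, -⟩
          exact (h (Subsingleton.elim _ _)).elim
        · rintro ⟨j, hj, -⟩
          omega
    · have hdata : IsCotreeData 2 3 (fun _ => 2) (fun x => decide (x = 2 ∧ m = 1)) := by
        refine ⟨by omega, by omega, by omega, ?_, by omega⟩
        intro t h3 h4
        exact ⟨0, 1, by omega, by omega, by omega, by omega, by omega, by omega, by omega⟩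
      obtain ⟨T, hs, hP, hl, hleaf, hg⟩ := hdata.output
      refine ⟨1, fun _ => T, le_rfl, by omega, fun _ => rfl, ?_, ?_, ?_, ?_, ?_, ?_, ?_, ?_, ?_⟩
      · simp [Prog.smallCase, Prog.run, Expr.eval, h0]
      · intro j hj
        simp [Prog.smallCase, Prog.run, Expr.eval, h0, h2]
      · intro hm i hi
        exact ⟨0, hm, by simp [Prog.smallCase, Prog.run, Expr.eval, h0, h2]; omega⟩
      · intro j j' hj hj' _ _
        omega
      · intro i
        simp [Prog.smallCase, Prog.run, Expr.eval, h0, hs]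
      · intro i x
        have hx : (x : ℕ) < 3 := hs ▸ x.2
        rw [hP]
        simp only [Prog.smallCase, Prog.run, Expr.eval, h0, State.setVar_var, State.setVar_arr,
          State.setArr_arr, Nat.reduceEqDiff, reduceIte, hσ.arr 3 (by omega),
          Function.update_apply]
        split_ifs <;> omega
      · intro i x
        have hx : (x : ℕ) < 3 := hs ▸ x.2
        rw [hl]
        simp only [Prog.smallCase, Prog.run, Expr.eval, h0, State.setVar_var, State.setVar_arr,
          State.setArr_arr, Nat.reduceEqDiff, reduceIte, hσ.arr 3 (by omega),
          State.setArr_var, Function.update_apply, hσ.arr 6 (by omega), h1]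
        simp only [zero_add, decide_eq_true_eq]
        split_ifs <;> omega
      · exact fun _ => hleaf
      · intro i x y
        rw [hg]
        simp only [ne_eq, reduceIte, true_and, decide_eq_true_eq]
        constructor
        · rintro ⟨hxy, rfl⟩
          refine ⟨0, by omega, ?_, (hedge 0 (by omega)).2.trans ?_⟩
          · simp [Prog.smallCase, Prog.run, Expr.eval, h0, h2]
          · rw [Sym2.eq_iff]
            omega
        · rintro ⟨j, hj, -, he⟩
          refine ⟨?_, by omega⟩
          rintro rfl
          rw [(hedge j hj).2, Sym2.eq_iff] at he
          omega

theorem runs_main {W n m Δ : ℕ} {σ : State} (hW : Fits W n m) (hΔ : Δ < n)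
    (h0 : σ.var 0 = n) (h1 : σ.var 1 = m) (hin : EdgeInput n m Δ (σ.arr 0) (σ.arr 1))
    (hσ : IsInitial σ) :
    Runs W .main σ (m * (1000 * n + 1520) + (50 * n + 250)) fun τ =>
      ∃ (k : ℕ) (T : Fin k → Cotree (Fin n)), IsSolution n m Δ (σ.arr 0) (σ.arr 1) τ T := by
  refine Runs.ite (T' := m * (1000 * n + 1520) + (50 * n + 240)) (fun he => ?_) (fun he => ?_) ?_
  · simp only [Expr.eval, h0, ne_eq, ite_eq_right_iff, one_ne_zero, imp_false, not_not] at he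
    exact (runs_smallCase hW he h0 h1 hin hσ).mono (by omega) fun _ _ h => h
  · simp only [Expr.eval, h0, ite_eq_right_iff, one_ne_zero, imp_false, not_lt] at he
    refine Runs.seq (runs_colourEdges hW hΔ h1 hin (hσ.arr 7 (by omega)) (hσ.arr 8 (by omega))
      (hσ.arr 9 (by omega))) (T₂ := m * (100 * n + 500) + (50 * n + 200)) ?_ (by linarith)
    intro τ hf hcol
    have ha : τ.arr 0 = σ.arr 0 := hf.arr 0 rfl
    have hb : τ.arr 1 = σ.arr 1 := hf.arr 1 rfl
    rw [← ha, ← hb] at hin hcol ⊢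
    refine (runs_buildTrees (m := m) hW hΔ ((hf.var 0 rfl).trans h0) ((hf.var 1 rfl).trans h1)
      ((hf.var 2 rfl).trans hσ.var_two) hin hcol ?_ ?_).mono le_rfl ?_
    · rw [hf.arr 6 rfl]
      exact hσ.arr 6 (by omega)
    · rw [hf.arr 10 rfl]
      exact hσ.arr 10 (by omega)
    · rintro ρ - ⟨h3, h4, h5⟩
      exact h3.isSolution he hin hcol h4 h5
  · have : ((Expr.var 0).lt (.const 3)).cost ≤ 5 := by decide
    omega

/-! ### Lists of edges -/

section

variable {n : ℕ} {G : SimpleGraph (Fin n)} {L : List (Fin n × Fin n)}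

theorem inputState_left {j : ℕ} (hj : j < L.length) :
    (inputState L).arr 0 j = (L[j].1 : ℕ) := by
  simp [inputState, hj]

theorem inputState_right {j : ℕ} (hj : j < L.length) :
    (inputState L).arr 1 j = (L[j].2 : ℕ) := by
  simp [inputState, hj]

theorem inputState_isInitial : IsInitial (inputState L) := by
  constructor
  · simp [inputState]
  · intro a ha i
    simp only [inputState]
    rw [if_neg (by omega), if_neg (by omega)]

theorem inputState_sym2 {j : ℕ} (hj : j < L.length) :
    s((inputState L).arr 0 j, (inputState L).arr 1 j) =
      (s(L[j].1, L[j].2)).map Fin.val := by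
  rw [inputState_left hj, inputState_right hj, Sym2.map_mk]

theorem IsEdgeList.mem (h : IsEdgeList G L) {j : ℕ} (hj : j < L.length) :
    s(L[j].1, L[j].2) ∈ G.edgeSet :=
  (h.2 _).1 (List.mem_map.2 ⟨L[j], List.getElem_mem hj, rfl⟩)

theorem IsEdgeList.exists_index (h : IsEdgeList G L) {e : Sym2 (Fin n)} (he : e ∈ G.edgeSet) :
    ∃ j, ∃ hj : j < L.length, s(L[j].1, L[j].2) = e := by
  obtain ⟨p, hp, rfl⟩ := List.mem_map.1 ((h.2 e).2 he)
  obtain ⟨j, hj, rfl⟩ := List.getElem_of_mem hp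
  exact ⟨j, hj, rfl⟩

theorem IsEdgeList.index_inj (h : IsEdgeList G L) {j j' : ℕ} (hj : j < L.length)
    (hj' : j' < L.length) (he : s(L[j].1, L[j].2) = s(L[j'].1, L[j'].2)) : j = j' := by
  refine (h.1.getElem_inj_iff (hi := by simpa using hj) (hj := by simpa using hj')).1 ?_
  simpa using he

theorem IsEdgeList.length_eq [DecidableRel G.Adj] (h : IsEdgeList G L) :
    L.length = G.edgeFinset.card := by
  classical
  rw [← List.length_map (fun p : Fin n × Fin n => s(p.1, p.2)), ← List.toFinset_card_of_nodup h.1]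
  congr 1
  ext e
  rw [List.mem_toFinset, h.2 e, SimpleGraph.mem_edgeFinset]

theorem IsEdgeList.edgeInput [DecidableRel G.Adj] (h : IsEdgeList G L) :
    EdgeInput n L.length G.maxDegree ((inputState L).arr 0) ((inputState L).arr 1) := by
  refine ⟨?_, ?_, ?_, ?_, ?_⟩
  · intro j hj
    rw [inputState_left hj]
    exact Fin.is_lt _
  · intro j hj
    rw [inputState_right hj]
    exact Fin.is_lt _
  · intro j hj
    rw [inputState_left hj, inputState_right hj]
    intro h'
    exact (G.mem_edgeSet.1 (h.mem hj)).ne (Fin.ext h')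
  · intro j j' hj hj' he
    rw [inputState_sym2 hj, inputState_sym2 hj'] at he
    exact h.index_inj hj hj' (Sym2.map.injective Fin.val_injective he)
  · intro v s hs
    rcases s.eq_empty_or_nonempty with rfl | ⟨w, hw⟩
    · simp
    have hadj : ∀ w ∈ s, ∃ v' w' : Fin n, (v' : ℕ) = v ∧ (w' : ℕ) = w ∧ G.Adj v' w' := by
      intro w hw
      obtain ⟨-, j, hj, he⟩ := hs w hw
      have hG := G.mem_edgeSet.1 (h.mem hj)
      rw [inputState_left hj, inputState_right hj] at he
      rcases Sym2.eq_iff.1 he with ⟨h1, h2⟩ | ⟨h1, h2⟩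
      · exact ⟨_, _, h1, h2, hG⟩
      · exact ⟨_, _, h2, h1, hG.symm⟩
    obtain ⟨v', -, rfl, -, -⟩ := hadj w hw
    refine le_trans ?_ (G.degree_le_maxDegree v')
    rw [← G.card_neighborFinset_eq_degree, ← Finset.card_map Fin.valEmbedding]
    refine Finset.card_le_card fun w hw => ?_
    obtain ⟨v'', w', hv, rfl, hG⟩ := hadj w hw
    obtain rfl := Fin.ext hv
    exact Finset.mem_map.2 ⟨w', by simpa using hG, rfl⟩

/-- The memory at the end determines an edge colouring. -/
theorem IsSolution.exists_colouring [DecidableRel G.Adj] {τ : State} {k : ℕ}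
    {T : Fin k → Cotree (Fin n)} (hn : 0 < n) (h : IsEdgeList G L)
    (hsol : IsSolution n L.length G.maxDegree ((inputState L).arr 0) ((inputState L).arr 1) τ T) :
    ∃ φ : G.lineGraph.Coloring (Fin k), IsOutput G L τ φ T ∧
      IsCographPartition G (colourClass φ) ∧
      (G ≠ ⊥ → ∀ i, (colourClass φ i).Nonempty) ∧
      (∀ i, (T i).graph = SimpleGraph.fromEdgeSet (colourClass φ i)) ∧ IsRepresentedBy G T := by
  have : Nonempty (Fin n) := ⟨⟨0, hn⟩⟩
  choose J hJ hJe using fun e : G.edgeSet => h.exists_index e.2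
  let φ : G.lineGraph.Coloring (Fin k) := SimpleGraph.Coloring.mk
    (fun e => ⟨τ.arr 2 (J e), hsol.lt _ (hJ e)⟩) (by
      intro e e' hadj heq
      obtain ⟨hne, v, hv, hv'⟩ := SimpleGraph.lineGraph_adj_iff_exists.1 hadj
      have := hsol.proper (J e) (J e') (hJ e) (hJ e') (congrArg Fin.val heq) ⟨v, by
        rw [inputState_sym2 (hJ e), hJe]
        exact Sym2.mem_map.2 ⟨v, hv, rfl⟩, by
        rw [inputState_sym2 (hJ e'), hJe]
        exact Sym2.mem_map.2 ⟨v, hv', rfl⟩⟩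
      refine hne (Subtype.ext ?_)
      rw [← hJe e, ← hJe e']
      simp only [this])
  have hφ : ∀ j (hj : j < L.length) (he : s(L[j].1, L[j].2) ∈ G.edgeSet),
      τ.arr 2 j = φ ⟨s(L[j].1, L[j].2), he⟩ := by
    intro j hj he
    have := h.index_inj (hJ ⟨_, he⟩) hj (hJe ⟨_, he⟩)
    change _ = τ.arr 2 (J ⟨s(L[j].1, L[j].2), he⟩)
    rw [this]
  have hclass : ∀ (i : Fin k) (e : Sym2 (Fin n)), e ∈ colourClass φ i ↔
      ∃ j, ∃ hj : j < L.length, τ.arr 2 j = i ∧ s(L[j].1, L[j].2) = e := by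
    intro i e
    rw [mem_colourClass]
    constructor
    · rintro ⟨he, rfl⟩
      obtain ⟨j, hj, rfl⟩ := h.exists_index he
      exact ⟨j, hj, hφ j hj he, rfl⟩
    · rintro ⟨j, hj, hji, rfl⟩
      exact ⟨h.mem hj, Fin.ext ((hφ j hj _).symm.trans hji)⟩
  have hne : 0 < L.length → ∀ i, (colourClass φ i).Nonempty := by
    intro hm i
    obtain ⟨j, hj, hji⟩ := hsol.surj hm i i.2
    exact ⟨_, (hclass i _).2 ⟨j, hj, hji, rfl⟩⟩
  have hT : ∀ i, (T i).graph = SimpleGraph.fromEdgeSet (colourClass φ i) := by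
    intro i
    ext x y
    rw [hsol.graph, SimpleGraph.fromEdgeSet_adj, hclass]
    constructor
    · rintro ⟨j, hj, hji, he⟩
      rw [inputState_sym2 hj, ← Sym2.map_mk] at he
      have he := Sym2.map.injective Fin.val_injective he
      refine ⟨⟨j, hj, hji, he⟩, ?_⟩
      have := h.mem hj
      rw [he] at this
      exact (G.mem_edgeSet.1 this).ne
    · rintro ⟨⟨j, hj, hji, he⟩, -⟩
      exact ⟨j, hj, hji, by rw [inputState_sym2 hj, he, Sym2.map_mk]⟩
  refine ⟨φ, ⟨hsol.count, hφ, hsol.size, hsol.parent, hsol.label, hsol.leaf⟩,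
    isCographPartition φ ?_, fun hG => hne ?_, hT, isRepresentedBy hT⟩
  · rcases Nat.eq_zero_or_pos L.length with h0 | h0
    · exact Or.inl (hsol.single h0).le
    · exact Or.inr (hne h0)
  · obtain ⟨x, y, hxy⟩ := SimpleGraph.ne_bot_iff_exists_adj.1 hG
    obtain ⟨j, hj, -⟩ := h.exists_index (G.mem_edgeSet.2 hxy)
    omega

end

/-! ### The program on all inputs -/

theorem fits_pow {n m C : ℕ} (hn : 0 < n) (hm : m ≤ n * n) (hC : 7 ≤ C) :
    Fits ((n + 1) ^ C) n m := by
  refine ⟨hn, hm, le_trans ?_ (Nat.pow_le_pow_right (by omega) hC)⟩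
  have h1 : n * n + 3 * n ≤ (n + 1) ^ 3 := by nlinarith
  have h2 := Nat.mul_le_mul h1 h1
  have h3 : 1 ≤ (n + 1) ^ 3 := Nat.one_le_pow _ _ (by omega)
  have h4 := Nat.mul_le_mul_left ((n + 1) ^ 3) h3
  have h5 : (n + 1) ^ 7 = (n + 1) ^ 3 * (n + 1) ^ 3 * (n + 1) := by ring
  have h6 := Nat.mul_le_mul_left ((n + 1) ^ 3 * (n + 1) ^ 3) (show 2 ≤ n + 1 by omega)
  omega

/-- The program `Prog.main` is correct, with words of `C * log (n + 1)` bits. -/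
theorem main_correct {n C : ℕ} (hC : 3000 ≤ C) (hn : 0 < n) (G : SimpleGraph (Fin n))
    [DecidableRel G.Adj] (L : List (Fin n × Fin n)) (hL : IsEdgeList G L) :
    ∃ (τ : State) (t : ℕ), Exec ((n + 1) ^ C) .main (inputState L) τ t ∧
      (0 < G.edgeFinset.card →
        t ≤ C * (n * G.edgeFinset.card + G.maxDegree * (n + G.edgeFinset.card))) ∧
      (G.edgeFinset.card = 0 → t ≤ C * n) ∧
      ∃ k : ℕ, 1 ≤ k ∧ k ≤ G.maxDegree + 1 ∧
        ∃ (φ : G.lineGraph.Coloring (Fin k)) (T : Fin k → Cotree (Fin n)),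
          IsOutput G L τ φ T ∧ IsCographPartition G (colourClass φ) ∧
          (G ≠ ⊥ → ∀ i, (colourClass φ i).Nonempty) ∧
          (∀ i, (T i).graph = SimpleGraph.fromEdgeSet (colourClass φ i)) ∧
          IsRepresentedBy G T := by
  have : Nonempty (Fin n) := ⟨⟨0, hn⟩⟩
  have hlen := hL.length_eq
  have hm : L.length ≤ n * n := by
    rw [hlen]
    refine G.card_edgeFinset_le_card_choose_two.trans ?_
    rw [Fintype.card_fin, Nat.choose_two_right]
    exact (Nat.div_le_self _ _).trans (Nat.mul_le_mul_left _ (Nat.sub_le _ _))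
  have hΔ : G.maxDegree < n := by simpa using G.maxDegree_lt_card_verts
  obtain ⟨τ, t, hexec, ht, k, T, hsol⟩ := runs_main (fits_pow (C := C) hn hm (by omega)) hΔ
    (σ := inputState L) (by simp [inputState]) (by simp [inputState]) hL.edgeInput
    inputState_isInitial
  obtain ⟨φ, h⟩ := hsol.exists_colouring hn hL
  rw [← hlen]
  refine ⟨τ, t, hexec, fun h0 => ht.trans ?_, fun h0 => ht.trans ?_, k, hsol.pos, hsol.le, φ, T, h⟩
  · refine le_trans ?_ (Nat.mul_le_mul hC (Nat.le_add_right _ _))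
    nlinarith [Nat.mul_le_mul hn h0, Nat.mul_le_mul_left n h0,
      Nat.mul_le_mul_right L.length hn]
  · rw [h0]
    refine le_trans ?_ (Nat.mul_le_mul_right n hC)
    linarith

theorem exists_isEdgeList {n : ℕ} (G : SimpleGraph (Fin n)) : ∃ L, IsEdgeList G L := by
  classical
  refine ⟨G.edgeFinset.toList.map Quot.out, ?_⟩
  have : (G.edgeFinset.toList.map Quot.out).map (fun p : Fin n × Fin n => s(p.1, p.2)) =
      G.edgeFinset.toList := by
    rw [List.map_map]
    refine (List.map_congr_left fun e _ => ?_).trans (List.map_id _)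
    exact Quot.out_eq e
  rw [IsEdgeList, this]
  exact ⟨Finset.nodup_toList _, fun e => by simp⟩

/-- The existence statement for arbitrary vertex sets follows from that for the sets `Fin n`. -/
theorem exists_cographPartition (V : Type u) [Fintype V] [Nonempty V] (G : SimpleGraph V)
    [DecidableRel G.Adj] :
    ∃ k : ℕ, 1 ≤ k ∧ k ≤ G.maxDegree + 1 ∧
      ∃ (φ : G.lineGraph.Coloring (Fin k)) (T : Fin k → Cotree V),
        IsCographPartition G (colourClass φ) ∧
        (G ≠ ⊥ → ∀ i, (colourClass φ i).Nonempty) ∧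
        (∀ i, (T i).graph = SimpleGraph.fromEdgeSet (colourClass φ i)) ∧
        IsRepresentedBy G T := by
  classical
  let e := Fintype.equivFin V
  let H : SimpleGraph (Fin (Fintype.card V)) := G.map e.toEmbedding
  let f : G ≃g H := SimpleGraph.Iso.map e G
  obtain ⟨L, hL⟩ := exists_isEdgeList H
  obtain ⟨-, -, -, -, -, k, h1, hk, φ, T, -, hpart, hne, hT, -⟩ :=
    main_correct (C := 3000) le_rfl Fintype.card_pos H L hL
  let ψ : G.lineGraph.Coloring (Fin k) := φ.comp f.lineGraph.toHom
  have hclass : ∀ i x y, s(x, y) ∈ colourClass ψ i ↔ s(e x, e y) ∈ colourClass φ i := by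
    intro i x y
    constructor
    · rintro ⟨h, hi⟩
      exact ⟨f.map_adj_iff.2 h, hi⟩
    · rintro ⟨h, hi⟩
      exact ⟨f.map_adj_iff.1 h, hi⟩
  have hT' : ∀ i, ((T i).rename e).graph = SimpleGraph.fromEdgeSet (colourClass ψ i) := by
    intro i
    ext x y
    rw [Cotree.rename_adj, hT, SimpleGraph.fromEdgeSet_adj, SimpleGraph.fromEdgeSet_adj, hclass,
      e.injective.ne_iff]
  have hne' : G ≠ ⊥ → ∀ i, (colourClass ψ i).Nonempty := by
    intro hG i
    obtain ⟨x, y, hxy⟩ := SimpleGraph.ne_bot_iff_exists_adj.1 hG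
    obtain ⟨d, hd⟩ := hne (SimpleGraph.ne_bot_iff_exists_adj.2 ⟨_, _, f.map_adj_iff.2 hxy⟩) i
    induction d using Sym2.ind with
    | _ x y =>
      refine ⟨s(e.symm x, e.symm y), (hclass _ _ _).2 ?_⟩
      simpa using hd
  refine ⟨k, h1, ?_, ψ, fun i => (T i).rename e, isCographPartition ψ ?_, hne', hT',
    isRepresentedBy hT'⟩
  · rwa [f.maxDegree_eq]
  · by_cases hG : G = ⊥
    · left
      have : G.maxDegree = 0 := by
        rw [SimpleGraph.maxDegree_eq_zero_iff, hG]
      rw [← f.maxDegree_eq] at hk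
      omega
    · exact Or.inr (hne' hG)

end CographDec

theorem mainTheorem4 :
    -- existence, for all finite graphs
    (∀ (V : Type u) [Fintype V] [Nonempty V] (G : SimpleGraph V) [DecidableRel G.Adj],
      ∃ k : ℕ, 1 ≤ k ∧ k ≤ G.maxDegree + 1 ∧
        ∃ (φ : G.lineGraph.Coloring (Fin k)) (T : Fin k → CographDec.Cotree V),
          CographDec.IsCographPartition G (CographDec.colourClass φ) ∧
          (G ≠ ⊥ → ∀ i, (CographDec.colourClass φ i).Nonempty) ∧
          (∀ i, (T i).graph = SimpleGraph.fromEdgeSet (CographDec.colourClass φ i)) ∧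
          CographDec.IsRepresentedBy G T) ∧
    -- one program computes all of this, with words of at most `C * log (n + 1)` bits
    (∃ (P : CographDec.Prog) (C : ℕ),
      ∀ (n : ℕ) (_ : 0 < n) (G : SimpleGraph (Fin n)) [DecidableRel G.Adj]
        (L : List (Fin n × Fin n)) (_ : CographDec.IsEdgeList G L),
        ∃ (τ : CographDec.State) (t : ℕ),
          CographDec.Exec ((n + 1) ^ C) P (CographDec.inputState L) τ t ∧
          (0 < G.edgeFinset.card →
            t ≤ C * (n * G.edgeFinset.card + G.maxDegree * (n + G.edgeFinset.card))) ∧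
          (G.edgeFinset.card = 0 → t ≤ C * n) ∧
          ∃ k : ℕ, 1 ≤ k ∧ k ≤ G.maxDegree + 1 ∧
            ∃ (φ : G.lineGraph.Coloring (Fin k)) (T : Fin k → CographDec.Cotree (Fin n)),
              CographDec.IsOutput G L τ φ T ∧
              CographDec.IsCographPartition G (CographDec.colourClass φ) ∧
              (G ≠ ⊥ → ∀ i, (CographDec.colourClass φ i).Nonempty) ∧
              (∀ i, (T i).graph = SimpleGraph.fromEdgeSet (CographDec.colourClass φ i)) ∧
              CographDec.IsRepresentedBy G T) :=
  ⟨CographDec.exists_cographPartition, .main, 3000, fun _ hn G _ L hL =>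
    CographDec.main_correct le_rfl hn G L hL⟩
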